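/- Let $M$ be a compact connected smooth $4$-manifold and let $(c,J_+,J_-)$ be a bi-Hermitian structure on $M$: $c$ is a conformal class of Riemannian metrics, and $J_+,J_-$ are integrable complex structures on $M$ which induce the same orientation and are orthogonal with respect to $c$. Suppose that $J_+(x)\neq J_-(x)$ for every $x\in M$ and that $J_+(x)\neq -J_-(x)$ for at least one $x\in M$. Put $J=J_+$ and let $S=(M,J)$ be the corresponding compact complex surface, with anti-canonical bundle $\mathcal K_S^*=\bigwedge^2(T^{1,0}M)$. Then there exist a closed real $1$-form $\theta$ on $M$, a smooth section $\sigma$ of $\bigwedge^2(T^{1,0}M)$ and a real $2$-form $\omega$ on $M$ such that, with $Q={\rm Re}(\sigma)$ regarded as a map $T^*M\to TM$ and $\omega$ regarded as the map $TM\to T^*M$, $X\mapsto\omega(X,\cdot)$: 1. $\bar\partial\sigma+\theta^{0,1}\otimes\sigma=0$. Equivalently, where $\theta=df$ locally, $e^{f}\sigma$ is holomorphic; that is, $\sigma$ is a holomorphic section of $\mathcal K_S^*\otimes\mathcal L$, where $\mathcal L=L\otimes\mathbb C$ and $L$ is the flat real line bundle determined by $[\theta]\in H^1_{dR}(M,\mathbb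 R)$. 2. $d\omega=\theta\wedge\omega$. Equivalently, where $\theta=df$ locally, $e^{-f}\omega$ is closed; that is, $\omega$ is a $d_{L^*}$-closed $2$-form with values in $L^*$. 3. The $J$-invariant part $F$ of $\omega$ is positive definite, i.e. $F(X,JX)>0$ for every tangent vector $X\neq0$. 4. $\omega J-J^*\omega+\omega Q\omega=0$, where $J^*\alpha=-\alpha\circ J$ for covectors $\alpha$. 5. $J_-=-J-Q\omega$. 6. The tensor $g=-\frac12\,\omega(J-J_-)$, i.e. $g(X,Y)=-\frac12\,\omega\big((J-J_-)X,Y\big)$, is a Riemannian metric and $c=[g]$. -/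

import Mathlib

open scoped Manifold ContDiff

noncomputable section

/-- The model space of real 4-manifolds. -/
abbrev E4 : Type := EuclideanSpace ℝ (Fin 4)

section FourManifold

variable (M : Type*) [TopologicalSpace M] [ChartedSpace E4 M] [IsManifold (𝓡 4) ∞ M]

/-! ### Tensor fields on a smooth 4-manifold -/

variable {M} in
/-- The differential at `x` of a map to a vector space (used for `ℂ` and `ℂ²`). -/
def cdiff {V : Type*} [NormedAddCommGroup V] [NormedSpace ℝ V] (u : M → V) (x : M) :
    TangentSpace (𝓡 4) x →L[ℝ] V :=
  mfderiv (𝓡 4) 𝓘(ℝ, V) u x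

/-- A complex structure on the 4-manifold `M`: a smooth almost complex structure `J` (that is,
`J² = -1`) which is integrable, i.e. `M` is covered by the domains of smooth coordinate charts
with values in `ℂ²` whose differentials intertwine `J` with multiplication by `i`. -/
structure CplxStructure where
  /-- the endomorphism of each tangent space -/
  J : ∀ x : M, TangentSpace (𝓡 4) x →L[ℝ] TangentSpace (𝓡 4) x
  smooth : ContMDiff (𝓡 4) ((𝓡 4).prod 𝓘(ℝ, E4 →L[ℝ] E4)) ∞
    (fun x ↦ Bundle.TotalSpace.mk' (E4 →L[ℝ] E4)
      (E := fun x : M ↦ TangentSpace (𝓡 4) x →L[ℝ] TangentSpace (𝓡 4) x) x (J x))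
  sq : ∀ (x : M) (v : TangentSpace (𝓡 4) x), J x (J x v) = -v
  integrable : ∀ x : M, ∃ φ : OpenPartialHomeomorph M (Fin 2 → ℂ), x ∈ φ.source ∧
    ContMDiffOn (𝓡 4) 𝓘(ℝ, Fin 2 → ℂ) ∞ φ φ.source ∧
    ContMDiffOn 𝓘(ℝ, Fin 2 → ℂ) (𝓡 4) ∞ φ.symm φ.target ∧
    ∀ y ∈ φ.source, ∀ v : TangentSpace (𝓡 4) y, cdiff φ y (J y v) = Complex.I • cdiff φ y v

/-- A smooth Riemannian metric on `M`. -/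
abbrev RMetric : Type _ :=
  Bundle.ContMDiffRiemannianMetric (𝓡 4) ∞ E4 (fun x : M ↦ TangentSpace (𝓡 4) x)

/-- Two Riemannian metrics are conformal if `g' = e^f g` for a smooth function `f`. -/
def conformalSetoid : Setoid (RMetric M) where
  r g g' := ∃ f : M → ℝ, ContMDiff (𝓡 4) 𝓘(ℝ, ℝ) ∞ f ∧
    ∀ (x : M) (v w : TangentSpace (𝓡 4) x), g'.inner x v w = Real.exp (f x) * g.inner x v w
  iseqv :=
    { refl := fun g ↦ ⟨fun _ ↦ 0, contMDiff_const, fun x v w ↦ by simp⟩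
      symm := by
        rintro g g' ⟨f, hf, h⟩
        refine ⟨fun x ↦ -f x, ?_, fun x v w ↦ ?_⟩
        · exact contDiff_neg.contMDiff.comp hf
        · rw [h, ← mul_assoc, ← Real.exp_add]; simp
      trans := by
        rintro g g' g'' ⟨f, hf, h⟩ ⟨f', hf', h'⟩
        refine ⟨fun x ↦ f' x + f x, hf'.add hf, fun x v w ↦ ?_⟩
        rw [h', h, ← mul_assoc, ← Real.exp_add] }

/-- A conformal class of Riemannian metrics on `M`. -/
def ConformalClass : Type _ := Quotient (conformalSetoid M)

variable {M} in
/-- The conformal class `[g]` of a metric `g`. -/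
def RMetric.conformalClass (g : RMetric M) : ConformalClass M :=
  Quotient.mk (conformalSetoid M) g

variable {M} in
/-- `J₁` and `J₂` induce the same orientation: every basis `(a, J₁ a, b, J₁ b)` and every basis
`(c, J₂ c, d, J₂ d)` of a tangent space have the same orientation. -/
def SameOrientation (J₁ J₂ : CplxStructure M) : Prop :=
  ∀ (x : M) (b₁ b₂ : Module.Basis (Fin 4) ℝ (TangentSpace (𝓡 4) x)),
    b₁ 1 = J₁.J x (b₁ 0) → b₁ 3 = J₁.J x (b₁ 2) →
    b₂ 1 = J₂.J x (b₂ 0) → b₂ 3 = J₂.J x (b₂ 2) → b₁.orientation = b₂.orientation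

/-- A bi-Hermitian structure `(c, J₊, J₋)`: two complex structures inducing the same orientation
and orthogonal with respect to (the metrics of) a conformal class `c`. -/
structure BiHermitian where
  c : ConformalClass M
  Jp : CplxStructure M
  Jm : CplxStructure M
  sameOrientation : SameOrientation Jp Jm
  orthogonal_p : ∀ g : RMetric M, g.conformalClass = c →
    ∀ (x : M) (v w : TangentSpace (𝓡 4) x), g.inner x (Jp.J x v) (Jp.J x w) = g.inner x v w
  orthogonal_m : ∀ g : RMetric M, g.conformalClass = c →
    ∀ (x : M) (v w : TangentSpace (𝓡 4) x), g.inner x (Jm.J x v) (Jm.J x w) = g.inner x v w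

/-- A smooth real 1-form. -/
structure OneForm where
  val : ∀ x : M, TangentSpace (𝓡 4) x →L[ℝ] ℝ
  smooth : ContMDiff (𝓡 4) ((𝓡 4).prod 𝓘(ℝ, E4 →L[ℝ] ℝ)) ∞
    (fun x ↦ Bundle.TotalSpace.mk' (E4 →L[ℝ] ℝ)
      (E := fun x : M ↦ TangentSpace (𝓡 4) x →L[ℝ] Bundle.Trivial M ℝ x) x (val x))

/-- A smooth real 2-form. It is also regarded as the map `TM → T*M`, `v ↦ Ω(v, ·)`. -/
structure TwoForm where
  val : ∀ x : M, TangentSpace (𝓡 4) x →L[ℝ] TangentSpace (𝓡 4) x →L[ℝ] ℝ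
  smooth : ContMDiff (𝓡 4) ((𝓡 4).prod 𝓘(ℝ, E4 →L[ℝ] E4 →L[ℝ] ℝ)) ∞
    (fun x ↦ Bundle.TotalSpace.mk' (E4 →L[ℝ] E4 →L[ℝ] ℝ)
      (E := fun x : M ↦ TangentSpace (𝓡 4) x →L[ℝ] TangentSpace (𝓡 4) x →L[ℝ]
        Bundle.Trivial M ℝ x) x (val x))
  alt : ∀ (x : M) (v : TangentSpace (𝓡 4) x), val x v v = 0

/-- A smooth section of `Λ²(TM) ⊗ ℂ`, given by its values on real covectors; it is smooth if its
values on smooth 1-forms are smooth functions. -/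
structure CplxBivector where
  val : ∀ x : M, (TangentSpace (𝓡 4) x →L[ℝ] ℝ) →L[ℝ] (TangentSpace (𝓡 4) x →L[ℝ] ℝ) →L[ℝ] ℂ
  smooth : ∀ α β : OneForm M, ContMDiff (𝓡 4) 𝓘(ℝ, ℂ) ∞ (fun x ↦ val x (α.val x) (β.val x))
  alt : ∀ (x : M) (α : TangentSpace (𝓡 4) x →L[ℝ] ℝ), val x α α = 0

variable {M}

/-! ### Exterior derivative and the Novikov differential `d_θ = d - θ ∧` -/

/-- Smooth vector fields. -/
def IsSmoothField (X : ∀ x : M, TangentSpace (𝓡 4) x) : Prop :=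
  ContMDiff (𝓡 4) ((𝓡 4).prod 𝓘(ℝ, E4)) ∞ (fun x ↦ (⟨x, X x⟩ : TangentBundle (𝓡 4) M))

/-- The derivative `X f` of a function along a vector field. -/
def alongField (X : ∀ x : M, TangentSpace (𝓡 4) x) (f : M → ℝ) (x : M) : ℝ :=
  mfderiv (𝓡 4) 𝓘(ℝ, ℝ) f x (X x)

/-- `(dθ)(X, Y) = X(θ(Y)) - Y(θ(X)) - θ([X, Y])`. -/
def OneForm.d (θ : OneForm M) (X Y : ∀ x : M, TangentSpace (𝓡 4) x) (x : M) : ℝ :=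
  alongField X (fun y ↦ θ.val y (Y y)) x - alongField Y (fun y ↦ θ.val y (X y)) x
    - θ.val x (VectorField.mlieBracket (𝓡 4) X Y x)

/-- The 1-form `θ` is closed. -/
def OneForm.IsClosed (θ : OneForm M) : Prop :=
  ∀ X Y : (∀ x : M, TangentSpace (𝓡 4) x), IsSmoothField X → IsSmoothField Y →
    ∀ x : M, θ.d X Y x = 0

/-- `(dΩ)(X, Y, Z)`, the cyclic sum of `X(Ω(Y, Z)) - Ω([X, Y], Z)`. -/
def TwoForm.d (Ω : TwoForm M) (X Y Z : ∀ x : M, TangentSpace (𝓡 4) x) (x : M) : ℝ :=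
  alongField X (fun y ↦ Ω.val y (Y y) (Z y)) x
    + alongField Y (fun y ↦ Ω.val y (Z y) (X y)) x
    + alongField Z (fun y ↦ Ω.val y (X y) (Y y)) x
    - Ω.val x (VectorField.mlieBracket (𝓡 4) X Y x) (Z x)
    - Ω.val x (VectorField.mlieBracket (𝓡 4) Y Z x) (X x)
    - Ω.val x (VectorField.mlieBracket (𝓡 4) Z X x) (Y x)

/-- `Ω` is `d_θ`-closed, that is `dΩ = θ ∧ Ω`. For a closed 1-form `θ`, `d_θ`-closed 2-forms are
the same as `d_{L*}`-closed 2-forms with values in `L*`, where `L` is the flat real line bundle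
of the class `[θ]`: where `θ = df`, the 2-form `e^{-f} Ω` is closed. -/
def TwoForm.IsTwistedClosed (Ω : TwoForm M) (θ : OneForm M) : Prop :=
  ∀ X Y Z : (∀ x : M, TangentSpace (𝓡 4) x),
    IsSmoothField X → IsSmoothField Y → IsSmoothField Z → ∀ x : M,
      Ω.d X Y Z x = θ.val x (X x) * Ω.val x (Y x) (Z x) + θ.val x (Y x) * Ω.val x (Z x) (X x)
        + θ.val x (Z x) * Ω.val x (X x) (Y x)

/-- The `J`-invariant part `½ (Ω(v, w) + Ω(Jv, Jw))` of a 2-form. -/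
def TwoForm.invariantPart (Ω : TwoForm M) (J : CplxStructure M) (x : M)
    (v w : TangentSpace (𝓡 4) x) : ℝ :=
  (1 / 2) * (Ω.val x v w + Ω.val x (J.J x v) (J.J x w))

/-- The `J`-invariant part `F` of `Ω` is positive definite: `F(v, Jv) > 0` for all `v ≠ 0`. -/
def TwoForm.IsTaming (Ω : TwoForm M) (J : CplxStructure M) : Prop :=
  ∀ (x : M) (v : TangentSpace (𝓡 4) x), v ≠ 0 → 0 < Ω.invariantPart J x v (J.J x v)

/-! ### Holomorphic functions and holomorphic sections of `K* ⊗ L` -/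

/-- `u` is holomorphic on the open set `U` of the complex surface `(M, J)`: `du ∘ J = i du`. -/
def IsHolomorphicOn (J : CplxStructure M) (u : M → ℂ) (U : Set M) : Prop :=
  ContMDiffOn (𝓡 4) 𝓘(ℝ, ℂ) ∞ u U ∧ ∀ y ∈ U, ∀ v : TangentSpace (𝓡 4) y,
    cdiff u y (J.J y v) = Complex.I * cdiff u y v

/-- The value `σ(α, β)` on complex-valued covectors (complex bilinear extension). -/
def CplxBivector.eval (σ : CplxBivector M) (x : M) (α β : TangentSpace (𝓡 4) x →L[ℝ] ℂ) : ℂ :=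
  σ.val x (Complex.reCLM.comp α) (Complex.reCLM.comp β)
    - σ.val x (Complex.imCLM.comp α) (Complex.imCLM.comp β)
    + Complex.I * (σ.val x (Complex.reCLM.comp α) (Complex.imCLM.comp β)
      + σ.val x (Complex.imCLM.comp α) (Complex.reCLM.comp β))

/-- `σ` is a section of `Λ²(T^{1,0}M)`, the anti-canonical bundle of `(M, J)`:
`σ(α ∘ J, β) = i σ(α, β)`. -/
def CplxBivector.IsTwoZero (σ : CplxBivector M) (J : CplxStructure M) : Prop :=
  ∀ (x : M) (α β : TangentSpace (𝓡 4) x →L[ℝ] ℝ),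
    σ.val x (α.comp (J.J x)) β = Complex.I * σ.val x α β

/-- `σ` is in the kernel of `∂̄_θ = ∂̄ + θ^{0,1} ⊗`: for local holomorphic functions `u`, `v`
(for instance holomorphic coordinates) the coefficient `s = σ(du, dv)` satisfies
`∂̄s + s θ^{0,1} = 0`, where `2 ∂̄s = ds + i ds ∘ J` and `2 θ^{0,1} = θ + i θ ∘ J`. -/
def CplxBivector.IsTwistedDbarClosed (σ : CplxBivector M) (J : CplxStructure M)
    (θ : OneForm M) : Prop :=
  ∀ (U : Set M) (u v : M → ℂ), IsOpen U → IsHolomorphicOn J u U → IsHolomorphicOn J v U →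
    ∀ y ∈ U, ∀ w : TangentSpace (𝓡 4) y,
      (cdiff (fun z ↦ σ.eval z (cdiff u z) (cdiff v z)) y w
        + Complex.I * cdiff (fun z ↦ σ.eval z (cdiff u z) (cdiff v z)) y (J.J y w))
        + σ.eval y (cdiff u y) (cdiff v y)
          * ((θ.val y w : ℂ) + Complex.I * (θ.val y (J.J y w) : ℂ)) = 0

/-- For a closed 1-form `θ`: `σ` is a holomorphic section of `K* ⊗ L`, where `K*` is the
anti-canonical bundle of `(M, J)` and `L` the flat holomorphic line bundle of real type
corresponding to the class `[θ]`; where `θ = df`, the section `e^f σ` of `K*` is holomorphic. -/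
def CplxBivector.IsHolomorphicSection (σ : CplxBivector M) (J : CplxStructure M)
    (θ : OneForm M) : Prop :=
  σ.IsTwoZero J ∧ σ.IsTwistedDbarClosed J θ

/-- `Q = Re σ`, where the real bivector `Re σ` is regarded as a map `T*M → TM`. -/
def CplxBivector.IsRealPart (σ : CplxBivector M)
    (Q : ∀ x : M, (TangentSpace (𝓡 4) x →L[ℝ] ℝ) →L[ℝ] TangentSpace (𝓡 4) x) : Prop :=
  ∀ (x : M) (α β : TangentSpace (𝓡 4) x →L[ℝ] ℝ), β (Q x α) = (σ.val x α β).re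

/-- The equation `Ω J - J* Ω + Ω Q Ω = 0` between maps `TM → T*M`, with `J* α = -α ∘ J`. -/
def SatisfiesQuadraticEq (Ω : TwoForm M) (J : CplxStructure M)
    (Q : ∀ x : M, (TangentSpace (𝓡 4) x →L[ℝ] ℝ) →L[ℝ] TangentSpace (𝓡 4) x) : Prop :=
  ∀ (x : M) (v : TangentSpace (𝓡 4) x),
    Ω.val x (J.J x v) - (-((Ω.val x v).comp (J.J x))) + Ω.val x (Q x (Ω.val x v)) = 0

end FourManifold

end

/-! At each point $J_+J_-+J_-J_+=-2p$ for a scalar $p$, because two orthogonal complex structures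
inducing the same orientation lie in one copy of the imaginary quaternions
(`exists_anticommutator_eq`); $p<1$ exactly where $J_+\neq J_-$. Hence
$\Omega=(1-p)^{-1}g((J_+-J_-)\cdot,\cdot)$ is a smooth 2-form. It tames $J_+$, it satisfies
$\Omega(J_-v,w)=\Omega(v,J_+w)$, and $(J_+-J_-)^2=-2(1-p)$ recovers $g$ from it
(`BiHermitian.exists_twoForm`). With $Q=-(J_++J_-)\Omega^{-1}$, the formula for $J_-$ and the
quadratic equation are pure algebra; $\sigma$ is the $(2,0)$-bivector with real part $Q$.

In dimension four, wedging with a nondegenerate 2-form is an isomorphism from 1-forms to 3-forms, so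
$d\Omega=\theta\wedge\Omega$ defines a unique $\theta$, the Lee form (`exists_isLeeForm`). If $u$ is
$J_+$-holomorphic, then $\Omega^{-1}du$ is of type $(1,0)$ for $J_-$. Integrability of $J_-$ keeps
the bracket of two such fields in that type, and transporting this back through $\Omega$ gives the
twisted equation $\bar\partial\sigma+\theta^{0,1}\otimes\sigma=0$ (`twisted_dbar_of_integrable`).

The global point is $d\theta=0$. Where the coefficient $h$ of $\sigma$ does not vanish,
$\theta^{0,1}=-\bar\partial\log h$, so $d\theta$ is $J_+$-invariant (`extd1_invariant`). The zeros
of $h$ are the points where $J_-=-J_+$. Unique continuation for the Cauchy-Riemann equation on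
complex lines, together with connectedness, shows that these points have empty interior, so
invariance holds everywhere by continuity (`TamedPair.dense_ne_neg`,
`TamedPair.extd1_lee_invariant`). Moreover $d^2\Omega=0$ forces $d\theta\wedge\Omega=0$. The wedge
square has Lorentzian signature on invariant 2-forms and the invariant part of $\Omega$ is timelike,
so $d\theta\wedge d\theta\le 0$, with equality only where $d\theta=0$ (`wedge22_self_nonpos`). By
Stokes the integral of $d\theta\wedge d\theta$ over $M$ vanishes, hence $d\theta=0$
(`density_self_eq_zero`). -/

noncomputable section

/-! ### Orthogonal complex structures on a four-dimensional Euclidean space -/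

section OrthogonalStructures

variable {V : Type*} [AddCommGroup V] [Module ℝ V]

/-- An orthonormal basis adapted to an orthogonal complex structure. -/
theorem exists_adapted_basis (hV : Module.finrank ℝ V = 4) (g : V →ₗ[ℝ] V →ₗ[ℝ] ℝ)
    (symm : ∀ v w, g v w = g w v) (pos : ∀ v, v ≠ 0 → 0 < g v v) (I : V →ₗ[ℝ] V)
    (sqI : ∀ v, I (I v) = -v) (orthI : ∀ v w, g (I v) (I w) = g v w) :
    ∃ b : Module.Basis (Fin 4) ℝ V, b 1 = I (b 0) ∧ b 3 = I (b 2) ∧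
      ∀ i j, g (b i) (b j) = if i = j then 1 else 0 := by
  have skew : ∀ v w, g (I v) w = -g v (I w) := fun v w ↦ by
    rw [← orthI v (I w), sqI, map_neg, neg_neg]
  have self : ∀ v, g v (I v) = 0 := fun v ↦ by
    have h := skew v v
    rw [symm (I v) v] at h; linarith
  have unit : ∀ v, v ≠ 0 → g ((√(g v v))⁻¹ • v) ((√(g v v))⁻¹ • v) = 1 := fun v hv ↦ by
    have h := pos v hv
    simp only [map_smul, LinearMap.smul_apply, smul_eq_mul]
    rw [← mul_assoc, ← mul_inv, Real.mul_self_sqrt h.le, inv_mul_cancel₀ h.ne']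
  have fin : FiniteDimensional ℝ V := Module.finite_of_finrank_pos (by omega)
  obtain ⟨v, hv⟩ : ∃ v : V, v ≠ 0 := by
    have : Nontrivial V := Module.nontrivial_of_finrank_pos (R := ℝ) (by omega)
    exact exists_ne 0
  obtain ⟨e, he⟩ : ∃ e : V, g e e = 1 := ⟨_, unit v hv⟩
  -- Two linear conditions on a four-dimensional space leave a nonzero vector orthogonal to both `e`
  -- and `I e`.
  obtain ⟨w, hw, hw'⟩ : ∃ w : V, w ≠ 0 ∧ (g e).prod (g (I e)) w = 0 := by
    have h := ((g e).prod (g (I e))).finrank_range_add_finrank_ker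
    have h' := Submodule.finrank_le (LinearMap.range ((g e).prod (g (I e))))
    have h2 : Module.finrank ℝ (ℝ × ℝ) = 2 := by simp
    have : 0 < Module.finrank ℝ (LinearMap.ker ((g e).prod (g (I e)))) := by omega
    have := Module.nontrivial_of_finrank_pos (R := ℝ) this
    obtain ⟨w, hw⟩ := exists_ne (0 : LinearMap.ker ((g e).prod (g (I e))))
    exact ⟨w, fun h ↦ hw (Subtype.ext h), w.2⟩
  have hw1 : g e w = 0 := congrArg Prod.fst hw'
  have hw2 : g (I e) w = 0 := congrArg Prod.snd hw'
  obtain ⟨f, hf, hef, hef'⟩ : ∃ f : V, g f f = 1 ∧ g e f = 0 ∧ g (I e) f = 0 :=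
    ⟨_, unit w hw, by simp [hw1], by simp [hw2]⟩
  have hef'' : g e (I f) = 0 := by rw [← neg_eq_zero, ← skew, hef']
  set b : Fin 4 → V := ![e, I e, f, I f] with hb
  have orth : ∀ i j, g (b i) (b j) = if i = j then 1 else 0 := by
    intro i j
    fin_cases i <;> fin_cases j <;>
      simp [hb, he, hf, hef, hef', hef'', self, orthI, symm f e, symm f (I e), symm (I f) e,
        symm (I e) e, symm (I f) f]
  have ind : LinearIndependent ℝ b := by
    rw [Fintype.linearIndependent_iff]
    intro c hc i
    have := congrArg (g (b i)) hc
    simpa [orth] using this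
  let B := basisOfLinearIndependentOfCardEqFinrank ind (by simp [hV])
  have hB : ⇑B = b := coe_basisOfLinearIndependentOfCardEqFinrank _ _
  refine ⟨B, ?_, ?_, ?_⟩ <;> rw [hB]
  · simp [hb]
  · simp [hb]
  · exact orth

/-- Two orthogonal complex structures which induce the same orientation anticommute up to a
scalar. -/
theorem exists_anticommutator_eq (hV : Module.finrank ℝ V = 4) (g : V →ₗ[ℝ] V →ₗ[ℝ] ℝ)
    (symm : ∀ v w, g v w = g w v) (pos : ∀ v, v ≠ 0 → 0 < g v v) (I J : V →ₗ[ℝ] V)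
    (sqI : ∀ v, I (I v) = -v) (sqJ : ∀ v, J (J v) = -v)
    (orthI : ∀ v w, g (I v) (I w) = g v w) (orthJ : ∀ v w, g (J v) (J w) = g v w)
    (same : ∀ b₁ b₂ : Module.Basis (Fin 4) ℝ V, b₁ 1 = I (b₁ 0) → b₁ 3 = I (b₁ 2) →
      b₂ 1 = J (b₂ 0) → b₂ 3 = J (b₂ 2) → b₁.orientation = b₂.orientation) :
    ∃ p : ℝ, ∀ v, I (J v) + J (I v) = (-2 * p) • v := by
  obtain ⟨b, h1, h3, orth⟩ := exists_adapted_basis hV g symm pos I sqI orthI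
  have skew : ∀ v w, g (J v) w = -g v (J w) := fun v w ↦ by
    rw [← orthJ v (J w), sqJ, map_neg, neg_neg]
  have coord : ∀ v, v = g (b 0) v • b 0 + g (b 1) v • b 1 + g (b 2) v • b 2 + g (b 3) v • b 3 := by
    intro v
    conv_lhs => rw [← b.sum_repr v]
    have : ∀ i, g (b i) v = b.repr v i := fun i ↦ by
      conv_lhs => rw [← b.sum_repr v]
      simp [-Module.Basis.sum_repr, orth]
    simp [-Module.Basis.sum_repr, Fin.sum_univ_four, this]
  have self : ∀ v, g v (J v) = 0 := fun v ↦ by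
    have h := skew v v
    rw [symm (J v) v] at h; linarith
  have anti : ∀ i j, g (b i) (J (b j)) = -g (b j) (J (b i)) := fun i j ↦ by
    rw [symm, skew]
  obtain ⟨x, hx⟩ : ∃ x, g (b 1) (J (b 0)) = x := ⟨_, rfl⟩
  obtain ⟨y, hy⟩ : ∃ y, g (b 2) (J (b 0)) = y := ⟨_, rfl⟩
  obtain ⟨z, hz⟩ : ∃ z, g (b 3) (J (b 0)) = z := ⟨_, rfl⟩
  obtain ⟨x', hx'⟩ : ∃ x', g (b 3) (J (b 2)) = x' := ⟨_, rfl⟩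
  obtain ⟨y', hy'⟩ : ∃ y', g (b 1) (J (b 3)) = y' := ⟨_, rfl⟩
  obtain ⟨z', hz'⟩ : ∃ z', g (b 2) (J (b 1)) = z' := ⟨_, rfl⟩
  have J0 : J (b 0) = x • b 1 + y • b 2 + z • b 3 := by
    conv_lhs => rw [coord (J (b 0))]
    rw [self, hx, hy, hz]; module
  have J1 : J (b 1) = -x • b 0 + z' • b 2 - y' • b 3 := by
    conv_lhs => rw [coord (J (b 1))]
    rw [self, anti 0 1, hx, anti 3 1, hy', hz']; module
  have J2 : J (b 2) = -y • b 0 - z' • b 1 + x' • b 3 := by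
    conv_lhs => rw [coord (J (b 2))]
    rw [self, anti 0 2, hy, anti 1 2, hz', hx']; module
  have J3 : J (b 3) = -z • b 0 + y' • b 1 - x' • b 2 := by
    conv_lhs => rw [coord (J (b 3))]
    rw [self, anti 0 3, hz, anti 2 3, hx', hy']; module
  have I0 : I (b 0) = b 1 := h1.symm
  have I1 : I (b 1) = -b 0 := by rw [h1, sqI]
  have I2 : I (b 2) = b 3 := h3.symm
  have I3 : I (b 3) = -b 2 := by rw [h3, sqI]
  have inn : ∀ i j, g (J (b i)) (J (b j)) = if i = j then 1 else 0 := fun i j ↦ by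
    rw [orthJ, orth]
  have n00 := inn 0 0
  have n11 := inn 1 1
  have n22 := inn 2 2
  have n33 := inn 3 3
  have n01 := inn 0 1
  have n02 := inn 0 2
  have n03 := inn 0 3
  have n12 := inn 1 2
  have n13 := inn 1 3
  have n23 := inn 2 3
  rw [J0] at n00 n01 n02 n03
  rw [J1] at n11 n01 n12 n13
  rw [J2] at n22 n02 n12 n23
  rw [J3] at n33 n03 n13 n23
  simp [orth] at n00 n11 n22 n33 n01 n02 n03 n12 n13 n23
  -- The skew matrix of an orthogonal complex structure is self-dual or anti-self-dual. Its Pfaffian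
  -- is `x * x' + y * y' + z * z'`; orthonormality of the images makes `(x', y', z')` the Pfaffian
  -- times `(x, y, z)` and the Pfaffian a sign.
  have ex : (x * x' + y * y' + z * z') * x = x' := by
    linear_combination x' * n00 + y * n03 - z * n02
  have ey : (x * x' + y * y' + z * z') * y = y' := by
    linear_combination y' * n00 - x * n03 + z * n01
  have ez : (x * x' + y * y' + z * z') * z = z' := by
    linear_combination z' * n00 + x * n02 - y * n01
  have pf : (x * x' + y * y' + z * z') ^ 2 = 1 := by
    linear_combination x' * ex + y' * ey + z' * ez + (n11 + n22 + n33 - n00) / 2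
  rcases sq_eq_sq_iff_eq_or_eq_neg.mp (pf.trans (one_pow 2).symm) with h | h
  all_goals rw [h] at ex ey ez
  -- In the self-dual case `J` is `x * I` plus a combination of two structures anticommuting with
  -- `I`, so only `x` survives in the anticommutator.
  · refine ⟨x, fun v ↦ ?_⟩
    suffices I ∘ₗ J + J ∘ₗ I = (-2 * x) • LinearMap.id from LinearMap.congr_fun this v
    refine b.ext fun i ↦ ?_
    subst ex ey ez
    fin_cases i <;> simp [I0, I1, I2, I3, J0, J1, J2, J3] <;> module
  · exfalso
    subst ex ey ez
    -- In the anti-self-dual case a negatively oriented basis adapted to `J` contradicts `same`. The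
    -- candidates `j = 1` and `j = 2` have determinants `-(y² + z²)` and `-(x² + z²)`, which cannot
    -- both vanish since `x² + y² + z² = 1`.
    have key : ∀ j : Fin 4, b.det ![b 0, J (b 0), b j, J (b j)] < 0 → False := fun j hj ↦ by
      obtain ⟨li, sp⟩ := (b.is_basis_iff_det (v := ![b 0, J (b 0), b j, J (b j)])).mpr
        hj.ne.isUnit
      have := same b (Module.Basis.mk li sp.ge) h1 h3 (by simp) (by simp)
      rw [b.orientation_eq_iff_det_pos, Module.Basis.coe_mk] at this
      exact lt_asymm this hj
    have d1 : b.det ![b 0, J (b 0), b 1, J (b 1)] = -(y ^ 2 + z ^ 2) := by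
      have : b.toMatrix ![b 0, J (b 0), b 1, J (b 1)] =
          !![1, 0, 0, -x; 0, x, 1, 0; 0, y, 0, -z; 0, z, 0, y] := by
        ext k l
        fin_cases k <;> fin_cases l <;>
          simp [Module.Basis.toMatrix_apply, J0, J1]
      rw [Module.Basis.det_apply, this, Matrix.det_succ_column_zero]
      simp [Fin.sum_univ_four, Matrix.det_fin_three]
      ring
    have d2 : b.det ![b 0, J (b 0), b 2, J (b 2)] = -(x ^ 2 + z ^ 2) := by
      have : b.toMatrix ![b 0, J (b 0), b 2, J (b 2)] =
          !![1, 0, 0, -y; 0, x, 0, z; 0, y, 1, 0; 0, z, 0, -x] := by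
        ext k l
        fin_cases k <;> fin_cases l <;>
          simp [Module.Basis.toMatrix_apply, J0, J2]
      rw [Module.Basis.det_apply, this, Matrix.det_succ_column_zero]
      simp [Fin.sum_univ_four, Matrix.det_fin_three]
      ring
    by_cases hyz : y ^ 2 + z ^ 2 = 0
    · exact key 2 (by rw [d2]; nlinarith [sq_nonneg y, sq_nonneg z])
    · exact key 1 (by rw [d1]; have : 0 ≤ y ^ 2 + z ^ 2 := by positivity
                      have := lt_of_le_of_ne this (Ne.symm hyz); linarith)

/-- Two distinct orthogonal complex structures `I`, `J` inducing the same orientation: for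
some `p < 1`, `g(Jv, Iv) = p g(v, v)`. -/
theorem anticommutator_lt_one (hV : Module.finrank ℝ V = 4) (g : V →ₗ[ℝ] V →ₗ[ℝ] ℝ)
    (symm : ∀ v w, g v w = g w v) (pos : ∀ v, v ≠ 0 → 0 < g v v) (I J : V →ₗ[ℝ] V)
    (sqI : ∀ v, I (I v) = -v) (sqJ : ∀ v, J (J v) = -v)
    (orthI : ∀ v w, g (I v) (I w) = g v w) (orthJ : ∀ v w, g (J v) (J w) = g v w)
    (same : ∀ b₁ b₂ : Module.Basis (Fin 4) ℝ V, b₁ 1 = I (b₁ 0) → b₁ 3 = I (b₁ 2) →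
      b₂ 1 = J (b₂ 0) → b₂ 3 = J (b₂ 2) → b₁.orientation = b₂.orientation) (hne : I ≠ J) :
    ∃ p : ℝ, p < 1 ∧ (∀ v, I (J v) + J (I v) = (-2 * p) • v) ∧
      ∀ v, g (J v) (I v) = p * g v v := by
  obtain ⟨p, hp⟩ := exists_anticommutator_eq hV g symm pos I J sqI sqJ orthI orthJ same
  have inner : ∀ v, g (J v) (I v) = p * g v v := fun v ↦ by
    have h1 : g (I (J v)) v = -g (J v) (I v) := by
      rw [← orthI (J v) (I v), sqI, map_neg, neg_neg]
    have h2 : g (J (I v)) v = -g (I v) (J v) := by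
      rw [← orthJ (I v) (J v), sqJ, map_neg, neg_neg]
    have h := congrArg (fun w ↦ g w v) (hp v)
    simp only [map_add, LinearMap.add_apply, h1, h2, map_smul, LinearMap.smul_apply,
      smul_eq_mul, symm (I v) (J v)] at h
    linarith
  refine ⟨p, ?_, hp, inner⟩
  obtain ⟨v, hv⟩ : ∃ v, I v - J v ≠ 0 := by
    by_contra! h
    exact hne (LinearMap.ext fun v ↦ sub_eq_zero.mp (h v))
  have hv0 : v ≠ 0 := fun h ↦ hv (by simp [h])
  have h1 := pos _ hv
  have h2 := pos _ hv0
  -- The left side is positive for a vector on which `I` and `J` differ, and this forces `p < 1`.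
  have h3 : g (I v - J v) (I v - J v) = 2 * (1 - p) * g v v := by
    simp only [map_sub, LinearMap.sub_apply, orthI, orthJ, symm (I v) (J v), inner]; ring
  rw [h3] at h1
  nlinarith

end OrthogonalStructures

/-! ### Unique continuation for `∂̄f = bf` in one complex variable -/

section UniqueContinuation

open Complex Metric

theorem HasFDerivAt.apply_vector {E F G : Type*} [NormedAddCommGroup E] [NormedSpace ℝ E]
    [NormedAddCommGroup F] [NormedSpace ℝ F] [NormedAddCommGroup G] [NormedSpace ℝ G]
    {L : E → F →L[ℝ] G} {L' : E →L[ℝ] F →L[ℝ] G} {x : E} (h : HasFDerivAt L L' x) (w : F) :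
    HasFDerivAt (fun y ↦ L y w) (L'.flip w) x :=
  (ContinuousLinearMap.apply ℝ G w).hasFDerivAt.comp x h

/-- With a positive second derivative the local maximum would also be a local minimum, so `q` would
be locally constant. -/
theorem second_derivative_test {q : ℝ → ℝ} (hq : ContDiffAt ℝ 2 q 0) (hmax : IsLocalMax q 0) :
    deriv (deriv q) 0 ≤ 0 := by
  by_contra! h
  have hmin := isLocalMin_of_deriv_deriv_pos h hmax.deriv_eq_zero hq.continuousAt
  have hconst : q =ᶠ[nhds 0] fun _ ↦ q 0 := by
    filter_upwards [hmax, hmin] with t h1 h2 using le_antisymm h1 h2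
  have : deriv q =ᶠ[nhds 0] fun _ ↦ 0 := by
    filter_upwards [hconst.deriv] with t ht
    rw [ht]; simp
  rw [this.deriv_eq] at h
  simp at h

theorem normSq_second_derivative {G : ℝ → ℂ} (hG : ContDiffAt ℝ 2 G 0)
    (hmax : IsLocalMax (fun t ↦ normSq (G t)) 0) :
    ((starRingEnd ℂ) (G 0) * deriv G 0).re = 0 ∧
      normSq (deriv G 0) + ((starRingEnd ℂ) (G 0) * deriv (deriv G) 0).re ≤ 0 := by
  have hd : ∀ᶠ t in nhds (0 : ℝ), HasDerivAt G (deriv G t) t := by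
    filter_upwards [hG.eventually (by simp)] with t ht
    exact (ht.differentiableAt (by simp)).hasDerivAt
  have hG' : ContDiffAt ℝ 1 (deriv G) 0 := by
    have := (hG.fderiv_right (m := 1) (by norm_num)).clm_apply contDiffAt_const
      (g := fun _ ↦ (1 : ℝ))
    simpa using this
  have hd2 : HasDerivAt (deriv G) (deriv (deriv G) 0) 0 :=
    (hG'.differentiableAt (by simp)).hasDerivAt
  have e : (fun t ↦ normSq (G t)) = fun t ↦ (G t).re * (G t).re + (G t).im * (G t).im := by
    ext t; rw [normSq_apply]
  have hre : ∀ {H : ℝ → ℂ} {H' : ℂ} {t : ℝ}, HasDerivAt H H' t →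
      HasDerivAt (fun t ↦ (H t).re) H'.re t := fun h ↦
    (Complex.reCLM.hasFDerivAt.comp_hasDerivAt _ h)
  have him : ∀ {H : ℝ → ℂ} {H' : ℂ} {t : ℝ}, HasDerivAt H H' t →
      HasDerivAt (fun t ↦ (H t).im) H'.im t := fun h ↦
    (Complex.imCLM.hasFDerivAt.comp_hasDerivAt _ h)
  have h1 : deriv (fun t ↦ normSq (G t)) =ᶠ[nhds 0]
      fun t ↦ 2 * ((G t).re * (deriv G t).re + (G t).im * (deriv G t).im) := by
    filter_upwards [hd] with t ht
    have h : HasDerivAt (fun t ↦ (G t).re * (G t).re + (G t).im * (G t).im) _ t :=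
      ((hre ht).mul (hre ht)).add ((him ht).mul (him ht))
    rw [e, h.deriv]
    ring
  have hq : ContDiffAt ℝ 2 (fun t ↦ normSq (G t)) 0 := by
    rw [e]
    have a : ContDiffAt ℝ 2 (fun t ↦ (G t).re) 0 := Complex.reCLM.contDiff.contDiffAt.comp 0 hG
    have b : ContDiffAt ℝ 2 (fun t ↦ (G t).im) 0 := Complex.imCLM.contDiff.contDiffAt.comp 0 hG
    exact (a.mul a).add (b.mul b)
  have s1 := hmax.deriv_eq_zero
  have s2 := second_derivative_test hq hmax
  rw [h1.eq_of_nhds] at s1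
  have ht := hd.self_of_nhds
  have h2 : HasDerivAt (fun t ↦ 2 * ((G t).re * (deriv G t).re + (G t).im * (deriv G t).im)) _ 0 :=
    (((hre ht).mul (hre hd2)).add ((him ht).mul (him hd2))).const_mul 2
  rw [h1.deriv_eq, h2.deriv] at s2
  constructor
  · simp only [mul_re, conj_re, conj_im]; linarith
  · simp only [mul_re, conj_re, conj_im, normSq_apply]; linarith

/-- At a local maximum of `|F|²`, where `F_x + iF_y = bF` and `F ≠ 0`, `Re (b_x - i b_y) ≤ 0`. -/
theorem dbar_local_max {F b : ℂ → ℂ} {t : ℂ} (hF : ContDiffAt ℝ 2 F t)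
    (hb : DifferentiableAt ℝ b t)
    (heq : ∀ᶠ s in nhds t, fderiv ℝ F s 1 + I * fderiv ℝ F s I = b s * F s)
    (hmax : IsLocalMax (fun s ↦ normSq (F s)) t) (h0 : F t ≠ 0) :
    (fderiv ℝ b t 1 - I * fderiv ℝ b t I).re ≤ 0 := by
  have hF' : DifferentiableAt ℝ (fderiv ℝ F) t :=
    (hF.fderiv_right (m := 1) (by norm_num)).differentiableAt (by simp)
  have hFd := hF.differentiableAt (by simp)
  -- Restriction to the real line through `t` with direction `d`: the first and second order
  -- conditions at the maximum, one direction at a time.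
  have line : ∀ d : ℂ, ((starRingEnd ℂ) (F t) * fderiv ℝ F t d).re = 0 ∧
      normSq (fderiv ℝ F t d) +
        ((starRingEnd ℂ) (F t) * fderiv ℝ (fderiv ℝ F) t d d).re ≤ 0 := by
    intro d
    have hl : ∀ s : ℝ, HasDerivAt (fun s : ℝ ↦ t + s • d) d s := fun s ↦ by
      simpa using ((hasDerivAt_id s).smul_const d).const_add t
    have hl0 : t + (0 : ℝ) • d = t := by simp
    have hlc : ContDiff ℝ 2 (fun s : ℝ ↦ t + s • d) := by fun_prop
    have tend : Filter.Tendsto (fun s : ℝ ↦ t + s • d) (nhds 0) (nhds t) := by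
      have := hlc.continuous.tendsto 0
      rwa [hl0] at this
    have hG : ContDiffAt ℝ 2 (fun s : ℝ ↦ F (t + s • d)) 0 := by
      have h := hF
      rw [← hl0] at h
      exact h.comp (0 : ℝ) hlc.contDiffAt
    have hm : IsLocalMax (fun s : ℝ ↦ normSq (F (t + s • d))) 0 := by
      have := tend.eventually hmax
      simpa [IsLocalMax, IsMaxFilter] using this
    have d1 : deriv (fun s : ℝ ↦ F (t + s • d)) =ᶠ[nhds 0] fun s ↦ fderiv ℝ F (t + s • d) d := by
      filter_upwards [tend.eventually (hF.eventually (by simp))] with s hs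
      exact ((hs.differentiableAt (by simp)).hasFDerivAt.comp_hasDerivAt s (hl s)).deriv
    have d2 : deriv (deriv (fun s : ℝ ↦ F (t + s • d))) 0 = fderiv ℝ (fderiv ℝ F) t d d := by
      rw [d1.deriv_eq]
      have h : HasFDerivAt (fderiv ℝ F) (fderiv ℝ (fderiv ℝ F) t) (t + (0 : ℝ) • d) := by
        rw [hl0]; exact hF'.hasFDerivAt
      exact ((h.apply_vector d).comp_hasDerivAt (0 : ℝ) (hl 0)).deriv
    have := normSq_second_derivative hG hm
    rwa [d2, d1.eq_of_nhds, hl0] at this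
  have sym : fderiv ℝ (fderiv ℝ F) t 1 I = fderiv ℝ (fderiv ℝ F) t I 1 :=
    (hF.isSymmSndFDerivAt (by simp)) 1 I
  have lap : ∀ d : ℂ, fderiv ℝ (fderiv ℝ F) t d 1 + I * fderiv ℝ (fderiv ℝ F) t d I =
      fderiv ℝ b t d * F t + b t * fderiv ℝ F t d := by
    intro d
    have e1 : HasFDerivAt (fun s ↦ fderiv ℝ F s 1 + I * fderiv ℝ F s I) _ t :=
      (hF'.hasFDerivAt.apply_vector 1).add ((hF'.hasFDerivAt.apply_vector I).const_mul I)
    have e2 := hb.hasFDerivAt.mul hFd.hasFDerivAt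
    have h := e1.unique (e2.congr_of_eventuallyEq heq)
    have := congrArg (fun L ↦ L d) h
    simp at this
    rw [this]; ring
  obtain ⟨x1, x2⟩ := line 1
  obtain ⟨y1, y2⟩ := line I
  have l1 := lap 1
  have l2 := lap I
  have h3 := heq.self_of_nhds
  rw [← sym] at l2
  -- Applying `∂_x - i∂_y` to the equation turns its left side into the Laplacian of `F`.
  have hL : fderiv ℝ (fderiv ℝ F) t 1 1 + fderiv ℝ (fderiv ℝ F) t I I =
      (fderiv ℝ b t 1 - I * fderiv ℝ b t I) * F t
        + b t * (fderiv ℝ F t 1 - I * fderiv ℝ F t I) := by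
    linear_combination l1 - I * l2 + (fderiv ℝ (fderiv ℝ F) t I I) * I_mul_I
  generalize fderiv ℝ (fderiv ℝ F) t 1 1 = P at *
  generalize fderiv ℝ (fderiv ℝ F) t I I = Q at *
  generalize fderiv ℝ b t 1 - I * fderiv ℝ b t I = B at *
  generalize fderiv ℝ F t 1 = p at *
  generalize fderiv ℝ F t I = q at *
  have hn : 0 < normSq (F t) := normSq_pos.mpr h0
  set c := (starRingEnd ℂ) (F t) with hc
  have hcF : c * F t = normSq (F t) := by rw [hc, mul_comm, mul_conj]
  -- The computation amounts to `Δ log|F| = Re(b_x - i b_y)`. At the maximum `c * p` and `c * q` are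
  -- purely imaginary, so the real part of the last product is `-|F|²(|p|² + |q|²)`. This cancels
  -- the gradient terms of the two second order inequalities and leaves `|F|⁴ Re B ≤ 0`.
  have key : normSq (F t) * (c * (P + Q)) = normSq (F t) * (normSq (F t) * B) +
      (c * (p + I * q)) * (c * (p - I * q)) := by
    rw [hL, h3, ← hcF]; ring
  have kre := congrArg Complex.re key
  have np : normSq (F t) * normSq p = (c * p).im ^ 2 := by
    have : normSq (c * p) = normSq (F t) * normSq p := by rw [normSq_mul, hc, normSq_conj]
    rw [← this, normSq_apply, x1]; ring
  have nq : normSq (F t) * normSq q = (c * q).im ^ 2 := by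
    have : normSq (c * q) = normSq (F t) * normSq q := by rw [normSq_mul, hc, normSq_conj]
    rw [← this, normSq_apply, y1]; ring
  have e3 : c * (p + I * q) * (c * (p - I * q)) = (c * p) ^ 2 + (c * q) ^ 2 := by
    linear_combination -c * c * q * q * I_mul_I
  rw [e3] at kre
  have e4 : ((c * p) ^ 2 + (c * q) ^ 2).re = -((c * p).im ^ 2 + (c * q).im ^ 2) := by
    rw [add_re, pow_two, pow_two, mul_re (c * p), mul_re (c * q), x1, y1]; ring
  rw [add_re, e4, re_ofReal_mul, re_ofReal_mul, re_ofReal_mul, mul_add, add_re] at kre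
  have e5 : normSq (F t) * (normSq (F t) * B.re) ≤ 0 := by nlinarith
  by_contra! hB
  have : 0 < normSq (F t) * (normSq (F t) * B.re) := by positivity
  linarith

/-- A solution of `f_x + i f_y = bf` on a disc which vanishes near the center vanishes. -/
theorem dbar_unique_continuation {f b : ℂ → ℂ} {R r : ℝ} (hR : 1 < R) (hr : 0 < r)
    (hf : ContDiffOn ℝ 2 f (ball 0 R)) (hb : ContDiffOn ℝ 1 b (ball 0 R))
    (heq : ∀ t ∈ ball (0 : ℂ) R, fderiv ℝ f t 1 + I * fderiv ℝ f t I = b t * f t)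
    (hzero : ∀ t ∈ ball (0 : ℂ) r, f t = 0) : f 1 = 0 := by
  by_contra h1
  obtain ⟨R', hR1, hR2⟩ := exists_between hR
  have hr1 : r ≤ 1 := by
    by_contra! h
    exact h1 (hzero 1 (by simpa using h))
  have hsub : closedBall (0 : ℂ) R' ⊆ ball 0 R := closedBall_subset_ball hR2
  have hcpt : IsCompact (closedBall (0 : ℂ) R') := isCompact_closedBall _ _
  have hnh : ∀ t ∈ ball (0 : ℂ) R, ball (0 : ℂ) R ∈ nhds t := fun t ht ↦ isOpen_ball.mem_nhds ht
  obtain ⟨C, hC⟩ := hcpt.exists_bound_of_continuousOn (hf.continuousOn.mono hsub)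
  have hb' : ContinuousOn (fun t ↦ fderiv ℝ b t 1 - I * fderiv ℝ b t I) (closedBall 0 R') := by
    have := (hb.continuousOn_fderiv_of_isOpen isOpen_ball (by simp)).mono hsub
    exact (this.clm_apply continuousOn_const).sub
      (continuousOn_const.mul (this.clm_apply continuousOn_const))
  obtain ⟨K, hK⟩ := hcpt.exists_bound_of_continuousOn hb'
  set κ : ℝ := |K| + 1 with hκ
  have hκ0 : 0 < κ := by positivity
  -- A Carleman weight: multiplying `f` by `exp(κ|t|²)` adds `2κt` to `b`, hence `4κ` to `Re(b_x - i
  -- b_y)`. Since `κ = |K| + 1`, the sum is positive and `dbar_local_max` excludes interior maxima.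
  let E : ℂ → ℂ := fun t ↦ cexp (κ * (t * (starRingEnd ℂ) t))
  have hEn : ∀ t, ‖E t‖ = Real.exp (κ * ‖t‖ ^ 2) := fun t ↦ by
    rw [Complex.norm_exp, mul_conj, normSq_eq_norm_sq, ← ofReal_mul, ofReal_re]
  have hEsm : ContDiff ℝ 2 E := by
    have : ContDiff ℝ 2 (starRingEnd ℂ : ℂ → ℂ) := Complex.conjCLE.contDiff
    have : ContDiff ℝ 2 fun t : ℂ ↦ (κ : ℂ) * (t * (starRingEnd ℂ) t) :=
      contDiff_const.mul (contDiff_id.mul this)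
    exact this.cexp
  have hE : ∀ t, fderiv ℝ E t 1 + I * fderiv ℝ E t I = 2 * κ * t * E t := by
    intro t
    have h0 : HasFDerivAt (starRingEnd ℂ : ℂ → ℂ) (Complex.conjCLE : ℂ →L[ℝ] ℂ) t :=
      Complex.conjCLE.hasFDerivAt
    have := (((hasFDerivAt_id t).mul h0).const_mul (κ : ℂ)).cexp
    rw [show fderiv ℝ E t = _ from this.fderiv]
    simp
    linear_combination (-(κ : ℂ) * t + κ * (starRingEnd ℂ) t) * E t * I_mul_I
  -- Division by `t^N` leaves the equation unchanged, as `t^(-N)` is holomorphic away from `0`. For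
  -- large `N` it makes `|F|` on the circle of radius `R'` smaller than `|F(1)|`.
  obtain ⟨N, hN⟩ : ∃ N : ℕ, |C| * Real.exp (κ * R' ^ 2) * (R'⁻¹) ^ N < ‖f 1‖ * Real.exp κ := by
    have ht := (tendsto_pow_atTop_nhds_zero_of_lt_one (r := R'⁻¹) (by positivity)
      (inv_lt_one_of_one_lt₀ hR1)).const_mul (|C| * Real.exp (κ * R' ^ 2))
    rw [mul_zero] at ht
    exact (ht.eventually (gt_mem_nhds (by positivity))).exists
  let m : ℂ → ℂ := fun t ↦ (t ^ N)⁻¹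
  have hm : ∀ t ≠ 0, DifferentiableAt ℂ m t := fun t ht ↦
    (differentiableAt_id.pow N).inv (pow_ne_zero N ht)
  have hmsm : ∀ t ≠ 0, ContDiffAt ℝ 2 m t := fun t ht ↦
    (contDiffAt_id.pow N).inv (pow_ne_zero N ht)
  have hmeq : ∀ t ≠ 0, fderiv ℝ m t 1 + I * fderiv ℝ m t I = 0 := by
    intro t ht
    have := (hm t ht).hasDerivAt.hasFDerivAt.restrictScalars ℝ
    rw [this.fderiv]
    simp
    linear_combination (deriv m t) * I_mul_I
  let F : ℂ → ℂ := fun t ↦ f t * E t * m t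
  have hFsm : ∀ t ∈ ball (0 : ℂ) R, t ≠ 0 → ContDiffAt ℝ 2 F t := fun t ht ht0 ↦
    ((hf.contDiffAt (hnh t ht)).mul hEsm.contDiffAt).mul (hmsm t ht0)
  have hFeq : ∀ t ∈ ball (0 : ℂ) R, t ≠ 0 →
      fderiv ℝ F t 1 + I * fderiv ℝ F t I = (b t + 2 * κ * t) * F t := by
    intro t ht ht0
    have df := ((hf.contDiffAt (hnh t ht)).differentiableAt (by simp)).hasFDerivAt
    have dE := (hEsm.contDiffAt.differentiableAt (x := t) (by simp)).hasFDerivAt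
    have dm := ((hmsm t ht0).differentiableAt (by simp)).hasFDerivAt
    rw [show fderiv ℝ F t = _ from ((df.mul dE).mul dm).fderiv]
    simp
    linear_combination f t * E t * hmeq t ht0 + m t * f t * hE t + m t * E t * heq t ht
  -- The radius `r / 2` keeps the pole at `0` out of the annulus. A maximum point with `F ≠ 0` has
  -- modulus at least `r`, so it is off the inner boundary.
  let A : Set ℂ := closedBall 0 R' \ ball 0 (r / 2)
  have hA : IsCompact A := hcpt.diff isOpen_ball
  have hA0 : ∀ t ∈ A, t ≠ 0 := by
    rintro t ⟨-, ht⟩ rfl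
    exact ht (by simpa using hr)
  have h1A : (1 : ℂ) ∈ A := ⟨by simpa using hR1.le, by simp; linarith⟩
  have hcont : ContinuousOn (fun t ↦ ‖F t‖) A := fun t ht ↦
    (hFsm t (hsub ht.1) (hA0 t ht)).continuousAt.norm.continuousWithinAt
  obtain ⟨t, htA, htmax⟩ := hA.exists_isMaxOn ⟨1, h1A⟩ hcont
  have hF1 : ‖F 1‖ = ‖f 1‖ * Real.exp κ := by
    simp only [F, m, norm_mul, hEn]; simp
  have hFt : ‖F 1‖ ≤ ‖F t‖ := htmax h1A
  have hpos : 0 < ‖F 1‖ := by rw [hF1]; positivity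
  have hFt0 : F t ≠ 0 := norm_pos_iff.mp (hpos.trans_le hFt)
  have hft0 : f t ≠ 0 := fun h ↦ hFt0 (by simp [F, h])
  have htr : r ≤ ‖t‖ := by
    by_contra! h
    exact hft0 (hzero t (by simpa using h))
  have htR : ‖t‖ ≤ R' := by simpa using htA.1
  rcases htR.lt_or_eq with hlt | heqR
  · have hmem : A ∈ nhds t := by
      have h1 : ball (0 : ℂ) R' \ closedBall 0 (r / 2) ∈ nhds t :=
        (isOpen_ball.sdiff isClosed_closedBall).mem_nhds
          ⟨by simpa using hlt, by simp; linarith⟩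
      exact Filter.mem_of_superset h1 fun s hs ↦
        ⟨ball_subset_closedBall hs.1, fun h ↦ hs.2 (ball_subset_closedBall h)⟩
    have hloc : IsLocalMax (fun s ↦ normSq (F s)) t := by
      filter_upwards [hmem] with s hs
      rw [normSq_eq_norm_sq, normSq_eq_norm_sq]
      exact pow_le_pow_left₀ (norm_nonneg _) (htmax hs) 2
    have htball := hsub htA.1
    have hbd : DifferentiableAt ℝ b t := (hb.contDiffAt (hnh t htball)).differentiableAt (by simp)
    have hlin : HasFDerivAt (fun t : ℂ ↦ (2 * κ * t : ℂ)) _ t :=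
      (hasFDerivAt_id (𝕜 := ℝ) t).const_mul (2 * κ : ℂ)
    have hev : ∀ᶠ s in nhds t, fderiv ℝ F s 1 + I * fderiv ℝ F s I
        = (b s + 2 * κ * s) * F s := by
      filter_upwards [hmem] with s hs using hFeq s (hsub hs.1) (hA0 s hs)
    have := dbar_local_max (hFsm t htball (hA0 t htA)) (hbd.add hlin.differentiableAt) hev hloc hFt0
    rw [(hbd.hasFDerivAt.add hlin).fderiv] at this
    have hKt := (abs_le.mp ((abs_re_le_norm _).trans (hK t htA.1))).1
    simp at this hKt
    have := le_abs_self K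
    linarith
  · have : ‖F t‖ ≤ |C| * Real.exp (κ * R' ^ 2) * (R'⁻¹) ^ N := by
      simp only [F, m, norm_mul, hEn, norm_inv, norm_pow, heqR, inv_pow]
      gcongr
      exact (hC t htA.1).trans (le_abs_self C)
    linarith

end UniqueContinuation

/-! ### Exterior calculus of 1-forms and 2-forms on a normed space -/

section ExteriorCalculus

variable {V : Type*} [NormedAddCommGroup V] [NormedSpace ℝ V]
variable {W : Type*} [NormedAddCommGroup W] [NormedSpace ℝ W]

/-- The exterior derivative of a 1-form. -/
def extd1 (η : V → V →L[ℝ] ℝ) (x : V) : V →L[ℝ] V →L[ℝ] ℝ :=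
  fderiv ℝ η x - (fderiv ℝ η x).flip

/-- The exterior derivative of a 2-form. -/
def extd2 (Ω : V → V →L[ℝ] V →L[ℝ] ℝ) (x a b c : V) : ℝ :=
  fderiv ℝ Ω x a b c + fderiv ℝ Ω x b c a + fderiv ℝ Ω x c a b

theorem extd1_apply (η : V → V →L[ℝ] ℝ) (x v w : V) :
    extd1 η x v w = fderiv ℝ η x v w - fderiv ℝ η x w v := rfl

/-- The wedge product of a 1-form and a 2-form. -/
def wedge12 (θ : V →L[ℝ] ℝ) (Ω : V →L[ℝ] V →L[ℝ] ℝ) (a b c : V) : ℝ :=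
  θ a * Ω b c + θ b * Ω c a + θ c * Ω a b

/-- The wedge product of two 2-forms. -/
def wedge22 (B C : V →L[ℝ] V →L[ℝ] ℝ) (a b c d : V) : ℝ :=
  B a b * C c d - B a c * C b d + B a d * C b c + B c d * C a b - B b d * C a c + B b c * C a d

theorem skew_of_alt {Ω : V →L[ℝ] V →L[ℝ] ℝ} (h : ∀ v, Ω v v = 0) (v w : V) :
    Ω v w = -Ω w v := by
  have := h (v + w)
  simp only [map_add, add_apply, h] at this
  linarith

theorem fderiv_alt {Ω : V → V →L[ℝ] V →L[ℝ] ℝ} {x : V} (hΩ : DifferentiableAt ℝ Ω x)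
    (alt : ∀ᶠ y in nhds x, ∀ v, Ω y v v = 0) (u v : V) : fderiv ℝ Ω x u v v = 0 := by
  have e : (fun y ↦ Ω y v v) =ᶠ[nhds x] fun _ ↦ 0 := by
    filter_upwards [alt] with t ht using ht v
  have := ((hΩ.hasFDerivAt.apply_vector v).apply_vector v).fderiv
  rw [e.fderiv_eq] at this
  simpa using (congrArg (fun L ↦ L u) this).symm

theorem HasFDerivAt.apply_field {η : V → W →L[ℝ] ℝ} {η' : V →L[ℝ] W →L[ℝ] ℝ} {Y : V → W}
    {Y' : V →L[ℝ] W} {x : V} (hη : HasFDerivAt η η' x) (hY : HasFDerivAt Y Y' x) (v : V) :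
    fderiv ℝ (fun y ↦ η y (Y y)) x v = η' v (Y x) + η x (Y' v) := by
  rw [(hη.clm_apply hY).fderiv]
  simp [add_comm]

theorem HasFDerivAt.apply_field₂ {Ω : V → W →L[ℝ] W →L[ℝ] ℝ} {Ω' : V →L[ℝ] W →L[ℝ] W →L[ℝ] ℝ}
    {Y Z : V → W} {Y' Z' : V →L[ℝ] W} {x : V} (hΩ : HasFDerivAt Ω Ω' x)
    (hY : HasFDerivAt Y Y' x) (hZ : HasFDerivAt Z Z' x) (v : V) :
    fderiv ℝ (fun y ↦ Ω y (Y y) (Z y)) x v =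
      Ω' v (Y x) (Z x) + Ω x (Y' v) (Z x) + Ω x (Y x) (Z' v) := by
  rw [HasFDerivAt.apply_field (hΩ.clm_apply hY) hZ]
  simp; ring

theorem extd1_apply_field {η : V → V →L[ℝ] ℝ} {X Y : V → V} {x : V}
    (hη : DifferentiableAt ℝ η x) (hX : DifferentiableAt ℝ X x) (hY : DifferentiableAt ℝ Y x) :
    fderiv ℝ (fun y ↦ η y (Y y)) x (X x) - fderiv ℝ (fun y ↦ η y (X y)) x (Y x)
      - η x (VectorField.lieBracket ℝ X Y x) = extd1 η x (X x) (Y x) := by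
  rw [hη.hasFDerivAt.apply_field hX.hasFDerivAt, hη.hasFDerivAt.apply_field hY.hasFDerivAt,
    VectorField.lieBracket, map_sub, extd1_apply]
  ring

theorem extd2_apply_field {Ω : V → V →L[ℝ] V →L[ℝ] ℝ} {X Y Z : V → V} {x : V}
    (hΩ : DifferentiableAt ℝ Ω x) (alt : ∀ v, Ω x v v = 0) (hX : DifferentiableAt ℝ X x)
    (hY : DifferentiableAt ℝ Y x) (hZ : DifferentiableAt ℝ Z x) :
    fderiv ℝ (fun y ↦ Ω y (Y y) (Z y)) x (X x) + fderiv ℝ (fun y ↦ Ω y (Z y) (X y)) x (Y x)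
      + fderiv ℝ (fun y ↦ Ω y (X y) (Y y)) x (Z x)
      - Ω x (VectorField.lieBracket ℝ X Y x) (Z x) - Ω x (VectorField.lieBracket ℝ Y Z x) (X x)
      - Ω x (VectorField.lieBracket ℝ Z X x) (Y x) = extd2 Ω x (X x) (Y x) (Z x) := by
  have X1 := hX.hasFDerivAt
  have Y1 := hY.hasFDerivAt
  have Z1 := hZ.hasFDerivAt
  have O1 := hΩ.hasFDerivAt
  rw [O1.apply_field₂ Y1 Z1, O1.apply_field₂ Z1 X1, O1.apply_field₂ X1 Y1]
  simp only [VectorField.lieBracket, map_sub, sub_apply, extd2]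
  rw [skew_of_alt alt (Y x) (fderiv ℝ Z x (X x)), skew_of_alt alt (Z x) (fderiv ℝ X x (Y x)),
    skew_of_alt alt (X x) (fderiv ℝ Y x (Z x))]
  ring

theorem fderiv_fderiv_symm {τ : V → W} {x : V} (hτ : ContDiffAt ℝ 2 τ x) (v w : V) :
    fderiv ℝ (fderiv ℝ τ) x v w = fderiv ℝ (fderiv ℝ τ) x w v :=
  (hτ.isSymmSndFDerivAt (by simp)) v w

theorem ContDiffAt.hasFDerivAt_fderiv {τ : V → W} {x : V} (hτ : ContDiffAt ℝ 2 τ x) :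
    HasFDerivAt (fderiv ℝ τ) (fderiv ℝ (fderiv ℝ τ) x) x :=
  ((hτ.fderiv_right (m := 1) (by norm_num)).differentiableAt (by simp)).hasFDerivAt

/-- Naturality of `d`, here and in `extd2_pullback`: the terms with second derivatives of `τ` are
symmetric and cancel in the alternating sum. It is needed for transition maps between charts. -/
theorem extd1_pullback {η : W → W →L[ℝ] ℝ} {η' : V → V →L[ℝ] ℝ} {τ : V → W} {x : V}
    (hη : DifferentiableAt ℝ η (τ x)) (hη' : DifferentiableAt ℝ η' x) (hτ : ContDiffAt ℝ 2 τ x)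
    (h : ∀ᶠ y in nhds x, ∀ w, η' y w = η (τ y) (fderiv ℝ τ y w)) (v w : V) :
    extd1 η' x v w = extd1 η (τ x) (fderiv ℝ τ x v) (fderiv ℝ τ x w) := by
  have h1 := (hτ.differentiableAt (by simp)).hasFDerivAt
  have key : ∀ v w, fderiv ℝ η' x v w = fderiv ℝ η (τ x) (fderiv ℝ τ x v) (fderiv ℝ τ x w)
      + η (τ x) (fderiv ℝ (fderiv ℝ τ) x v w) := by
    intro v w
    have e : (fun y ↦ η' y w) =ᶠ[nhds x] fun y ↦ η (τ y) (fderiv ℝ τ y w) := by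
      filter_upwards [h] with y hy using hy w
    have := (hη'.hasFDerivAt.apply_vector w).fderiv
    rw [e.fderiv_eq] at this
    have h2 := congrArg (fun L ↦ L v) this
    simp only [ContinuousLinearMap.flip_apply] at h2
    have h3 : HasFDerivAt (fun y ↦ η (τ y)) _ x := hη.hasFDerivAt.comp x h1
    rw [← h2, h3.apply_field (hτ.hasFDerivAt_fderiv.apply_vector w)]
    rfl
  rw [extd1_apply, extd1_apply, key, key, fderiv_fderiv_symm hτ v w]
  ring

set_option maxSynthPendingDepth 5 in
theorem extd2_pullback {Ω : W → W →L[ℝ] W →L[ℝ] ℝ} {Ω' : V → V →L[ℝ] V →L[ℝ] ℝ} {τ : V → W}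
    {x : V} (hΩ : DifferentiableAt ℝ Ω (τ x)) (alt : ∀ v, Ω (τ x) v v = 0)
    (hΩ' : DifferentiableAt ℝ Ω' x) (hτ : ContDiffAt ℝ 2 τ x)
    (h : ∀ᶠ y in nhds x, ∀ v w, Ω' y v w = Ω (τ y) (fderiv ℝ τ y v) (fderiv ℝ τ y w))
    (a b c : V) :
    extd2 Ω' x a b c =
      extd2 Ω (τ x) (fderiv ℝ τ x a) (fderiv ℝ τ x b) (fderiv ℝ τ x c) := by
  have h1 := (hτ.differentiableAt (by simp)).hasFDerivAt
  have key : ∀ u v w, fderiv ℝ Ω' x u v w =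
      fderiv ℝ Ω (τ x) (fderiv ℝ τ x u) (fderiv ℝ τ x v) (fderiv ℝ τ x w)
      + Ω (τ x) (fderiv ℝ (fderiv ℝ τ) x u v) (fderiv ℝ τ x w)
      + Ω (τ x) (fderiv ℝ τ x v) (fderiv ℝ (fderiv ℝ τ) x u w) := by
    intro u v w
    have e : (fun y ↦ Ω' y v w) =ᶠ[nhds x]
        fun y ↦ Ω (τ y) (fderiv ℝ τ y v) (fderiv ℝ τ y w) := by
      filter_upwards [h] with y hy using hy v w
    have := ((hΩ'.hasFDerivAt.apply_vector v).apply_vector w).fderiv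
    rw [e.fderiv_eq] at this
    have h2 := congrArg (fun L ↦ L u) this
    simp only [ContinuousLinearMap.flip_apply] at h2
    have h3 : HasFDerivAt (fun y ↦ Ω (τ y)) ((fderiv ℝ Ω (τ x)).comp (fderiv ℝ τ x)) x :=
      hΩ.hasFDerivAt.comp x h1
    rw [← h2, h3.apply_field₂ (hτ.hasFDerivAt_fderiv.apply_vector v)
      (hτ.hasFDerivAt_fderiv.apply_vector w)]
    rfl
  have sk := skew_of_alt alt
  rw [extd2, extd2, key, key, key, fderiv_fderiv_symm hτ b a, fderiv_fderiv_symm hτ c b,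
    fderiv_fderiv_symm hτ c a, sk (fderiv ℝ τ x b), sk (fderiv ℝ τ x c), sk (fderiv ℝ τ x a)]
  ring

set_option maxHeartbeats 600000 in
set_option maxSynthPendingDepth 5 in
/-- `d² = 0` for `dΩ = θ ∧ Ω`: it follows that `dθ ∧ Ω = 0`. -/
theorem wedge22_extd1_eq_zero {Ω : V → V →L[ℝ] V →L[ℝ] ℝ} {θ : V → V →L[ℝ] ℝ} {x : V}
    (hΩ : ContDiffAt ℝ 2 Ω x) (hθ : DifferentiableAt ℝ θ x)
    (alt : ∀ᶠ y in nhds x, ∀ v, Ω y v v = 0)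
    (h : ∀ᶠ y in nhds x, ∀ a b c, extd2 Ω y a b c = wedge12 (θ y) (Ω y) a b c) (a b c d : V) :
    wedge22 (extd1 θ x) (Ω x) a b c d = 0 := by
  have O1 := (hΩ.differentiableAt (by simp)).hasFDerivAt
  have O2 := hΩ.hasFDerivAt_fderiv
  have T1 := hθ.hasFDerivAt
  have E : ∀ d a b c, fderiv ℝ (fderiv ℝ Ω) x d a b c + fderiv ℝ (fderiv ℝ Ω) x d b c a
      + fderiv ℝ (fderiv ℝ Ω) x d c a b =
      fderiv ℝ θ x d a * Ω x b c + fderiv ℝ θ x d b * Ω x c a + fderiv ℝ θ x d c * Ω x a b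
      + θ x a * fderiv ℝ Ω x d b c + θ x b * fderiv ℝ Ω x d c a + θ x c * fderiv ℝ Ω x d a b := by
    intro d a b c
    have e1 : HasFDerivAt (fun y ↦ extd2 Ω y a b c) _ x :=
      ((((O2.apply_vector a).apply_vector b).apply_vector c).add
        (((O2.apply_vector b).apply_vector c).apply_vector a)).add
        (((O2.apply_vector c).apply_vector a).apply_vector b)
    have e2 : HasFDerivAt (fun y ↦ wedge12 (θ y) (Ω y) a b c) _ x :=
      (((T1.apply_vector a).mul ((O1.apply_vector b).apply_vector c)).add
        ((T1.apply_vector b).mul ((O1.apply_vector c).apply_vector a))).add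
        ((T1.apply_vector c).mul ((O1.apply_vector a).apply_vector b))
    have e3 : (fun y ↦ extd2 Ω y a b c) =ᶠ[nhds x] fun y ↦ wedge12 (θ y) (Ω y) a b c := by
      filter_upwards [h] with y hy using hy a b c
    have := congrArg (fun L ↦ L d) (e1.unique (e2.congr_of_eventuallyEq e3))
    simp only [add_apply, ContinuousLinearMap.flip_apply,
      smul_apply, smul_eq_mul] at this
    rw [this]; ring
  have alt1 : ∀ᶠ y in nhds x, ∀ u v, fderiv ℝ Ω y u v v = 0 := by
    filter_upwards [alt.eventually_nhds, hΩ.eventually (by simp)] with y hy hy' u v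
    exact fderiv_alt (hy'.differentiableAt (by simp)) hy u v
  have alt2 : ∀ s u v, fderiv ℝ (fderiv ℝ Ω) x s u v v = 0 := by
    intro s u v
    have e : (fun y ↦ fderiv ℝ Ω y u v v) =ᶠ[nhds x] fun _ ↦ 0 := by
      filter_upwards [alt1] with t ht using ht u v
    have := (((O2.apply_vector u).apply_vector v).apply_vector v).fderiv
    rw [e.fderiv_eq] at this
    simpa using (congrArg (fun L ↦ L s) this).symm
  have sk0 := skew_of_alt alt.self_of_nhds
  have sk1 := fun s ↦ skew_of_alt (alt1.self_of_nhds s)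
  have sk2 := fun s u ↦ skew_of_alt (alt2 s u)
  have sy := fun u v : V ↦ fderiv_fderiv_symm hΩ u v
  have id := h.self_of_nhds
  simp only [extd2, wedge12] at id
  have E1 := E a b c d
  have E2 := E b a c d
  have E3 := E c a b d
  have E4 := E d a b c
  have i1 := id b c d
  have i2 := id a c d
  have i3 := id a b d
  have i4 := id a b c
  simp only [wedge22, extd1_apply]
  simp only [sy b a, sy c a, sy d a, sy c b, sy d b, sy d c] at E1 E2 E3 E4
  simp only [sk0 c a, sk0 d a, sk0 d b, fun s ↦ sk1 s c a, fun s ↦ sk1 s d a,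
    fun s ↦ sk1 s d b, fun s t ↦ sk2 s t c a, fun s t ↦ sk2 s t d a, fun s t ↦ sk2 s t d b]
    at E1 E2 E3 E4 i1 i2 i3 i4 ⊢
  -- Alternating over the four slots removes the second derivatives of `Ω` and leaves `dθ ∧ Ω - θ ∧
  -- dΩ`. The remaining multiples of `i1`, ..., `i4` replace `θ ∧ dΩ` by `θ ∧ θ ∧ Ω = 0`.
  linear_combination -E1 + E2 - E3 + E4 + θ x a * i1 - θ x b * i2 + θ x c * i3 - θ x d * i4

/-- If `h ≠ 0` and `(dh + hθ)^{0,1} = 0`, then `dθ` is `I`-invariant. -/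
theorem extd1_invariant {h : V → ℂ} {θ : V → V →L[ℝ] ℝ} {x : V} (I : V →L[ℝ] V)
    (hh : ContDiffAt ℝ 2 h x) (hθ : DifferentiableAt ℝ θ x) (h0 : h x ≠ 0)
    (heq : ∀ᶠ y in nhds x, ∀ w, fderiv ℝ h y w + Complex.I * fderiv ℝ h y (I w)
      + h y * (θ y w + Complex.I * θ y (I w)) = 0) (v w : V) :
    extd1 θ x (I v) (I w) = extd1 θ x v w := by
  have H1 := (hh.differentiableAt (by simp)).hasFDerivAt
  have H2 := hh.hasFDerivAt_fderiv
  have T1 := hθ.hasFDerivAt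
  have G : ∀ v w, fderiv ℝ (fderiv ℝ h) x v w + Complex.I * fderiv ℝ (fderiv ℝ h) x v (I w)
      + fderiv ℝ h x v * (θ x w + Complex.I * θ x (I w))
      + h x * (fderiv ℝ θ x v w + Complex.I * fderiv ℝ θ x v (I w)) = 0 := by
    intro v w
    have o : ∀ w, HasFDerivAt (fun y ↦ (θ y w : ℂ)) _ x := fun w ↦
      Complex.ofRealCLM.hasFDerivAt.comp x (T1.apply_vector w)
    have e1 : HasFDerivAt (fun y ↦ fderiv ℝ h y w + Complex.I * fderiv ℝ h y (I w)
        + h y * (θ y w + Complex.I * θ y (I w))) _ x :=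
      ((H2.apply_vector w).add ((H2.apply_vector (I w)).const_mul Complex.I)).add
        (H1.mul ((o w).add ((o (I w)).const_mul Complex.I)))
    have e3 : (fun y ↦ fderiv ℝ h y w + Complex.I * fderiv ℝ h y (I w)
        + h y * (θ y w + Complex.I * θ y (I w))) =ᶠ[nhds x] fun _ ↦ 0 := by
      filter_upwards [heq] with y hy using hy w
    have := congrArg (fun L ↦ L v) (e1.unique
      ((hasFDerivAt_const (0 : ℂ) x).congr_of_eventuallyEq e3))
    simp at this
    linear_combination this
  have h1 := heq.self_of_nhds v
  have h2 := heq.self_of_nhds w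
  have s := fun v w : V ↦ fderiv_fderiv_symm hh v w
  have g1 := G v w
  have g2 := G (I v) w
  have g3 := G w v
  have g4 := G (I w) v
  rw [s w v, s w (I v)] at g3
  rw [s (I w) v, s (I w) (I v)] at g4
  -- Antisymmetrising over `v + iIv` and `w + iIw` eliminates the second derivatives of `h`, and the
  -- equation itself eliminates the first ones. What remains is `h · dθ(v + iIv, w + iIw) = 0`, the
  -- vanishing of the `(0,2)`-part; its real part is the invariance.
  have key : h x * ((fderiv ℝ θ x v w + Complex.I * fderiv ℝ θ x v (I w)
      + Complex.I * fderiv ℝ θ x (I v) w - fderiv ℝ θ x (I v) (I w))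
      - (fderiv ℝ θ x w v + Complex.I * fderiv ℝ θ x w (I v)
      + Complex.I * fderiv ℝ θ x (I w) v - fderiv ℝ θ x (I w) (I v))) = 0 := by
    have hI := Complex.I_mul_I
    linear_combination g1 + Complex.I * g2 - g3 - Complex.I * g4
      - (θ x w + Complex.I * θ x (I w)) * h1 + (θ x v + Complex.I * θ x (I v)) * h2
      + h x * (-fderiv ℝ θ x (I v) (I w) + fderiv ℝ θ x (I w) (I v)) * hI
  have := congrArg Complex.re ((mul_eq_zero.mp key).resolve_left h0)
  simp at this
  rw [extd1_apply, extd1_apply]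
  linarith

/-- The bracket of the dual fields of two closed 1-forms. -/
theorem bracket_of_closed {Ω : V → V →L[ℝ] V →L[ℝ] ℝ} {α β : V → V →L[ℝ] ℝ} {A B : V → V} {x : V}
    (hΩ : DifferentiableAt ℝ Ω x) (alt : ∀ᶠ y in nhds x, ∀ v, Ω y v v = 0)
    (hα : DifferentiableAt ℝ α x) (hβ : DifferentiableAt ℝ β x)
    (dα : ∀ v w, fderiv ℝ α x v w = fderiv ℝ α x w v)
    (dβ : ∀ v w, fderiv ℝ β x v w = fderiv ℝ β x w v)
    (hA : DifferentiableAt ℝ A x) (hB : DifferentiableAt ℝ B x)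
    (hAα : ∀ᶠ y in nhds x, ∀ w, Ω y (A y) w = α y w)
    (hBβ : ∀ᶠ y in nhds x, ∀ w, Ω y (B y) w = β y w) (w : V) :
    Ω x (VectorField.lieBracket ℝ A B x) w =
      -fderiv ℝ (fun y ↦ Ω y (A y) (B y)) x w - extd2 Ω x (A x) (B x) w := by
  have O1 := hΩ.hasFDerivAt
  have A1 := hA.hasFDerivAt
  have B1 := hB.hasFDerivAt
  have E : ∀ {α : V → V →L[ℝ] ℝ} {A : V → V}, DifferentiableAt ℝ α x → DifferentiableAt ℝ A x →
      (∀ᶠ y in nhds x, ∀ w, Ω y (A y) w = α y w) → ∀ v w, fderiv ℝ α x v w =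
      fderiv ℝ Ω x v (A x) w + Ω x (fderiv ℝ A x v) w := by
    intro α A hα hA h v w
    have e : (fun y ↦ Ω y (A y) w) =ᶠ[nhds x] fun y ↦ α y w := by
      filter_upwards [h] with y hy using hy w
    have h1 := O1.apply_field₂ hA.hasFDerivAt (hasFDerivAt_const w x) v
    rw [e.fderiv_eq, (hα.hasFDerivAt.apply_vector w).fderiv] at h1
    simpa using h1
  have EA := E hα hA hAα
  have EB := E hβ hB hBβ
  have sk := skew_of_alt alt.self_of_nhds
  have sk' := fun u ↦ skew_of_alt (fderiv_alt hΩ alt u)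
  rw [O1.apply_field₂ A1 B1, VectorField.lieBracket, map_sub, sub_apply, extd2]
  -- Closedness of `α` on the pair `(B, w)` and of `β` on the pair `(A, w)`; the difference of the
  -- two identities is the bracket formula.
  have a := (EA (B x) w).symm.trans ((dα _ _).trans (EA w (B x)))
  have b := (EB (A x) w).symm.trans ((dβ _ _).trans (EB w (A x)))
  rw [sk' w (B x), sk (fderiv ℝ B x w)] at b
  rw [sk' (B x) (A x)] at a
  linear_combination b - a

end ExteriorCalculus

/-! ### Integrability of the adjoint structure and the twisted Cauchy-Riemann equation -/

section TwistedDbar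

variable {V : Type*} [NormedAddCommGroup V] [NormedSpace ℝ V]

open Complex

/-- The real and imaginary parts of `du` are closed 1-forms, which is the form in which
`bracket_of_closed` can use them. -/
theorem reDeriv_symm {u : V → ℂ} {x : V} (hu : ContDiffAt ℝ 2 u x) (L : ℂ →L[ℝ] ℝ) :
    DifferentiableAt ℝ (fun y ↦ L.comp (fderiv ℝ u y)) x ∧
      ∀ v w, fderiv ℝ (fun y ↦ L.comp (fderiv ℝ u y)) x v w =
        fderiv ℝ (fun y ↦ L.comp (fderiv ℝ u y)) x w v := by
  have h : HasFDerivAt (fun y ↦ L.comp (fderiv ℝ u y))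
      ((ContinuousLinearMap.compL ℝ V ℂ ℝ L).comp (fderiv ℝ (fderiv ℝ u) x)) x :=
    (ContinuousLinearMap.compL ℝ V ℂ ℝ L).hasFDerivAt.comp x hu.hasFDerivAt_fderiv
  refine ⟨h.differentiableAt, fun v w ↦ ?_⟩
  rw [h.fderiv]
  simp [fderiv_fderiv_symm hu v w]

/-- Derivatives of a function along a commutator. -/
theorem fderiv_lieBracket {Z : Type*} [NormedAddCommGroup Z] [NormedSpace ℝ Z] {q : V → Z} {x : V}
    (hq : ContDiffAt ℝ 2 q x) {A B : V → V} (hA : DifferentiableAt ℝ A x)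
    (hB : DifferentiableAt ℝ B x) :
    fderiv ℝ q x (VectorField.lieBracket ℝ A B x) =
      fderiv ℝ (fun y ↦ fderiv ℝ q y (B y)) x (A x)
        - fderiv ℝ (fun y ↦ fderiv ℝ q y (A y)) x (B x) := by
  have h := hq.hasFDerivAt_fderiv
  rw [VectorField.lieBracket, map_sub, (h.clm_apply hA.hasFDerivAt).fderiv,
    (h.clm_apply hB.hasFDerivAt).fderiv]
  simp [fderiv_fderiv_symm hq (A x) (B x)]

/-- Let `Ω` be a 2-form with `dΩ = θ ∧ Ω`, let `K` be the structure which is the `Ω`-adjoint of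
`I`, and suppose that `K` has holomorphic coordinates `q`. If `u`, `v` are `I`-holomorphic
and `A + iA'` is the Hamiltonian field of `u`, then `∂̄s + s θ^{0,1} = 0` for
`s = dv(A + iA')`. -/
theorem twisted_dbar_of_integrable {Z : Type*} [NormedAddCommGroup Z] [NormedSpace ℂ Z]
    {Ω : V → V →L[ℝ] V →L[ℝ] ℝ} {θ : V →L[ℝ] ℝ} {u v : V → ℂ} {q : V → Z} {A A' B B' : V → V}
    {x : V} (I K : V →L[ℝ] V) (sqI : ∀ w, I (I w) = -w)
    (hΩ : DifferentiableAt ℝ Ω x) (alt : ∀ᶠ y in nhds x, ∀ v, Ω y v v = 0)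
    (dΩ : ∀ a b c, extd2 Ω x a b c = wedge12 θ (Ω x) a b c)
    (hu : ContDiffAt ℝ 2 u x) (hv : ContDiffAt ℝ 2 v x) (hq : ContDiffAt ℝ 2 q x)
    (hA : DifferentiableAt ℝ A x) (hA' : DifferentiableAt ℝ A' x)
    (hB : DifferentiableAt ℝ B x) (hB' : DifferentiableAt ℝ B' x)
    (eA : ∀ᶠ y in nhds x, ∀ w, Ω y (A y) w = (fderiv ℝ u y w).re)
    (eA' : ∀ᶠ y in nhds x, ∀ w, Ω y (A' y) w = (fderiv ℝ u y w).im)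
    (eB : ∀ᶠ y in nhds x, ∀ w, Ω y (B y) w = (fderiv ℝ v y w).re)
    (eB' : ∀ᶠ y in nhds x, ∀ w, Ω y (B' y) w = (fderiv ℝ v y w).im)
    (qA : ∀ᶠ y in nhds x, fderiv ℝ q y (A y) = Complex.I • fderiv ℝ q y (A' y))
    (qB : ∀ᶠ y in nhds x, fderiv ℝ q y (B y) = Complex.I • fderiv ℝ q y (B' y))
    (qK : ∀ w, fderiv ℝ q x (K w) = Complex.I • fderiv ℝ q x w)
    (qinj : Function.Injective (fderiv ℝ q x))
    (adj : ∀ v w, Ω x (K v) w = Ω x v (I w))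
    (uI : ∀ w, fderiv ℝ u x (I w) = Complex.I * fderiv ℝ u x w)
    (vI : ∀ w, fderiv ℝ v x (I w) = Complex.I * fderiv ℝ v x w) (w : V) :
    fderiv ℝ (fun y ↦ fderiv ℝ v y (A y) + Complex.I * fderiv ℝ v y (A' y)) x w
      + Complex.I * fderiv ℝ (fun y ↦ fderiv ℝ v y (A y)
        + Complex.I * fderiv ℝ v y (A' y)) x (I w)
      + (fderiv ℝ v x (A x) + Complex.I * fderiv ℝ v x (A' x))
        * (θ w + Complex.I * θ (I w)) = 0 := by
  obtain ⟨u1, u2⟩ := reDeriv_symm hu reCLM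
  obtain ⟨u3, u4⟩ := reDeriv_symm hu imCLM
  obtain ⟨v1, v2⟩ := reDeriv_symm hv reCLM
  obtain ⟨v3, v4⟩ := reDeriv_symm hv imCLM
  have br := fun w ↦ bracket_of_closed hΩ alt u1 v1 u2 v2 hA hB eA eB w
  have br' := fun w ↦ bracket_of_closed hΩ alt u3 v3 u4 v4 hA' hB' eA' eB' w
  have br1 := fun w ↦ bracket_of_closed hΩ alt u3 v1 u4 v2 hA' hB eA' eB w
  have br2 := fun w ↦ bracket_of_closed hΩ alt u1 v3 u2 v4 hA hB' eA eB' w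
  -- `C + iC'` is the bracket of the complex fields `A + iA'` and `B + iB'`.
  set C := VectorField.lieBracket ℝ A B x - VectorField.lieBracket ℝ A' B' x with hC
  set C' := VectorField.lieBracket ℝ A' B x + VectorField.lieBracket ℝ A B' x with hC'
  -- `K` is integrable, so that `C + iC'` is of type (1,0) for `K`
  have hCC : K C' = C := by
    apply qinj
    have smul : ∀ {f g : V → Z}, f =ᶠ[nhds x] (fun y ↦ Complex.I • g y) → DifferentiableAt ℝ g x →
        ∀ w, fderiv ℝ f x w = Complex.I • fderiv ℝ g x w := fun h hg w ↦ by
      rw [h.fderiv_eq, fderiv_fun_const_smul hg]; rfl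
    have d := fun {A : V → V} (hA : DifferentiableAt ℝ A x) ↦
      (hq.hasFDerivAt_fderiv.clm_apply hA.hasFDerivAt).differentiableAt
    rw [qK, hC, hC', map_sub, map_add, fderiv_lieBracket hq hA hB, fderiv_lieBracket hq hA' hB',
      fderiv_lieBracket hq hA' hB, fderiv_lieBracket hq hA hB',
      smul qA (d hA'), smul qB (d hB'), smul qA (d hA'), smul qB (d hB')]
    simp only [smul_add, smul_sub, smul_smul, I_mul_I]
    module
  -- This says that `Ω(C + iC', ·)` is of type `(1,0)` for `I`. With `s = -Ω(A + iA', B + iB')`, the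
  -- bracket formula and `dΩ = θ ∧ Ω` identify that form with `ds + sθ - θ(A + iA') dv + θ(B + iB')
  -- du`. Since `du` and `dv` are of type `(1,0)`, the `(0,1)`-part of `ds + sθ` vanishes.
  have hη : ∀ w, Ω x C' (I w) = Ω x C w := fun w ↦ by rw [← adj, hCC]
  have e1 := hη w
  have e2 := hη (I w)
  have d : ∀ {A B : V → V}, DifferentiableAt ℝ A x → DifferentiableAt ℝ B x →
      DifferentiableAt ℝ (fun y ↦ Ω y (A y) (B y)) x := fun hA hB ↦
    ((hΩ.hasFDerivAt.clm_apply hA.hasFDerivAt).clm_apply hB.hasFDerivAt).differentiableAt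
  have o : ∀ {f : V → ℝ}, DifferentiableAt ℝ f x → HasFDerivAt (fun y ↦ (f y : ℂ))
      (ofRealCLM.comp (fderiv ℝ f x)) x := fun h ↦ ofRealCLM.hasFDerivAt.comp x h.hasFDerivAt
  have eS : (fun y ↦ fderiv ℝ v y (A y) + Complex.I * fderiv ℝ v y (A' y)) =ᶠ[nhds x]
      fun y ↦ -((Ω y (A y) (B y) : ℂ) - Ω y (A' y) (B' y)
        + Complex.I * (Ω y (A' y) (B y) + Ω y (A y) (B' y))) := by
    filter_upwards [alt, eB, eB'] with y h1 h2 h3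
    have sk := skew_of_alt h1
    rw [sk (A y), sk (A y), sk (A' y), sk (A' y), h2, h3, h2, h3]
    apply Complex.ext
    · simp; ring
    · simp
  have hS : HasFDerivAt (fun y ↦ -((Ω y (A y) (B y) : ℂ) - Ω y (A' y) (B' y)
        + Complex.I * (Ω y (A' y) (B y) + Ω y (A y) (B' y)))) _ x :=
    (((o (d hA hB)).sub (o (d hA' hB'))).add
      (((o (d hA' hB)).add (o (d hA hB'))).const_mul Complex.I)).neg
  rw [show fderiv ℝ v x (A x) + Complex.I * fderiv ℝ v x (A' x) = _ from eS.self_of_nhds,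
    eS.fderiv_eq, hS.fderiv]
  have sk := skew_of_alt alt.self_of_nhds
  have a1 := eA.self_of_nhds
  have a2 := eA'.self_of_nhds
  have b1 := eB.self_of_nhds
  have b2 := eB'.self_of_nhds
  rw [hC, hC'] at e1 e2
  simp only [map_add, map_sub, add_apply, sub_apply, br, br', br1, br2, dΩ, wedge12, sqI, map_neg,
    b1, b2, uI, vI, sk _ (A x), sk _ (A' x), a1, a2] at e1 e2
  have r1 := a1 (B x)
  have r2 := a2 (B x)
  have r3 := a1 (B' x)
  have r4 := a2 (B' x)
  refine Complex.ext ?_ ?_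
  · simp [a1, a2] at e1 e2 ⊢
    linarith
  · simp [a1, a2] at e1 e2 ⊢
    linarith

end TwistedDbar

/-! ### Two-forms on a four-dimensional space -/

section FourDimensional

variable {V : Type*} [NormedAddCommGroup V] [NormedSpace ℝ V]

/-- Cyclic invariance carries linearity and alternation from the first slots to all of them, so four
basis triples determine `T`. -/
theorem alternating_three_eq_zero (b : Module.Basis (Fin 4) ℝ V) {T : V → V → V → ℝ}
    (add : ∀ a a' c d, T (a + a') c d = T a c d + T a' c d)
    (smul : ∀ (r : ℝ) a c d, T (r • a) c d = r * T a c d)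
    (cyc : ∀ a c d, T a c d = T c d a) (alt : ∀ a c, T a a c = 0)
    (h1 : T (b 0) (b 1) (b 2) = 0) (h2 : T (b 0) (b 1) (b 3) = 0)
    (h3 : T (b 0) (b 2) (b 3) = 0) (h4 : T (b 1) (b 2) (b 3) = 0) (a c d : V) :
    T a c d = 0 := by
  have add₂ : ∀ a c c' d, T a (c + c') d = T a c d + T a c' d := fun a c c' d ↦ by
    rw [cyc a (c + c') d, add, cyc a c d, cyc a c' d]
  have sk : ∀ a c d, T a c d = -T c a d := fun a c d ↦ by
    have := alt (a + c) d
    rw [add, add₂, add₂, alt, alt] at this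
    linarith
  have perm : ∀ a c d, T a c d = 0 → T c d a = 0 ∧ T d a c = 0 ∧ T c a d = 0 ∧ T a d c = 0 ∧
      T d c a = 0 := fun a c d h ↦ by
    refine ⟨by rw [← cyc, h], by rw [cyc, h], by rw [sk, h, neg_zero], ?_, ?_⟩
    · rw [← cyc, sk, h, neg_zero]
    · rw [sk, ← cyc, h, neg_zero]
  have ext : ∀ {T : V → ℝ}, (∀ a a', T (a + a') = T a + T a') → (∀ (r : ℝ) a, T (r • a) = r * T a) →
      (∀ i, T (b i) = 0) → ∀ a, T a = 0 := fun {T} hadd hsmul h a ↦ by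
    have : (IsLinearMap.mk' T ⟨hadd, hsmul⟩ : V →ₗ[ℝ] ℝ) = 0 := b.ext fun i ↦ by simpa using h i
    exact LinearMap.congr_fun this a
  have alt₂ : ∀ a c, T a c a = 0 := fun a c ↦ by rw [← cyc, alt]
  have alt₃ : ∀ a c, T c a a = 0 := fun a c ↦ by rw [cyc, alt]
  have basis : ∀ i j k, T (b i) (b j) (b k) = 0 := by
    intro i j k
    have p1 := perm _ _ _ h1
    have p2 := perm _ _ _ h2
    have p3 := perm _ _ _ h3
    have p4 := perm _ _ _ h4
    fin_cases i <;> fin_cases j <;> fin_cases k <;>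
      simp only [Fin.zero_eta, Fin.mk_one, Fin.reduceFinMk, alt, alt₂, alt₃, h1, h2, h3, h4, p1, p2,
        p3, p4]
  have s1 : ∀ j k a, T a (b j) (b k) = 0 := fun j k ↦
    ext (fun _ _ ↦ add _ _ _ _) (fun _ _ ↦ smul _ _ _ _) (fun i ↦ basis i j k)
  have s2 : ∀ k a c, T c (b k) a = 0 := fun k a ↦
    ext (fun _ _ ↦ add _ _ _ _) (fun _ _ ↦ smul _ _ _ _) (fun i ↦ by rw [cyc, ← cyc, ← cyc, s1])
  exact ext (T := fun a ↦ T a c d) (fun _ _ ↦ add _ _ _ _) (fun _ _ ↦ smul _ _ _ _)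
    (fun i ↦ by rw [← cyc, s2]) a

/-- The Pfaffian of a 2-form. -/
def pfaffian (b : Fin 4 → V) (Ω : V →L[ℝ] V →L[ℝ] ℝ) : ℝ :=
  Ω (b 0) (b 1) * Ω (b 2) (b 3) - Ω (b 0) (b 2) * Ω (b 1) (b 3) + Ω (b 0) (b 3) * Ω (b 1) (b 2)

/-- The coefficients of the solution of `θ ∧ Ω = T`, multiplied by the Pfaffian of `Ω`. -/
def lefschetzCoeff (b : Fin 4 → V) (Ω : V →L[ℝ] V →L[ℝ] ℝ) (T : V → V → V → ℝ) : Fin 4 → ℝ :=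
  ![Ω (b 0) (b 3) * T (b 0) (b 1) (b 2) - Ω (b 0) (b 2) * T (b 0) (b 1) (b 3)
      + Ω (b 0) (b 1) * T (b 0) (b 2) (b 3),
    Ω (b 1) (b 3) * T (b 0) (b 1) (b 2) - Ω (b 1) (b 2) * T (b 0) (b 1) (b 3)
      + Ω (b 0) (b 1) * T (b 1) (b 2) (b 3),
    Ω (b 2) (b 3) * T (b 0) (b 1) (b 2) - Ω (b 1) (b 2) * T (b 0) (b 2) (b 3)
      + Ω (b 0) (b 2) * T (b 1) (b 2) (b 3),
    Ω (b 2) (b 3) * T (b 0) (b 1) (b 3) - Ω (b 1) (b 3) * T (b 0) (b 2) (b 3)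
      + Ω (b 0) (b 3) * T (b 1) (b 2) (b 3)]

/-- If the Pfaffian vanished, the combinations `k1`, `k2`, `k3` of basis vectors would lie in the
kernel of `Ω`. Their coefficients would then be zero, which puts `b 0` itself in the kernel. -/
theorem pfaffian_ne_zero (b : Module.Basis (Fin 4) ℝ V) {Ω : V →L[ℝ] V →L[ℝ] ℝ}
    (alt : ∀ v, Ω v v = 0) (nd : ∀ v, Ω v = 0 → v = 0) : pfaffian b Ω ≠ 0 := by
  intro h
  have sk := skew_of_alt alt
  have ext : ∀ v, (∀ i, Ω v (b i) = 0) → v = 0 := fun v hv ↦ nd v <| by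
    have : (Ω v : V →ₗ[ℝ] ℝ) = 0 := b.ext fun i ↦ by simpa using hv i
    exact ContinuousLinearMap.coe_inj.mp this
  have li := Fintype.linearIndependent_iff.mp b.linearIndependent
  rw [pfaffian] at h
  have k1 := ext (Ω (b 2) (b 3) • b 1 - Ω (b 1) (b 3) • b 2 + Ω (b 1) (b 2) • b 3) (fun i ↦ by
    fin_cases i <;>
    simp [alt, sk (b 1) (b 0), sk (b 2) (b 0), sk (b 3) (b 0), sk (b 2) (b 1), sk (b 3) (b 1),
      sk (b 3) (b 2)] <;> linarith)
  have k2 := ext (Ω (b 2) (b 3) • b 0 - Ω (b 0) (b 3) • b 2 + Ω (b 0) (b 2) • b 3) (fun i ↦ by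
    fin_cases i <;>
    simp [alt, sk (b 2) (b 0), sk (b 3) (b 0), sk (b 2) (b 1), sk (b 3) (b 1),
      sk (b 3) (b 2)] <;> linarith)
  have k3 := ext (Ω (b 1) (b 3) • b 0 - Ω (b 0) (b 3) • b 1 + Ω (b 0) (b 1) • b 3) (fun i ↦ by
    fin_cases i <;>
    simp [alt, sk (b 1) (b 0), sk (b 3) (b 0), sk (b 3) (b 1), sk (b 3) (b 2)] <;> linarith)
  have c1 := li ![0, Ω (b 2) (b 3), -Ω (b 1) (b 3), Ω (b 1) (b 2)]
    (by rw [← k1]; simp [Fin.sum_univ_four]; module)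
  have c2 := li ![Ω (b 2) (b 3), 0, -Ω (b 0) (b 3), Ω (b 0) (b 2)]
    (by rw [← k2]; simp [Fin.sum_univ_four]; module)
  have c3 := li ![Ω (b 1) (b 3), -Ω (b 0) (b 3), 0, Ω (b 0) (b 1)]
    (by rw [← k3]; simp [Fin.sum_univ_four]; module)
  have a03 := c2 2
  have a02 := c2 3
  have a01 := c3 3
  simp at a03 a02 a01
  exact b.ne_zero 0 (ext (b 0) fun i ↦ by fin_cases i <;> simp [alt, a01, a02, a03])

/-- The combinations used here are those of `lefschetzCoeff`: they invert `θ ↦ θ ∧ Ω` up to the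
factor `pfaffian b Ω`. Uniqueness of the Lee form rests on this. -/
theorem wedge12_injective (b : Module.Basis (Fin 4) ℝ V) {Ω : V →L[ℝ] V →L[ℝ] ℝ}
    (alt : ∀ v, Ω v v = 0) (nd : pfaffian b Ω ≠ 0) {θ θ' : V →L[ℝ] ℝ}
    (h : ∀ a c d, wedge12 θ Ω a c d = wedge12 θ' Ω a c d) : θ = θ' := by
  have sk := skew_of_alt alt
  have h1 := h (b 0) (b 1) (b 2)
  have h2 := h (b 0) (b 1) (b 3)
  have h3 := h (b 0) (b 2) (b 3)
  have h4 := h (b 1) (b 2) (b 3)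
  simp only [wedge12, sk (b 2) (b 0), sk (b 3) (b 0), sk (b 3) (b 1)] at h1 h2 h3 h4
  have : (θ : V →ₗ[ℝ] ℝ) = θ' := b.ext fun i ↦ by
    refine mul_right_cancel₀ nd ?_
    fin_cases i <;> simp only [pfaffian, Fin.zero_eta, Fin.mk_one, Fin.reduceFinMk,
      ContinuousLinearMap.coe_coe]
    · linear_combination Ω (b 0) (b 3) * h1 - Ω (b 0) (b 2) * h2 + Ω (b 0) (b 1) * h3
    · linear_combination Ω (b 1) (b 3) * h1 - Ω (b 1) (b 2) * h2 + Ω (b 0) (b 1) * h4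
    · linear_combination Ω (b 2) (b 3) * h1 - Ω (b 1) (b 2) * h3 + Ω (b 0) (b 2) * h4
    · linear_combination Ω (b 2) (b 3) * h2 - Ω (b 1) (b 3) * h3 + Ω (b 0) (b 3) * h4
  exact ContinuousLinearMap.coe_inj.mp this

/-- The wedge product is an alternating 4-form on a four-dimensional space, hence a multiple of the
determinant form. -/
theorem wedge22_map (b : Module.Basis (Fin 4) ℝ V) {B C : V →L[ℝ] V →L[ℝ] ℝ}
    (altB : ∀ v, B v v = 0) (altC : ∀ v, C v v = 0) (L : V →ₗ[ℝ] V) :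
    wedge22 B C (L (b 0)) (L (b 1)) (L (b 2)) (L (b 3)) =
      LinearMap.det L * wedge22 B C (b 0) (b 1) (b 2) (b 3) := by
  have skB := skew_of_alt altB
  have skC := skew_of_alt altC
  let f : V [⋀^Fin 4]→ₗ[ℝ] ℝ :=
    { toFun := fun v ↦ wedge22 B C (v 0) (v 1) (v 2) (v 3)
      map_update_add' := by
        intro inst v i x y
        obtain rfl : inst = instDecidableEqFin 4 := Subsingleton.elim _ _
        fin_cases i <;> simp [wedge22] <;> ring
      map_update_smul' := by
        intro inst v i r x
        obtain rfl : inst = instDecidableEqFin 4 := Subsingleton.elim _ _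
        fin_cases i <;> simp [wedge22] <;> ring
      map_eq_zero_of_eq' := by
        intro v i j hij hne
        have swap : ∀ i j, B (v i) (v j) = -B (v j) (v i) ∧ C (v i) (v j) = -C (v j) (v i) :=
          fun i j ↦ ⟨skB _ _, skC _ _⟩
        fin_cases i <;> fin_cases j <;> simp only [Fin.zero_eta, Fin.mk_one, Fin.reduceFinMk,
          ne_eq, not_true_eq_false] at hij hne <;>
          simp only [wedge22, hij, altB, altC, swap 1 0, swap 2 0,  swap 2 1, swap 3 1,
            swap 3 2] <;> ring }
  have h := congrArg (fun F : V [⋀^Fin 4]→ₗ[ℝ] ℝ ↦ F (L ∘ b)) (AlternatingMap.eq_smul_basis_det b f)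
  have h2 := b.det_comp L b
  rw [b.det_self, mul_one] at h2
  simp only [AlternatingMap.smul_apply, h2, smul_eq_mul] at h
  rw [mul_comm]
  exact h

variable [FiniteDimensional ℝ V]

/-- The solution `θ` of `θ ∧ Ω = T`. -/
def lefschetzInv (b : Module.Basis (Fin 4) ℝ V) (Ω : V →L[ℝ] V →L[ℝ] ℝ) (T : V → V → V → ℝ) :
    V →L[ℝ] ℝ :=
  ∑ i, (lefschetzCoeff b Ω T i / pfaffian b Ω) • LinearMap.toContinuousLinearMap (b.coord i)

theorem lefschetzInv_apply (b : Module.Basis (Fin 4) ℝ V) (Ω : V →L[ℝ] V →L[ℝ] ℝ)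
    (T : V → V → V → ℝ) (w : V) :
    lefschetzInv b Ω T w = ∑ i, lefschetzCoeff b Ω T i / pfaffian b Ω * b.coord i w := by
  simp [lefschetzInv]

theorem wedge12_lefschetzInv (b : Module.Basis (Fin 4) ℝ V) {Ω : V →L[ℝ] V →L[ℝ] ℝ}
    (alt : ∀ v, Ω v v = 0) (nd : pfaffian b Ω ≠ 0) {T : V → V → V → ℝ}
    (add : ∀ a a' c d, T (a + a') c d = T a c d + T a' c d)
    (smul : ∀ (r : ℝ) a c d, T (r • a) c d = r * T a c d)
    (cyc : ∀ a c d, T a c d = T c d a) (altT : ∀ a c, T a a c = 0) (a c d : V) :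
    T a c d = wedge12 (lefschetzInv b Ω T) Ω a c d := by
  have sk := skew_of_alt alt
  rw [← sub_eq_zero]
  have val : ∀ i, lefschetzInv b Ω T (b i) = lefschetzCoeff b Ω T i / pfaffian b Ω := fun i ↦ by
    rw [lefschetzInv_apply]
    simp [Finsupp.single_apply]
  refine alternating_three_eq_zero b
    (T := fun a c d ↦ T a c d - wedge12 (lefschetzInv b Ω T) Ω a c d)
    ?_ ?_ ?_ ?_ ?_ ?_ ?_ ?_ a c d
  · intro a a' c d
    simp only [add, wedge12, map_add, add_apply]; ring
  · intro r a c d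
    simp only [smul, wedge12, map_smul, smul_apply, smul_eq_mul]; ring
  · intro a c d
    simp only [cyc a c d, wedge12]; ring
  · intro a c
    simp only [altT, wedge12, alt, sk c a]; ring
  all_goals
    simp only [wedge12, val, sk (b 2) (b 0), sk (b 3) (b 0), sk (b 3) (b 1)]
    field_simp
    simp only [lefschetzCoeff, pfaffian, Matrix.cons_val]
    ring

end FourDimensional

/-! ### Invariant 2-forms on `ℂ²` -/

section ComplexPlane

abbrev C2 : Type := Fin 2 → ℂ

/-- The real basis `(1, 0), (i, 0), (0, 1), (0, i)` of `ℂ²`. -/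
def C2.basis : Module.Basis (Fin 4) ℝ C2 :=
  .ofEquivFun
    { toFun := fun v ↦ ![(v 0).re, (v 0).im, (v 1).re, (v 1).im]
      invFun := fun c ↦ ![⟨c 0, c 1⟩, ⟨c 2, c 3⟩]
      map_add' := fun v w ↦ by ext i; fin_cases i <;> simp
      map_smul' := fun r v ↦ by ext i; fin_cases i <;> simp
      left_inv := fun v ↦ by ext i; fin_cases i <;> simp
      right_inv := fun c ↦ by ext i; fin_cases i <;> simp }

/-- Multiplication by `i`. -/
def C2.mulI : C2 →L[ℝ] C2 :=
  (Complex.I • ContinuousLinearMap.id ℂ C2).restrictScalars ℝ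

@[simp] theorem C2.mulI_apply (v : C2) : C2.mulI v = Complex.I • v := rfl

theorem C2.basis_one : C2.basis 1 = Complex.I • C2.basis 0 := by
  ext i; fin_cases i <;> simp [C2.basis, Complex.ext_iff]

theorem C2.basis_three : C2.basis 3 = Complex.I • C2.basis 2 := by
  ext i; fin_cases i <;> simp [C2.basis, Complex.ext_iff]

theorem C2.I_smul_I_smul (v : C2) : Complex.I • Complex.I • v = -v := by
  rw [smul_smul, Complex.I_mul_I, neg_one_smul]

/-- The form `ad - p² - q²` is Lorentzian, `key` says that `(α, δ, t/2, s/2)` is timelike, and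
`orth` is orthogonality to it. A vector orthogonal to a timelike one cannot be timelike, nor a
nonzero null vector. -/
theorem reversed_cauchy_schwarz {a d p q s t α δ : ℝ} (key : s ^ 2 + t ^ 2 < 4 * α * δ)
    (orth : a * δ + d * α = p * t + q * s) (h : p ^ 2 + q ^ 2 ≤ a * d) :
    a * d = 0 ∧ p = 0 ∧ q = 0 := by
  have cs : (p * t + q * s) ^ 2 ≤ (p ^ 2 + q ^ 2) * (s ^ 2 + t ^ 2) := by
    nlinarith [sq_nonneg (p * s - q * t)]
  have am : 4 * (a * d) * (α * δ) ≤ (a * δ + d * α) ^ 2 := by nlinarith [sq_nonneg (a * δ - d * α)]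
  rw [orth] at am
  have h1 : (p ^ 2 + q ^ 2) * (s ^ 2 + t ^ 2) ≤ a * d * (s ^ 2 + t ^ 2) :=
    mul_le_mul_of_nonneg_right h (by positivity)
  have h2 : a * d * (4 * α * δ - (s ^ 2 + t ^ 2)) ≤ 0 := by linarith
  have h3 : a * d ≤ 0 := by
    by_contra! h'
    have := mul_pos h' (sub_pos.mpr key)
    linarith
  have hp := sq_nonneg p
  have hq := sq_nonneg q
  exact ⟨by linarith, by simpa using le_antisymm (by linarith : p ^ 2 ≤ 0) hp,
    by simpa using le_antisymm (by linarith : q ^ 2 ≤ 0) hq⟩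

/-- An `i`-invariant 2-form orthogonal to a taming 2-form is negative for the wedge product. -/
theorem wedge22_self_nonpos {B Ω : C2 →L[ℝ] C2 →L[ℝ] ℝ} (altB : ∀ v, B v v = 0)
    (altΩ : ∀ v, Ω v v = 0) (inv : ∀ v w, B (Complex.I • v) (Complex.I • w) = B v w)
    (tame : ∀ v, v ≠ 0 → 0 < Ω v (Complex.I • v))
    (orth : wedge22 B Ω (C2.basis 0) (C2.basis 1) (C2.basis 2) (C2.basis 3) = 0) :
    wedge22 B B (C2.basis 0) (C2.basis 1) (C2.basis 2) (C2.basis 3) ≤ 0 ∧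
      (wedge22 B B (C2.basis 0) (C2.basis 1) (C2.basis 2) (C2.basis 3) = 0 → B = 0) := by
  have skB := skew_of_alt altB
  have skΩ := skew_of_alt altΩ
  have e1 := C2.basis_one
  have e3 := C2.basis_three
  have li := Fintype.linearIndependent_iff.mp C2.basis.linearIndependent
  set e := C2.basis
  have J0 : Complex.I • e 0 = e 1 := e1.symm
  have J1 : Complex.I • e 1 = -e 0 := by rw [e1, C2.I_smul_I_smul]
  have J2 : Complex.I • e 2 = e 3 := e3.symm
  have J3 : Complex.I • e 3 = -e 2 := by rw [e3, C2.I_smul_I_smul]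
  have i02 := inv (e 0) (e 2)
  have i03 := inv (e 0) (e 3)
  rw [J0, J2] at i02
  rw [J0, J3, map_neg] at i03
  have pos0 := tame (e 0) (e.ne_zero 0)
  have pos2 := tame (e 2) (e.ne_zero 2)
  rw [J0] at pos0
  rw [J2] at pos2
  obtain ⟨s, hs⟩ : ∃ s, s = Ω (e 1) (e 2) - Ω (e 0) (e 3) := ⟨_, rfl⟩
  obtain ⟨t, ht⟩ : ∃ t, t = Ω (e 0) (e 2) + Ω (e 1) (e 3) := ⟨_, rfl⟩
  -- For `v = a e₀ + b e₂ + c e₃` one has `Ω(v, iv) = a²Ω(e₀, e₁) - ab s - ac t + (b² + c²)Ω(e₂,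
  -- e₃)`. The chosen vector minimises this for fixed `a`, so its positivity is the discriminant
  -- inequality `key`.
  have hne : (2 * Ω (e 2) (e 3)) • e 0 + s • e 2 + t • e 3 ≠ 0 := fun h ↦ by
    have := li ![2 * Ω (e 2) (e 3), 0, s, t] (by simp [Fin.sum_univ_four, ← h]) 0
    simp at this; linarith
  have pos := tame _ hne
  have hJ : Complex.I • ((2 * Ω (e 2) (e 3)) • e 0 + s • e 2 + t • e 3) =
      (2 * Ω (e 2) (e 3)) • e 1 + s • e 3 - t • e 2 := by
    rw [smul_add, smul_add, smul_comm Complex.I, smul_comm Complex.I, smul_comm Complex.I,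
      J0, J2, J3]
    module
  rw [hJ] at pos
  simp only [map_add, map_sub, map_smul, add_apply, smul_apply, smul_eq_mul, altΩ,
    skΩ (e 2) (e 1), skΩ (e 3) (e 1), skΩ (e 3) (e 2), mul_zero, add_zero] at pos
  have key : s ^ 2 + t ^ 2 < 4 * Ω (e 0) (e 1) * Ω (e 2) (e 3) := by
    have : 0 < Ω (e 2) (e 3) * (4 * Ω (e 0) (e 1) * Ω (e 2) (e 3) - (s ^ 2 + t ^ 2)) := by
      rw [hs, ht] at pos ⊢; nlinarith
    nlinarith [(mul_pos_iff_of_pos_left pos2).mp this]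
  -- By invariance only four coefficients `a`, `d`, `p`, `q` of `B` are independent, and `B ∧ B`
  -- equals `2(ad - p² - q²)`.
  simp only [wedge22] at orth ⊢
  rw [← i02] at orth ⊢
  rw [← i03] at orth ⊢
  have orth' : B (e 0) (e 1) * Ω (e 2) (e 3) + B (e 2) (e 3) * Ω (e 0) (e 1) =
      B (e 1) (e 3) * t + B (e 1) (e 2) * s := by
    rw [hs, ht]; linarith
  obtain ⟨a, ha⟩ : ∃ a, a = B (e 0) (e 1) := ⟨_, rfl⟩
  obtain ⟨d, hd⟩ : ∃ d, d = B (e 2) (e 3) := ⟨_, rfl⟩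
  obtain ⟨p, hp⟩ : ∃ p, p = B (e 1) (e 3) := ⟨_, rfl⟩
  obtain ⟨q, hq⟩ : ∃ q, q = B (e 1) (e 2) := ⟨_, rfl⟩
  rw [← ha, ← hd, ← hp, ← hq] at orth' ⊢
  generalize Ω (e 0) (e 1) = α at *
  generalize Ω (e 2) (e 3) = δ at *
  have main := reversed_cauchy_schwarz key orth'
  constructor
  · by_contra! h
    have h' : p ^ 2 + q ^ 2 < a * d := by nlinarith
    obtain ⟨h1, h2, h3⟩ := main h'.le
    rw [h1, h2, h3] at h'
    norm_num at h'
  · intro h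
    obtain ⟨h1, h2, h3⟩ := main (by nlinarith)
    rw [h2, h3, zero_mul, zero_mul, add_zero] at orth'
    -- One of `a`, `d` vanishes; orthogonality, with both diagonal coefficients of `Ω` positive,
    -- kills the other.
    have had : a = 0 ∧ d = 0 := by
      rcases mul_eq_zero.mp h1 with h | h <;> rw [h] at orth' ⊢
      · simpa [pos0.ne'] using orth'
      · simpa [pos2.ne'] using orth'
    obtain ⟨rfl, rfl⟩ := had
    have val : ∀ i j, B (e i) (e j) = 0 := by
      intro i j
      have h02 : B (e 0) (e 2) = 0 := by rw [← i02, ← hp, h2]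
      have h03 : B (e 0) (e 3) = 0 := by rw [← i03, ← hq, h3, neg_zero]
      fin_cases i <;> fin_cases j <;>
        simp [altB, ← ha, ← hd, ← hp, ← hq, h2, h3, h02, h03, skB (e 1) (e 0), skB (e 2) (e 0),
          skB (e 3) (e 0), skB (e 2) (e 1), skB (e 3) (e 1), skB (e 3) (e 2)]
    have row : ∀ i, B (e i) = 0 := fun i ↦
      ContinuousLinearMap.coe_inj.mp (e.ext fun j ↦ by simpa using val i j)
    exact ContinuousLinearMap.coe_inj.mp (e.ext fun i ↦ by simpa using row i)

end ComplexPlane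

/-! ### Tensor fields in holomorphic charts -/

section Charts

theorem contMDiffWithinAt_of_trivial {M : Type*} [TopologicalSpace M] [ChartedSpace E4 M]
    {N F H : Type*} [NormedAddCommGroup F] [NormedSpace ℝ F]
    [TopologicalSpace H] {I : ModelWithCorners ℝ F H} [TopologicalSpace N] [ChartedSpace H N]
    {s : Set N} {x : N} {b : N → M} {c : N → ℝ}
    (h : ContMDiffWithinAt I ((𝓡 4).prod 𝓘(ℝ, ℝ)) ∞
      (fun y ↦ Bundle.TotalSpace.mk' ℝ (E := Bundle.Trivial M ℝ) (b y) (c y)) s x) :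
    ContMDiffWithinAt I 𝓘(ℝ, ℝ) ∞ c s x :=
  (Bundle.contMDiffWithinAt_totalSpace.mp h).2

variable {M : Type*} [TopologicalSpace M] [ChartedSpace E4 M] [IsManifold (𝓡 4) ∞ M]

/-- A smooth chart with values in `ℂ²` which is holomorphic for `J`. -/
structure HolChart (J : CplxStructure M) where
  φ : OpenPartialHomeomorph M C2
  smooth : ContMDiffOn (𝓡 4) 𝓘(ℝ, C2) ∞ φ φ.source
  smooth_symm : ContMDiffOn 𝓘(ℝ, C2) (𝓡 4) ∞ φ.symm φ.target
  hol : ∀ y ∈ φ.source, ∀ v : TangentSpace (𝓡 4) y,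
    cdiff φ y (J.J y v) = Complex.I • cdiff φ y v

theorem CplxStructure.exists_chart (J : CplxStructure M) (x : M) :
    ∃ ψ : HolChart J, x ∈ ψ.φ.source := by
  obtain ⟨φ, h1, h2, h3, h4⟩ := J.integrable x
  exact ⟨⟨φ, h2, h3, h4⟩, h1⟩

namespace HolChart

variable {J : CplxStructure M} (ψ : HolChart J)

/-- The differential of a chart. -/
def D (y : M) : TangentSpace (𝓡 4) y →L[ℝ] C2 := cdiff ψ.φ y

/-- The differential of the inverse of a chart. -/
def E (z : C2) : C2 →L[ℝ] TangentSpace (𝓡 4) (ψ.φ.symm z) :=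
  mfderiv 𝓘(ℝ, C2) (𝓡 4) ψ.φ.symm z

theorem mdiff {y : M} (hy : y ∈ ψ.φ.source) : MDifferentiableAt (𝓡 4) 𝓘(ℝ, C2) ψ.φ y :=
  ((ψ.smooth y hy).contMDiffAt (ψ.φ.open_source.mem_nhds hy)).mdifferentiableAt (by simp)

theorem mdiff_symm {z : C2} (hz : z ∈ ψ.φ.target) :
    MDifferentiableAt 𝓘(ℝ, C2) (𝓡 4) ψ.φ.symm z :=
  ((ψ.smooth_symm z hz).contMDiffAt (ψ.φ.open_target.mem_nhds hz)).mdifferentiableAt (by simp)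

theorem D_E {z : C2} (hz : z ∈ ψ.φ.target) (w : C2) : ψ.D (ψ.φ.symm z) (ψ.E z w) = w := by
  have h := mfderiv_comp z (ψ.mdiff (ψ.φ.map_target hz)) (ψ.mdiff_symm hz)
  have e : ψ.φ ∘ ψ.φ.symm =ᶠ[nhds z] id := by
    filter_upwards [ψ.φ.open_target.mem_nhds hz] with t ht using ψ.φ.right_inv ht
  rw [e.mfderiv_eq, mfderiv_id] at h
  exact (congrArg (fun L : C2 →L[ℝ] C2 ↦ L w) h).symm

theorem E_D {z : C2} (hz : z ∈ ψ.φ.target) (v : TangentSpace (𝓡 4) (ψ.φ.symm z)) :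
    ψ.E z (ψ.D (ψ.φ.symm z) v) = v := by
  -- `D_E` gives one composite; equality of dimensions makes the injective map `ψ.E z` surjective,
  -- hence the other composite.
  have inj : Function.Surjective (ψ.E z) := by
    have fin : FiniteDimensional ℝ (TangentSpace (𝓡 4) (ψ.φ.symm z)) :=
      inferInstanceAs (FiniteDimensional ℝ E4)
    have h1 : Function.Injective (ψ.E z : C2 →ₗ[ℝ] TangentSpace (𝓡 4) (ψ.φ.symm z)) :=
      Function.LeftInverse.injective (ψ.D_E hz)
    refine (LinearMap.injective_iff_surjective_of_finrank_eq_finrank ?_).mp h1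
    have : Module.finrank ℝ (TangentSpace (𝓡 4) (ψ.φ.symm z)) = Module.finrank ℝ E4 := rfl
    rw [this, Module.finrank_eq_card_basis C2.basis]
    simp
  obtain ⟨w, rfl⟩ := inj v
  rw [ψ.D_E hz]

theorem D_J {z : C2} (hz : z ∈ ψ.φ.target) (v : TangentSpace (𝓡 4) (ψ.φ.symm z)) :
    ψ.D _ (J.J _ v) = Complex.I • ψ.D _ v := ψ.hol _ (ψ.φ.map_target hz) v

theorem E_I {z : C2} (hz : z ∈ ψ.φ.target) (w : C2) :
    ψ.E z (Complex.I • w) = J.J _ (ψ.E z w) := by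
  rw [← ψ.E_D hz (J.J _ (ψ.E z w)), ψ.D_J hz, ψ.D_E hz]

/-- The coordinate expression of a 1-form. -/
def pull1 (η : ∀ x : M, TangentSpace (𝓡 4) x →L[ℝ] ℝ) (z : C2) : C2 →L[ℝ] ℝ :=
  (η (ψ.φ.symm z)).comp (ψ.E z)

/-- The coordinate expression of a bilinear form. -/
def pull2 (Ω : ∀ x : M, TangentSpace (𝓡 4) x →L[ℝ] TangentSpace (𝓡 4) x →L[ℝ] ℝ) (z : C2) :
    C2 →L[ℝ] C2 →L[ℝ] ℝ :=
  ContinuousLinearMap.bilinearComp (show E4 →L[ℝ] E4 →L[ℝ] ℝ from Ω (ψ.φ.symm z))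
    (show C2 →L[ℝ] E4 from ψ.E z) (show C2 →L[ℝ] E4 from ψ.E z)

theorem pull1_apply (η : ∀ x : M, TangentSpace (𝓡 4) x →L[ℝ] ℝ) (z w : C2) :
    ψ.pull1 η z w = η (ψ.φ.symm z) (ψ.E z w) := rfl

theorem pull2_apply (Ω : ∀ x : M, TangentSpace (𝓡 4) x →L[ℝ] TangentSpace (𝓡 4) x →L[ℝ] ℝ)
    (z v w : C2) : ψ.pull2 Ω z v w = Ω (ψ.φ.symm z) (ψ.E z v) (ψ.E z w) := rfl

/-- Coordinate fields are smooth. -/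
theorem contMDiffOn_E (w : C2) : ContMDiffOn 𝓘(ℝ, C2) ((𝓡 4).prod 𝓘(ℝ, E4)) ∞
    (fun z ↦ (⟨ψ.φ.symm z, ψ.E z w⟩ : TangentBundle (𝓡 4) M)) ψ.φ.target := by
  have h := ψ.smooth_symm.contMDiffOn_tangentMapWithin (m := ∞) (by simp)
    ψ.φ.open_target.uniqueMDiffOn
  have c : ContMDiff 𝓘(ℝ, C2) (𝓘(ℝ, C2).tangent) ∞
      (fun z : C2 ↦ (⟨z, w⟩ : TangentBundle 𝓘(ℝ, C2) C2)) := by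
    exact contMDiff_vectorSpace_iff_contDiff.mpr contDiff_const
  refine (h.comp c.contMDiffOn (fun z hz ↦ hz)).congr fun z hz ↦ ?_
  simp only [Function.comp, tangentMapWithin, E]
  rw [mfderivWithin_of_isOpen ψ.φ.open_target hz]
  rfl

theorem contDiffOn_pull1 {η : ∀ x : M, TangentSpace (𝓡 4) x →L[ℝ] ℝ}
    (hη : ContMDiff (𝓡 4) ((𝓡 4).prod 𝓘(ℝ, E4 →L[ℝ] ℝ)) ∞
      (fun x ↦ Bundle.TotalSpace.mk' (E4 →L[ℝ] ℝ)
        (E := fun x : M ↦ TangentSpace (𝓡 4) x →L[ℝ] Bundle.Trivial M ℝ x) x (η x))) :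
    ContDiffOn ℝ ∞ (ψ.pull1 η) ψ.φ.target := by
  rw [contDiffOn_clm_apply]
  intro w z hz
  have h1 := (ψ.contMDiffOn_E w z hz)
  have h2 := (hη.contMDiffAt (x := ψ.φ.symm z)).comp_contMDiffWithinAt z (ψ.smooth_symm z hz)
  have := ContMDiffWithinAt.clm_bundle_apply (F₁ := E4) (F₂ := ℝ)
    (E₁ := fun x : M ↦ TangentSpace (𝓡 4) x) (E₂ := Bundle.Trivial M ℝ) (b := ψ.φ.symm)
    (ϕ := fun z ↦ η (ψ.φ.symm z)) (v := fun z ↦ ψ.E z w) h2 h1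
  exact (contMDiffWithinAt_of_trivial this).contDiffWithinAt

theorem contDiffOn_pull2 {Ω : ∀ x : M, TangentSpace (𝓡 4) x →L[ℝ] TangentSpace (𝓡 4) x →L[ℝ] ℝ}
    (hη : ContMDiff (𝓡 4) ((𝓡 4).prod 𝓘(ℝ, E4 →L[ℝ] E4 →L[ℝ] ℝ)) ∞
    (fun x ↦ Bundle.TotalSpace.mk' (E4 →L[ℝ] E4 →L[ℝ] ℝ)
      (E := fun x : M ↦ TangentSpace (𝓡 4) x →L[ℝ] TangentSpace (𝓡 4) x →L[ℝ]
        Bundle.Trivial M ℝ x) x (Ω x))) :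
    ContDiffOn ℝ ∞ (ψ.pull2 Ω) ψ.φ.target := by
  rw [contDiffOn_clm_apply]
  intro v
  rw [contDiffOn_clm_apply]
  intro w z hz
  have h2 := (hη.contMDiffAt (x := ψ.φ.symm z)).comp_contMDiffWithinAt z (ψ.smooth_symm z hz)
  have := ContMDiffWithinAt.clm_bundle_apply₂ (F₁ := E4) (F₂ := E4) (F₃ := ℝ)
    (E₁ := fun x : M ↦ TangentSpace (𝓡 4) x) (E₂ := fun x : M ↦ TangentSpace (𝓡 4) x)
    (E₃ := Bundle.Trivial M ℝ) (b := ψ.φ.symm)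
    (ψ := fun z ↦ Ω (ψ.φ.symm z)) (v := fun z ↦ ψ.E z v) (w := fun z ↦ ψ.E z w) h2
    (ψ.contMDiffOn_E v z hz) (ψ.contMDiffOn_E w z hz)
  exact (contMDiffWithinAt_of_trivial this).contDiffWithinAt

theorem contMDiffAt_D {x : M} (hx : x ∈ ψ.φ.source) :
    ContMDiffAt (𝓡 4) 𝓘(ℝ, E4 →L[ℝ] C2) ∞ (fun y ↦
      (ψ.D y).comp ((trivializationAt E4 (TangentSpace (𝓡 4)) x).symmL ℝ y)) x := by
  have h := ((ψ.smooth x hx).contMDiffAt (ψ.φ.open_source.mem_nhds hx)).mfderiv_const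
    (m := ∞) (by simp)
  refine h.congr_of_eventuallyEq ?_
  filter_upwards with y
  ext w
  simp [inTangentCoordinates, ContinuousLinearMap.inCoordinates]
  rfl

/-- Together with `contMDiffAt_of_pull2`, this allows global tensor fields to be proved smooth from
their expressions in holomorphic charts. -/
theorem contMDiffAt_of_pull1 {η : ∀ x : M, TangentSpace (𝓡 4) x →L[ℝ] ℝ} {x : M}
    (hx : x ∈ ψ.φ.source) (h : ContDiffAt ℝ ∞ (ψ.pull1 η) (ψ.φ x)) :
    ContMDiffAt (𝓡 4) ((𝓡 4).prod 𝓘(ℝ, E4 →L[ℝ] ℝ)) ∞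
      (fun x ↦ Bundle.TotalSpace.mk' (E4 →L[ℝ] ℝ)
        (E := fun x : M ↦ TangentSpace (𝓡 4) x →L[ℝ] Bundle.Trivial M ℝ x) x (η x)) x := by
  rw [contMDiffAt_hom_bundle]
  refine ⟨contMDiffAt_id, ?_⟩
  have hφ := (ψ.smooth x hx).contMDiffAt (ψ.φ.open_source.mem_nhds hx)
  have h1 : ContMDiffAt (𝓡 4) 𝓘(ℝ, C2 →L[ℝ] ℝ) ∞ (fun y ↦ ψ.pull1 η (ψ.φ y)) x :=
    h.contMDiffAt.comp x hφ
  refine (h1.clm_comp (ψ.contMDiffAt_D hx)).congr_of_eventuallyEq ?_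
  filter_upwards [ψ.φ.open_source.mem_nhds hx] with y hy
  obtain ⟨z, hz, rfl⟩ : ∃ z ∈ ψ.φ.target, ψ.φ.symm z = y :=
    ⟨ψ.φ y, ψ.φ.map_source hy, ψ.φ.left_inv hy⟩
  ext w
  simp [ContinuousLinearMap.inCoordinates, ψ.φ.right_inv hz, pull1_apply, ψ.E_D hz]

theorem contMDiffAt_of_pull2
    {Ω : ∀ x : M, TangentSpace (𝓡 4) x →L[ℝ] TangentSpace (𝓡 4) x →L[ℝ] ℝ} {x : M}
    (hx : x ∈ ψ.φ.source) (h : ContDiffAt ℝ ∞ (ψ.pull2 Ω) (ψ.φ x)) :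
    ContMDiffAt (𝓡 4) ((𝓡 4).prod 𝓘(ℝ, E4 →L[ℝ] E4 →L[ℝ] ℝ)) ∞
    (fun x ↦ Bundle.TotalSpace.mk' (E4 →L[ℝ] E4 →L[ℝ] ℝ)
      (E := fun x : M ↦ TangentSpace (𝓡 4) x →L[ℝ] TangentSpace (𝓡 4) x →L[ℝ]
        Bundle.Trivial M ℝ x) x (Ω x)) x := by
  rw [contMDiffAt_hom_bundle]
  refine ⟨contMDiffAt_id, ?_⟩
  have hφ := (ψ.smooth x hx).contMDiffAt (ψ.φ.open_source.mem_nhds hx)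
  have h1 : ContMDiffAt (𝓡 4) 𝓘(ℝ, C2 →L[ℝ] C2 →L[ℝ] ℝ) ∞ (fun y ↦ ψ.pull2 Ω (ψ.φ y)) x :=
    h.contMDiffAt.comp x hφ
  have hD := ψ.contMDiffAt_D hx
  have h2 := ((ContinuousLinearMap.compL ℝ E4 C2 ℝ).flip.contDiff.contMDiff.contMDiffAt.comp x
    hD).clm_comp (h1.clm_comp hD)
  refine h2.congr_of_eventuallyEq ?_
  have hb := (trivializationAt E4 (TangentSpace (𝓡 4)) x).open_baseSet.mem_nhds
    (FiberBundle.mem_baseSet_trivializationAt' x)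
  filter_upwards [ψ.φ.open_source.mem_nhds hx, hb] with y hy hyb
  obtain ⟨z, hz, rfl⟩ : ∃ z ∈ ψ.φ.target, ψ.φ.symm z = y :=
    ⟨ψ.φ y, ψ.φ.map_source hy, ψ.φ.left_inv hy⟩
  ext v w
  have := inCoordinates_apply_eq₂ (F₃ := ℝ) (E₃ := Bundle.Trivial M ℝ)
    (ϕ := Ω (ψ.φ.symm z)) hyb hyb (by simp) (v := v) (w := w)
  refine Eq.trans this ?_
  simp [ψ.φ.right_inv hz, pull2_apply, ψ.E_D hz, Bundle.Trivialization.symmL_apply (hb := hyb)]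

/-- The derivative of a function in a chart. -/
theorem mfderiv_eq {F : Type*} [NormedAddCommGroup F] [NormedSpace ℝ F] {f : M → F} {z : C2}
    (hz : z ∈ ψ.φ.target)
    (hf : DifferentiableAt ℝ (fun t ↦ f (ψ.φ.symm t)) z) (v : TangentSpace (𝓡 4) (ψ.φ.symm z)) :
    mfderiv (𝓡 4) 𝓘(ℝ, F) f (ψ.φ.symm z) v =
      fderiv ℝ (fun t ↦ f (ψ.φ.symm t)) z (ψ.D _ v) := by
  have e : f =ᶠ[nhds (ψ.φ.symm z)] (fun t ↦ f (ψ.φ.symm t)) ∘ ψ.φ := by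
    filter_upwards [ψ.φ.open_source.mem_nhds (ψ.φ.map_target hz)] with y hy
    simp [ψ.φ.left_inv hy]
  have h1 : MDifferentiableAt 𝓘(ℝ, C2) 𝓘(ℝ, F) (fun t ↦ f (ψ.φ.symm t))
      (ψ.φ (ψ.φ.symm z)) := by
    rw [ψ.φ.right_inv hz]; exact hf.mdifferentiableAt
  rw [e.mfderiv_eq, mfderiv_comp (ψ.φ.symm z) h1 (ψ.mdiff (ψ.φ.map_target hz)), mfderiv_eq_fderiv,
    ψ.φ.right_inv hz]
  rfl

/-- The coordinate expression of a vector field. -/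
def field (X : ∀ x : M, TangentSpace (𝓡 4) x) (z : C2) : C2 :=
  ψ.D (ψ.φ.symm z) (X (ψ.φ.symm z))

theorem E_field (X : ∀ x : M, TangentSpace (𝓡 4) x) {z : C2} (hz : z ∈ ψ.φ.target) :
    ψ.E z (ψ.field X z) = X (ψ.φ.symm z) := ψ.E_D hz _

theorem inverse_E {z : C2} (hz : z ∈ ψ.φ.target) : (ψ.E z).inverse = ψ.D (ψ.φ.symm z) :=
  ContinuousLinearMap.inverse_eq (by ext w; simp [ψ.E_D hz]) (by ext w; simp [ψ.D_E hz])

theorem field_eq_mpullback (X : ∀ x : M, TangentSpace (𝓡 4) x) {z : C2} (hz : z ∈ ψ.φ.target) :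
    ψ.field X z = VectorField.mpullback 𝓘(ℝ, C2) (𝓡 4) ψ.φ.symm X z := by
  rw [VectorField.mpullback_apply]
  exact (congrArg (fun L : TangentSpace (𝓡 4) (ψ.φ.symm z) →L[ℝ] C2 ↦ L (X (ψ.φ.symm z)))
    (ψ.inverse_E hz)).symm

theorem contDiffOn_field {X : ∀ x : M, TangentSpace (𝓡 4) x} (hX : IsSmoothField X) :
    ContDiffOn ℝ ∞ (ψ.field X) ψ.φ.target := by
  intro z hz
  have h1 := ((ψ.smooth _ (ψ.φ.map_target hz)).contMDiffAt
    (ψ.φ.open_source.mem_nhds (ψ.φ.map_target hz)))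
  have h2 := ((ψ.smooth.contMDiffOn_tangentMapWithin (m := ∞) (by simp)
    ψ.φ.open_source.uniqueMDiffOn).comp hX.contMDiffOn (fun y hy ↦ hy)).comp ψ.smooth_symm
    (fun t ht ↦ ψ.φ.map_target ht)
  have h3 : ContMDiffOn 𝓘(ℝ, C2) (𝓘(ℝ, C2).tangent) ∞
      (fun z : C2 ↦ (⟨z, ψ.field X z⟩ : TangentBundle 𝓘(ℝ, C2) C2)) ψ.φ.target := by
    refine h2.congr fun z hz ↦ ?_
    simp only [Function.comp, tangentMapWithin, field, D, cdiff]
    rw [mfderivWithin_of_isOpen ψ.φ.open_source (ψ.φ.map_target hz), ψ.φ.right_inv hz]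
    rfl
  exact (contMDiffOn_vectorSpace_iff_contDiffOn.mp h3) z hz

theorem D_mlieBracket {X Y : ∀ x : M, TangentSpace (𝓡 4) x} (hX : IsSmoothField X)
    (hY : IsSmoothField Y) {z : C2} (hz : z ∈ ψ.φ.target) :
    ψ.field (VectorField.mlieBracket (𝓡 4) X Y) z =
      VectorField.lieBracket ℝ (ψ.field X) (ψ.field Y) z := by
  have man : IsManifold (𝓡 4) (minSmoothness ℝ 2) M := by
    rw [minSmoothness_of_isRCLikeNormedField]
    exact IsManifold.of_le (n := ∞) (by norm_cast)
  have h := VectorField.mpullback_mlieBracket (I := 𝓘(ℝ, C2)) (I' := 𝓡 4) (f := ψ.φ.symm)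
    (V := X) (W := Y) (x₀ := z) (n := ∞) (hX.mdifferentiableAt (by simp))
    (hY.mdifferentiableAt (by simp))
    ((ψ.smooth_symm z hz).contMDiffAt (ψ.φ.open_target.mem_nhds hz))
    (by rw [minSmoothness_of_isRCLikeNormedField]; norm_cast)
  rw [ψ.field_eq_mpullback _ hz]
  refine h.trans ?_
  have e : ∀ V W : C2 → C2, VectorField.mlieBracket 𝓘(ℝ, C2) V W z =
      VectorField.lieBracket ℝ V W z := fun V W ↦
    (congrFun VectorField.mlieBracketWithin_univ.symm z).trans
      ((congrFun VectorField.mlieBracketWithin_eq_lieBracketWithin z).trans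
        (congrFun VectorField.lieBracketWithin_univ z))
  have c : ∀ X : (∀ x : M, TangentSpace (𝓡 4) x),
      (VectorField.mpullback 𝓘(ℝ, C2) (𝓡 4) ψ.φ.symm X : C2 → C2) =ᶠ[nhds z] ψ.field X := by
    intro X
    filter_upwards [ψ.φ.open_target.mem_nhds hz] with t ht using (ψ.field_eq_mpullback X ht).symm
  have k : ∀ V V' W W' : C2 → C2, V =ᶠ[nhds z] V' → W =ᶠ[nhds z] W' →
      VectorField.lieBracket ℝ V W z = VectorField.lieBracket ℝ V' W' z :=
    fun _ _ _ _ h h' ↦ h.lieBracket_vectorField_eq h'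
  exact (e _ _).trans (k _ _ _ _ (c X) (c Y))

end HolChart

end Charts

/-! ### The 2-form of a bi-Hermitian structure -/

section Fundamental

variable {M : Type*} [TopologicalSpace M] [ChartedSpace E4 M] [IsManifold (𝓡 4) ∞ M]

theorem HolChart.contDiffOn_metric {J : CplxStructure M} (ψ : HolChart J) (g : RMetric M)
    (v w : C2) : ContDiffOn ℝ ∞ (fun z ↦ g.inner (ψ.φ.symm z) (ψ.E z v) (ψ.E z w)) ψ.φ.target := by
  have h := ψ.contDiffOn_pull2 (Ω := g.inner) g.contMDiff
  rw [contDiffOn_clm_apply] at h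
  have h' := h v
  rw [contDiffOn_clm_apply] at h'
  exact h' w

theorem HolChart.contMDiffWithinAt_apply_E {J : CplxStructure M} (ψ : HolChart J)
    (J' : CplxStructure M) (v : C2) {z : C2} (hz : z ∈ ψ.φ.target) :
    ContMDiffWithinAt 𝓘(ℝ, C2) ((𝓡 4).prod 𝓘(ℝ, E4)) ∞
      (fun z ↦ (⟨ψ.φ.symm z, J'.J _ (ψ.E z v)⟩ : TangentBundle (𝓡 4) M)) ψ.φ.target z :=
  ContMDiffWithinAt.clm_bundle_apply (F₁ := E4) (F₂ := E4)
    (E₁ := fun x : M ↦ TangentSpace (𝓡 4) x) (E₂ := fun x : M ↦ TangentSpace (𝓡 4) x)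
    (b := ψ.φ.symm) (ϕ := fun z ↦ J'.J (ψ.φ.symm z)) (v := fun z ↦ ψ.E z v)
    ((J'.smooth.contMDiffAt (x := ψ.φ.symm z)).comp_contMDiffWithinAt z (ψ.smooth_symm z hz))
    (ψ.contMDiffOn_E v z hz)

theorem HolChart.contDiffOn_metric_comp {J : CplxStructure M} (ψ : HolChart J)
    (J' : CplxStructure M) (g : RMetric M) (v w : C2) : ContDiffOn ℝ ∞
      (fun z ↦ g.inner (ψ.φ.symm z) (J'.J _ (ψ.E z v)) (ψ.E z w)) ψ.φ.target := by
  intro z hz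
  have h2 := (g.contMDiff.contMDiffAt (x := ψ.φ.symm z)).comp_contMDiffWithinAt z
    (ψ.smooth_symm z hz)
  have := ContMDiffWithinAt.clm_bundle_apply₂ (F₁ := E4) (F₂ := E4) (F₃ := ℝ)
    (E₁ := fun x : M ↦ TangentSpace (𝓡 4) x) (E₂ := fun x : M ↦ TangentSpace (𝓡 4) x)
    (E₃ := Bundle.Trivial M ℝ) (b := ψ.φ.symm)
    (ψ := fun z ↦ g.inner (ψ.φ.symm z)) (v := fun z ↦ J'.J _ (ψ.E z v)) (w := fun z ↦ ψ.E z w) h2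
    (ψ.contMDiffWithinAt_apply_E J' v hz) (ψ.contMDiffOn_E w z hz)
  exact (contMDiffWithinAt_of_trivial this).contDiffWithinAt

/-- The form is `(1 - p)⁻¹ g((J₊ - J₋)·, ·)`. The factor is chosen so that `Ω(v, J₊v) = g(v, v)`;
the metric comes back from `(J₊ - J₋)² = -2(1 - p)`. -/
theorem BiHermitian.exists_twoForm (B : BiHermitian M) (hne : ∀ x : M, B.Jp.J x ≠ B.Jm.J x) :
    ∃ (g : RMetric M) (Ω : TwoForm M), g.conformalClass = B.c ∧
      (∀ x v w, Ω.val x (B.Jm.J x v) w = Ω.val x v (B.Jp.J x w)) ∧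
      (∀ x v, v ≠ 0 → 0 < Ω.val x v (B.Jp.J x v)) ∧
      ∀ x v w, g.inner x v w = -(1 / 2) * Ω.val x (B.Jp.J x v - B.Jm.J x v) w := by
  obtain ⟨g, hg⟩ := Quotient.exists_rep B.c
  have op := B.orthogonal_p g hg
  have om := B.orthogonal_m g hg
  have sp := B.Jp.sq
  have sm := B.Jm.sq
  have h : ∀ x : M, ∃ p : ℝ, p < 1 ∧ (∀ v, B.Jp.J x (B.Jm.J x v) + B.Jm.J x (B.Jp.J x v) =
      (-2 * p) • v) ∧ ∀ v, g.inner x (B.Jm.J x v) (B.Jp.J x v) = p * g.inner x v v := by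
    intro x
    have fin : FiniteDimensional ℝ (TangentSpace (𝓡 4) x) :=
      inferInstanceAs (FiniteDimensional ℝ E4)
    have dim : Module.finrank ℝ (TangentSpace (𝓡 4) x) = 4 := by
      have : Module.finrank ℝ (TangentSpace (𝓡 4) x) = Module.finrank ℝ E4 := rfl
      rw [this]; simp
    let g' : TangentSpace (𝓡 4) x →ₗ[ℝ] TangentSpace (𝓡 4) x →ₗ[ℝ] ℝ :=
      LinearMap.mk₂ ℝ (fun v w ↦ g.inner x v w) (by simp) (by simp) (by simp) (by simp)
    exact anticommutator_lt_one dim g' (fun v w ↦ g.symm x v w) (fun v hv ↦ g.pos x v hv)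
      (B.Jp.J x : TangentSpace (𝓡 4) x →ₗ[ℝ] TangentSpace (𝓡 4) x)
      (B.Jm.J x : TangentSpace (𝓡 4) x →ₗ[ℝ] TangentSpace (𝓡 4) x)
      (sp x) (sm x) (op x) (om x) (B.sameOrientation x)
      (fun h ↦ hne x (ContinuousLinearMap.coe_inj.mp h))
  choose p hp anti inn using h
  have q : ∀ x, 0 < 1 - p x := fun x ↦ by linarith [hp x]
  let Ω : ∀ x : M, TangentSpace (𝓡 4) x →L[ℝ] TangentSpace (𝓡 4) x →L[ℝ] ℝ :=
    fun x ↦ (1 - p x)⁻¹ • (g.inner x).comp (B.Jp.J x - B.Jm.J x)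
  have hΩ : ∀ x v w, Ω x v w = (1 - p x)⁻¹ *
      (g.inner x (B.Jp.J x v) w - g.inner x (B.Jm.J x v) w) := fun x v w ↦ by
    simp [Ω]
  have swap : ∀ (J : CplxStructure M) (x : M) (v w : TangentSpace (𝓡 4) x),
      (∀ v w, g.inner x (J.J x v) (J.J x w) = g.inner x v w) →
      g.inner x v (J.J x w) = -g.inner x (J.J x v) w := fun J x v w h ↦ by
    rw [← h v (J.J x w), J.sq, map_neg]
  have adj : ∀ x v w, Ω x (B.Jm.J x v) w = Ω x v (B.Jp.J x w) := fun x v w ↦ by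
    rw [hΩ, hΩ, op, sm, swap B.Jp x _ _ (op x)]
    simp only [map_neg, neg_apply]
    ring
  have tame : ∀ x v, Ω x v (B.Jp.J x v) = g.inner x v v := fun x v ↦ by
    rw [hΩ, op, inn]
    field_simp [(q x).ne']
  refine ⟨g, ⟨Ω, fun x ↦ ?_, fun x v ↦ ?_⟩, hg, adj, fun x v hv ↦ ?_, fun x v w ↦ ?_⟩
  · obtain ⟨ψ, hψ⟩ := B.Jp.exists_chart x
    refine ψ.contMDiffAt_of_pull2 hψ (ContDiffOn.contDiffAt (s := ψ.φ.target) ?_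
      (ψ.φ.open_target.mem_nhds (ψ.φ.map_source hψ)))
    rw [contDiffOn_clm_apply]
    intro v
    rw [contDiffOn_clm_apply]
    intro w
    have G : ∀ v w, ContDiffOn ℝ ∞ (fun z ↦ g.inner (ψ.φ.symm z) (B.Jp.J _ (ψ.E z v)) (ψ.E z w)
      - g.inner (ψ.φ.symm z) (B.Jm.J _ (ψ.E z v)) (ψ.E z w)) ψ.φ.target := fun v w ↦
      (ψ.contDiffOn_metric_comp B.Jp g v w).sub (ψ.contDiffOn_metric_comp B.Jm g v w)
    have pos : ∀ z ∈ ψ.φ.target, 0 < g.inner (ψ.φ.symm z) (ψ.E z (C2.basis 0))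
        (ψ.E z (C2.basis 0)) := fun z hz ↦ g.pos _ _ fun h0 ↦ C2.basis.ne_zero 0 (by
      rw [← ψ.D_E hz (C2.basis 0), h0, map_zero])
    -- The function `p` was chosen pointwise, so its smoothness has to be extracted: evaluating on
    -- one coordinate field writes `(1 - p)⁻¹` as a quotient of smooth functions with nonzero
    -- denominator.
    have key : ∀ z ∈ ψ.φ.target,
        g.inner (ψ.φ.symm z) (B.Jp.J _ (ψ.E z (C2.basis 0))) (ψ.E z (Complex.I • C2.basis 0))
        - g.inner (ψ.φ.symm z) (B.Jm.J _ (ψ.E z (C2.basis 0))) (ψ.E z (Complex.I • C2.basis 0)) =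
        (1 - p (ψ.φ.symm z)) * g.inner (ψ.φ.symm z) (ψ.E z (C2.basis 0)) (ψ.E z (C2.basis 0)) := by
      intro z hz
      rw [ψ.E_I hz, op, inn]; ring
    refine (((ψ.contDiffOn_metric g (C2.basis 0) (C2.basis 0)).div
      (G (C2.basis 0) (Complex.I • C2.basis 0)) fun z hz ↦ ?_).mul (G v w)).congr fun z hz ↦ ?_
    · rw [key z hz]; exact (mul_pos (q _) (pos z hz)).ne'
    · rw [Pi.div_apply, key z hz, ψ.pull2_apply, hΩ]
      have := (pos z hz).ne'
      have := (q (ψ.φ.symm z)).ne'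
      field_simp
  · have h1 := swap B.Jp x v v (op x)
    have h2 := swap B.Jm x v v (om x)
    rw [g.symm] at h1 h2
    rw [hΩ]
    have h3 : g.inner x (B.Jp.J x v) v = 0 := by linarith
    have h4 : g.inner x (B.Jm.J x v) v = 0 := by linarith
    rw [h3, h4]; simp
  · rw [tame]; exact g.pos x v hv
  · have e : B.Jp.J x (B.Jp.J x v - B.Jm.J x v) - B.Jm.J x (B.Jp.J x v - B.Jm.J x v) =
        (-2 * (1 - p x)) • v := by
      have := anti x v
      rw [map_sub, map_sub, sp, sm]
      rw [show (-2 * (1 - p x)) • v = -(2 : ℝ) • v - (-2 * p x) • v by module, ← this]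
      module
    have := congrArg (fun u ↦ g.inner x u w) e
    simp only [map_sub, map_smul, sub_apply, smul_apply, smul_eq_mul] at this
    change _ = -(1 / 2) * Ω x _ w
    rw [hΩ]
    simp only [map_sub, sub_apply]
    rw [this]
    field_simp [(q x).ne']

end Fundamental

/-! ### The Lee form of a nondegenerate 2-form -/

section LeeForm

variable {M : Type*} [TopologicalSpace M] [ChartedSpace E4 M] [IsManifold (𝓡 4) ∞ M]
  {J J' : CplxStructure M}

namespace HolChart

variable (ψ : HolChart J) (χ : HolChart J')

theorem fderiv_comp_symm {F : Type*} [NormedAddCommGroup F] [NormedSpace ℝ F] {f : M → F} {z : C2}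
    (hz : z ∈ ψ.φ.target) (hf : MDifferentiableAt (𝓡 4) 𝓘(ℝ, F) f (ψ.φ.symm z)) (v : C2) :
    fderiv ℝ (fun t ↦ f (ψ.φ.symm t)) z v = cdiff f (ψ.φ.symm z) (ψ.E z v) := by
  have h := mfderiv_comp z hf (ψ.mdiff_symm hz)
  rw [mfderiv_eq_fderiv] at h
  exact congrArg (fun L : C2 →L[ℝ] F ↦ L v) h

theorem fderiv_transition {z : C2} (hz : z ∈ ψ.φ.target) (hχ : ψ.φ.symm z ∈ χ.φ.source) (v : C2) :
    fderiv ℝ (fun t ↦ χ.φ (ψ.φ.symm t)) z v = χ.D (ψ.φ.symm z) (ψ.E z v) :=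
  ψ.fderiv_comp_symm hz (χ.mdiff hχ) v

theorem contDiffAt_transition {z : C2} (hz : z ∈ ψ.φ.target) (hχ : ψ.φ.symm z ∈ χ.φ.source) :
    ContDiffAt ℝ ∞ (fun t ↦ χ.φ (ψ.φ.symm t)) z := by
  rw [← contMDiffAt_iff_contDiffAt]
  exact ((χ.smooth _ hχ).contMDiffAt (χ.φ.open_source.mem_nhds hχ)).comp z
    ((ψ.smooth_symm z hz).contMDiffAt (ψ.φ.open_target.mem_nhds hz))

theorem eventually_mem_source {z : C2} (hz : z ∈ ψ.φ.target) (hχ : ψ.φ.symm z ∈ χ.φ.source) :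
    ∀ᶠ t in nhds z, t ∈ ψ.φ.target ∧ ψ.φ.symm t ∈ χ.φ.source :=
  (show ∀ᶠ t in nhds z, t ∈ ψ.φ.target from ψ.φ.open_target.mem_nhds hz).and
    ((ψ.φ.continuousAt_symm hz).eventually (χ.φ.open_source.mem_nhds hχ))

theorem pull1_D (η : ∀ x : M, TangentSpace (𝓡 4) x →L[ℝ] ℝ) {y : M} (hy : y ∈ ψ.φ.source)
    (v : TangentSpace (𝓡 4) y) : ψ.pull1 η (ψ.φ y) (ψ.D y v) = η y v := by
  obtain ⟨z, hz, rfl⟩ : ∃ z ∈ ψ.φ.target, ψ.φ.symm z = y :=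
    ⟨ψ.φ y, ψ.φ.map_source hy, ψ.φ.left_inv hy⟩
  rw [ψ.φ.right_inv hz, pull1_apply, ψ.E_D hz]

theorem pull2_D (Ω : ∀ x : M, TangentSpace (𝓡 4) x →L[ℝ] TangentSpace (𝓡 4) x →L[ℝ] ℝ) {y : M}
    (hy : y ∈ ψ.φ.source) (v w : TangentSpace (𝓡 4) y) :
    ψ.pull2 Ω (ψ.φ y) (ψ.D y v) (ψ.D y w) = Ω y v w := by
  obtain ⟨z, hz, rfl⟩ : ∃ z ∈ ψ.φ.target, ψ.φ.symm z = y :=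
    ⟨ψ.φ y, ψ.φ.map_source hy, ψ.φ.left_inv hy⟩
  rw [ψ.φ.right_inv hz, pull2_apply, ψ.E_D hz, ψ.E_D hz]

theorem pull1_transition (η : ∀ x : M, TangentSpace (𝓡 4) x →L[ℝ] ℝ) {z : C2}
    (hz : z ∈ ψ.φ.target) (hχ : ψ.φ.symm z ∈ χ.φ.source) (v : C2) :
    ψ.pull1 η z v =
      χ.pull1 η (χ.φ (ψ.φ.symm z)) (fderiv ℝ (fun t ↦ χ.φ (ψ.φ.symm t)) z v) := by
  rw [fderiv_transition ψ χ hz hχ, pull1_D χ η hχ, pull1_apply]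

theorem pull2_transition
    (Ω : ∀ x : M, TangentSpace (𝓡 4) x →L[ℝ] TangentSpace (𝓡 4) x →L[ℝ] ℝ) {z : C2}
    (hz : z ∈ ψ.φ.target) (hχ : ψ.φ.symm z ∈ χ.φ.source) (v w : C2) :
    ψ.pull2 Ω z v w = χ.pull2 Ω (χ.φ (ψ.φ.symm z))
      (fderiv ℝ (fun t ↦ χ.φ (ψ.φ.symm t)) z v) (fderiv ℝ (fun t ↦ χ.φ (ψ.φ.symm t)) z w) := by
  rw [fderiv_transition ψ χ hz hχ, fderiv_transition ψ χ hz hχ, pull2_D χ Ω hχ, pull2_apply]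

variable (Ω : TwoForm M)

theorem contDiffAt_twoForm {z : C2} (hz : z ∈ ψ.φ.target) : ContDiffAt ℝ ∞ (ψ.pull2 Ω.val) z :=
  (ψ.contDiffOn_pull2 Ω.smooth).contDiffAt (ψ.φ.open_target.mem_nhds hz)

theorem contDiffAt_oneForm (θ : OneForm M) {z : C2} (hz : z ∈ ψ.φ.target) :
    ContDiffAt ℝ ∞ (ψ.pull1 θ.val) z :=
  (ψ.contDiffOn_pull1 θ.smooth).contDiffAt (ψ.φ.open_target.mem_nhds hz)

theorem contDiffAt_field {X : ∀ x : M, TangentSpace (𝓡 4) x} (hX : IsSmoothField X) {z : C2}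
    (hz : z ∈ ψ.φ.target) : ContDiffAt ℝ ∞ (ψ.field X) z :=
  (ψ.contDiffOn_field hX).contDiffAt (ψ.φ.open_target.mem_nhds hz)

theorem pull2_alt (z v : C2) : ψ.pull2 Ω.val z v v = 0 := Ω.alt _ _

theorem pull2_nondegenerate (nd : ∀ x v, Ω.val x v = 0 → v = 0) {z : C2} (hz : z ∈ ψ.φ.target)
    (v : C2) (h : ψ.pull2 Ω.val z v = 0) : v = 0 := by
  have : ψ.E z v = 0 := nd _ _ <| by
    ext w
    have := congrArg (fun L : C2 →L[ℝ] ℝ ↦ L (ψ.D _ w)) h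
    simpa [pull2_apply, ψ.E_D hz] using this
  rw [← ψ.D_E hz v, this, map_zero]

/-- The exterior derivative of a 1-form in a chart. -/
theorem d_oneForm (θ : OneForm M) {X Y : ∀ x : M, TangentSpace (𝓡 4) x} (hX : IsSmoothField X)
    (hY : IsSmoothField Y) {z : C2} (hz : z ∈ ψ.φ.target) :
    θ.d X Y (ψ.φ.symm z) = extd1 (ψ.pull1 θ.val) z (ψ.field X z) (ψ.field Y z) := by
  have T1 := (ψ.contDiffAt_oneForm θ hz).differentiableAt (by simp)
  have e : ∀ Y : (∀ x : M, TangentSpace (𝓡 4) x), (fun t ↦ θ.val (ψ.φ.symm t) (Y (ψ.φ.symm t)))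
      =ᶠ[nhds z] fun t ↦ ψ.pull1 θ.val t (ψ.field Y t) := fun Y ↦ by
    filter_upwards [ψ.φ.open_target.mem_nhds hz] with t ht
    rw [pull1_apply, ψ.E_field Y ht]
  have d : ∀ {X : ∀ x : M, TangentSpace (𝓡 4) x}, IsSmoothField X →
      DifferentiableAt ℝ (ψ.field X) z := fun hX ↦
    (ψ.contDiffAt_field hX hz).differentiableAt (by simp)
  have a : ∀ X {Y : ∀ x : M, TangentSpace (𝓡 4) x}, IsSmoothField Y →
      alongField X (fun y ↦ θ.val y (Y y)) (ψ.φ.symm z) =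
      fderiv ℝ (fun t ↦ ψ.pull1 θ.val t (ψ.field Y t)) z (ψ.field X z) := fun X Y hY ↦ by
    rw [alongField, ψ.mfderiv_eq hz, (e Y).fderiv_eq]
    · rfl
    · exact (T1.clm_apply (d hY)).congr_of_eventuallyEq (e Y)
  rw [← extd1_apply_field T1 (d hX) (d hY), ← ψ.D_mlieBracket hX hY hz, OneForm.d, a X hY, a Y hX,
    pull1_apply, ψ.E_field _ hz]

/-- The exterior derivative of a 2-form in a chart. -/
theorem d_twoForm {X Y Z : ∀ x : M, TangentSpace (𝓡 4) x} (hX : IsSmoothField X)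
    (hY : IsSmoothField Y) (hZ : IsSmoothField Z) {z : C2} (hz : z ∈ ψ.φ.target) :
    Ω.d X Y Z (ψ.φ.symm z) =
      extd2 (ψ.pull2 Ω.val) z (ψ.field X z) (ψ.field Y z) (ψ.field Z z) := by
  have T1 := (ψ.contDiffAt_twoForm Ω hz).differentiableAt (by simp)
  have e : ∀ Y Z : (∀ x : M, TangentSpace (𝓡 4) x),
      (fun t ↦ Ω.val (ψ.φ.symm t) (Y (ψ.φ.symm t)) (Z (ψ.φ.symm t)))
      =ᶠ[nhds z] fun t ↦ ψ.pull2 Ω.val t (ψ.field Y t) (ψ.field Z t) := fun Y Z ↦ by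
    filter_upwards [ψ.φ.open_target.mem_nhds hz] with t ht
    rw [pull2_apply, ψ.E_field Y ht, ψ.E_field Z ht]
  have d : ∀ {X : ∀ x : M, TangentSpace (𝓡 4) x}, IsSmoothField X →
      DifferentiableAt ℝ (ψ.field X) z := fun hX ↦
    (ψ.contDiffAt_field hX hz).differentiableAt (by simp)
  have a : ∀ X {Y Z : ∀ x : M, TangentSpace (𝓡 4) x}, IsSmoothField Y → IsSmoothField Z →
      alongField X (fun y ↦ Ω.val y (Y y) (Z y)) (ψ.φ.symm z) =
      fderiv ℝ (fun t ↦ ψ.pull2 Ω.val t (ψ.field Y t) (ψ.field Z t)) z (ψ.field X z) :=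
    fun X Y Z hY hZ ↦ by
    rw [alongField, ψ.mfderiv_eq hz, (e Y Z).fderiv_eq]
    · rfl
    · exact ((T1.clm_apply (d hY)).clm_apply (d hZ)).congr_of_eventuallyEq (e Y Z)
  rw [← extd2_apply_field T1 (ψ.pull2_alt Ω z) (d hX) (d hY) (d hZ), ← ψ.D_mlieBracket hX hY hz,
    ← ψ.D_mlieBracket hY hZ hz, ← ψ.D_mlieBracket hZ hX hz, TwoForm.d, a X hY hZ, a Y hZ hX,
    a Z hX hY]
  simp only [pull2_apply, ψ.E_field _ hz]

/-- The solution `θ` of `dΩ = θ ∧ Ω` in a chart. -/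
def lee (z : C2) : C2 →L[ℝ] ℝ :=
  lefschetzInv C2.basis (ψ.pull2 Ω.val z) (extd2 (ψ.pull2 Ω.val) z)

variable {Ω}

theorem pfaffian_pull2_ne_zero (nd : ∀ x v, Ω.val x v = 0 → v = 0) {z : C2} (hz : z ∈ ψ.φ.target) :
    pfaffian C2.basis (ψ.pull2 Ω.val z) ≠ 0 :=
  pfaffian_ne_zero C2.basis (ψ.pull2_alt Ω z) (ψ.pull2_nondegenerate Ω nd hz)

set_option maxSynthPendingDepth 5 in
theorem extd2_eq_wedge12_lee (nd : ∀ x v, Ω.val x v = 0 → v = 0) {z : C2}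
    (hz : z ∈ ψ.φ.target) (a b c : C2) :
    extd2 (ψ.pull2 Ω.val) z a b c = wedge12 (ψ.lee Ω z) (ψ.pull2 Ω.val z) a b c := by
  have al := fderiv_alt ((ψ.contDiffAt_twoForm Ω hz).differentiableAt (by simp))
    (Filter.Eventually.of_forall fun t v ↦ ψ.pull2_alt Ω t v)
  refine wedge12_lefschetzInv C2.basis (ψ.pull2_alt Ω z) (ψ.pfaffian_pull2_ne_zero nd hz)
    ?_ ?_ ?_ ?_ a b c
  · intro a a' c d; simp only [extd2, map_add, add_apply]; ring
  · intro r a c d; simp only [extd2, map_smul, smul_apply, smul_eq_mul]; ring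
  · intro a c d; simp only [extd2]; ring
  · intro a c
    have := skew_of_alt (al a) a c
    simp only [extd2, al, this]; ring

set_option maxSynthPendingDepth 5 in
theorem contDiffOn_lee (nd : ∀ x v, Ω.val x v = 0 → v = 0) :
    ContDiffOn ℝ ∞ (ψ.lee Ω) ψ.φ.target := by
  have O := ψ.contDiffOn_pull2 Ω.smooth
  have O' := O.fderiv_of_isOpen (m := ∞) ψ.φ.open_target (by simp)
  have h0 : ∀ i j, ContDiffOn ℝ ∞ (fun z ↦ ψ.pull2 Ω.val z (C2.basis i) (C2.basis j))
      ψ.φ.target := fun i j ↦ (O.clm_apply contDiffOn_const).clm_apply contDiffOn_const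
  have h1 : ∀ i j k, ContDiffOn ℝ ∞ (fun z ↦
      fderiv ℝ (ψ.pull2 Ω.val) z (C2.basis i) (C2.basis j) (C2.basis k)) ψ.φ.target := fun i j k ↦
    ((O'.clm_apply contDiffOn_const).clm_apply contDiffOn_const).clm_apply contDiffOn_const
  have h2 : ∀ i j k, ContDiffOn ℝ ∞ (fun z ↦
      extd2 (ψ.pull2 Ω.val) z (C2.basis i) (C2.basis j) (C2.basis k)) ψ.φ.target := fun i j k ↦
    ((h1 i j k).add (h1 j k i)).add (h1 k i j)
  have h3 : ContDiffOn ℝ ∞ (fun z ↦ pfaffian C2.basis (ψ.pull2 Ω.val z)) ψ.φ.target :=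
    (((h0 0 1).mul (h0 2 3)).sub ((h0 0 2).mul (h0 1 3))).add ((h0 0 3).mul (h0 1 2))
  have h4 : ∀ i, ContDiffOn ℝ ∞ (fun z ↦ lefschetzCoeff C2.basis (ψ.pull2 Ω.val z)
      (extd2 (ψ.pull2 Ω.val) z) i) ψ.φ.target := by
    intro i
    fin_cases i
    · exact (((h0 0 3).mul (h2 0 1 2)).sub ((h0 0 2).mul (h2 0 1 3))).add ((h0 0 1).mul (h2 0 2 3))
    · exact (((h0 1 3).mul (h2 0 1 2)).sub ((h0 1 2).mul (h2 0 1 3))).add ((h0 0 1).mul (h2 1 2 3))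
    · exact (((h0 2 3).mul (h2 0 1 2)).sub ((h0 1 2).mul (h2 0 2 3))).add ((h0 0 2).mul (h2 1 2 3))
    · exact (((h0 2 3).mul (h2 0 1 3)).sub ((h0 1 3).mul (h2 0 2 3))).add ((h0 0 3).mul (h2 1 2 3))
  have h5 : ∀ i, ContDiffOn ℝ ∞ (fun z ↦ lefschetzCoeff C2.basis (ψ.pull2 Ω.val z)
      (extd2 (ψ.pull2 Ω.val) z) i / pfaffian C2.basis (ψ.pull2 Ω.val z)) ψ.φ.target := fun i ↦
    (h4 i).div h3 fun z hz ↦ ψ.pfaffian_pull2_ne_zero nd hz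
  have h6 : ∀ i, ContDiffOn ℝ ∞ (fun z ↦ (lefschetzCoeff C2.basis (ψ.pull2 Ω.val z)
      (extd2 (ψ.pull2 Ω.val) z) i / pfaffian C2.basis (ψ.pull2 Ω.val z)) •
      LinearMap.toContinuousLinearMap (C2.basis.coord i)) ψ.φ.target := fun i ↦
    (h5 i).smul contDiffOn_const
  exact (ContDiffOn.sum (s := Finset.univ) fun i _ ↦ h6 i).congr fun z _ ↦ rfl

/-- Both sides solve the same equation `dΩ = θ ∧ Ω`, by naturality of `d`, and the solution is
unique. -/
theorem lee_transition (nd : ∀ x v, Ω.val x v = 0 → v = 0) {z : C2}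
    (hz : z ∈ ψ.φ.target) (hχ : ψ.φ.symm z ∈ χ.φ.source) :
    ψ.lee Ω z = (χ.lee Ω (χ.φ (ψ.φ.symm z))).comp (fderiv ℝ (fun t ↦ χ.φ (ψ.φ.symm t)) z) := by
  have hχ' := χ.φ.map_source hχ
  refine wedge12_injective C2.basis (ψ.pull2_alt Ω z) (ψ.pfaffian_pull2_ne_zero nd hz)
    fun a b c ↦ ?_
  rw [← ψ.extd2_eq_wedge12_lee nd hz, extd2_pullback (Ω := χ.pull2 Ω.val)
    (τ := fun t ↦ χ.φ (ψ.φ.symm t)) ((χ.contDiffAt_twoForm Ω hχ').differentiableAt (by simp))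
    (χ.pull2_alt Ω _) ((ψ.contDiffAt_twoForm Ω hz).differentiableAt (by simp))
    ((contDiffAt_transition ψ χ hz hχ).of_le (by norm_cast)) ?_, χ.extd2_eq_wedge12_lee nd hχ']
  · simp only [wedge12, pull2_transition ψ χ Ω.val hz hχ, ContinuousLinearMap.comp_apply]
  · filter_upwards [eventually_mem_source ψ χ hz hχ] with t ht v w
    exact pull2_transition ψ χ Ω.val ht.1 ht.2 v w

end HolChart

/-- In every chart, `dΩ = θ ∧ Ω`. -/
def IsLeeForm (J : CplxStructure M) (Ω : TwoForm M) (θ : OneForm M) : Prop :=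
  ∀ (ψ : HolChart J), ∀ z ∈ ψ.φ.target, ∀ a b c, extd2 (ψ.pull2 Ω.val) z a b c =
    wedge12 (ψ.pull1 θ.val z) (ψ.pull2 Ω.val z) a b c

/-- The value at each point is taken from an arbitrary chart there; `lee_transition` makes it agree
with the local Lee form of every chart, which gives smoothness. -/
theorem exists_isLeeForm (J : CplxStructure M) {Ω : TwoForm M}
    (nd : ∀ x v, Ω.val x v = 0 → v = 0) : ∃ θ : OneForm M, IsLeeForm J Ω θ := by
  choose χ hχ using J.exists_chart
  let θ : ∀ x : M, TangentSpace (𝓡 4) x →L[ℝ] ℝ := fun x ↦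
    ((χ x).lee Ω ((χ x).φ x)).comp ((χ x).D x)
  have h : ∀ (ψ : HolChart J), ∀ z ∈ ψ.φ.target, ψ.pull1 θ z = ψ.lee Ω z := by
    intro ψ z hz
    ext w
    rw [HolChart.lee_transition ψ (χ (ψ.φ.symm z)) nd hz (hχ _), ContinuousLinearMap.comp_apply,
      HolChart.fderiv_transition ψ _ hz (hχ _)]
    rfl
  refine ⟨⟨θ, fun x ↦ ?_⟩, fun ψ z hz a b c ↦ ?_⟩
  · obtain ⟨ψ, hψ⟩ := J.exists_chart x
    refine ψ.contMDiffAt_of_pull1 hψ (ContDiffOn.contDiffAt (s := ψ.φ.target) ?_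
      (ψ.φ.open_target.mem_nhds (ψ.φ.map_source hψ)))
    exact (ψ.contDiffOn_lee nd).congr (h ψ)
  · rw [ψ.extd2_eq_wedge12_lee nd hz, h ψ z hz]

theorem IsLeeForm.isTwistedClosed {Ω : TwoForm M} {θ : OneForm M} (h : IsLeeForm J Ω θ) :
    Ω.IsTwistedClosed θ := by
  intro X Y Z hX hY hZ x
  obtain ⟨ψ, hψ⟩ := J.exists_chart x
  obtain ⟨z, hz, rfl⟩ : ∃ z ∈ ψ.φ.target, ψ.φ.symm z = x :=
    ⟨ψ.φ x, ψ.φ.map_source hψ, ψ.φ.left_inv hψ⟩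
  rw [ψ.d_twoForm Ω hX hY hZ hz, h ψ z hz, wedge12]
  simp only [HolChart.pull2_apply, HolChart.pull1_apply, ψ.E_field _ hz]

end LeeForm

/-! ### Poisson structures -/

section Poisson

theorem exists_equiv_of_nondegenerate {V : Type*} [NormedAddCommGroup V] [NormedSpace ℝ V]
    [FiniteDimensional ℝ V] (O : V →L[ℝ] V →L[ℝ] ℝ) (nd : ∀ v, O v = 0 → v = 0) :
    ∃ e : V ≃L[ℝ] (V →L[ℝ] ℝ), (e : V →L[ℝ] V →L[ℝ] ℝ) = O := by
  have inj : Function.Injective (O : V →ₗ[ℝ] V →L[ℝ] ℝ) :=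
    (injective_iff_map_eq_zero _).mpr nd
  have dim : Module.finrank ℝ V = Module.finrank ℝ (V →L[ℝ] ℝ) := by
    rw [← (LinearMap.toContinuousLinearMap (𝕜 := ℝ) (E := V) (F' := ℝ)).finrank_eq]
    exact (Subspace.dual_finrank_eq (K := ℝ) (V := V)).symm
  refine ⟨(LinearEquiv.ofBijective (O : V →ₗ[ℝ] V →L[ℝ] ℝ)
    ⟨inj, (LinearMap.injective_iff_surjective_of_finrank_eq_finrank dim).mp inj⟩
    ).toContinuousLinearEquiv, ?_⟩
  ext v w
  rfl

theorem apply_inverse_of_nondegenerate {V : Type*} [NormedAddCommGroup V] [NormedSpace ℝ V]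
    [FiniteDimensional ℝ V] (O : V →L[ℝ] V →L[ℝ] ℝ) (nd : ∀ v, O v = 0 → v = 0) :
    (∀ α, O (O.inverse α) = α) ∧ ∀ v, O.inverse (O v) = v := by
  obtain ⟨e, rfl⟩ := exists_equiv_of_nondegenerate O nd
  simp [ContinuousLinearMap.inverse_equiv]

theorem exists_clm_of_bilinear {V W : Type*} [NormedAddCommGroup V] [NormedSpace ℝ V]
    [FiniteDimensional ℝ V] [NormedAddCommGroup W] [NormedSpace ℝ W] (f : V →ₗ[ℝ] V →ₗ[ℝ] W) :
    ∃ F : V →L[ℝ] V →L[ℝ] W, ∀ v w, F v w = f v w :=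
  ⟨LinearMap.toContinuousLinearMap
    ((LinearMap.toContinuousLinearMap (𝕜 := ℝ) (E := V) (F' := W)).toLinearMap ∘ₗ f),
    fun _ _ ↦ rfl⟩

theorem exists_bivector_of_endomorphism {V : Type*} [NormedAddCommGroup V] [NormedSpace ℝ V]
    [FiniteDimensional ℝ V] (Q : (V →L[ℝ] ℝ) →L[ℝ] V) (J : V →L[ℝ] V) :
    ∃ F : (V →L[ℝ] ℝ) →L[ℝ] (V →L[ℝ] ℝ) →L[ℝ] ℂ,
      ∀ α β, F α β = β (Q α) - Complex.I * β (Q (α.comp J)) := by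
  refine exists_clm_of_bilinear (LinearMap.mk₂ ℝ
    (fun α β : V →L[ℝ] ℝ ↦ (β (Q α) : ℂ) - Complex.I * β (Q (α.comp J))) ?_ ?_ ?_ ?_)
  · intro α α' β
    rw [ContinuousLinearMap.add_comp, map_add, map_add, map_add, map_add]
    push_cast; ring
  · intro r α β
    rw [ContinuousLinearMap.smul_comp, map_smul, map_smul, map_smul, map_smul]
    simp; ring
  · intro α β β'; simp only [add_apply]; push_cast; ring
  · intro r α β; simp; ring

variable (M : Type*) [TopologicalSpace M] [ChartedSpace E4 M] [IsManifold (𝓡 4) ∞ M]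

/-- Two complex structures `J₊`, `J₋` which are adjoint to each other with respect to a 2-form
taming `J₊`. -/
structure TamedPair where
  Jp : CplxStructure M
  Jm : CplxStructure M
  Ω : TwoForm M
  adj : ∀ x v w, Ω.val x (Jm.J x v) w = Ω.val x v (Jp.J x w)
  tame : ∀ x v, v ≠ 0 → 0 < Ω.val x v (Jp.J x v)

variable {M}

namespace TamedPair

variable (S : TamedPair M)

theorem nondegenerate (x : M) (v : TangentSpace (𝓡 4) x) (h : S.Ω.val x v = 0) : v = 0 := by
  by_contra hv
  have := S.tame x v hv
  rw [h] at this
  simp at this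

theorem skew (x : M) (v w : TangentSpace (𝓡 4) x) : S.Ω.val x v w = -S.Ω.val x w v := by
  have := S.Ω.alt x (v + w)
  simp only [map_add, add_apply, S.Ω.alt] at this
  linarith

theorem adj' (x : M) (v w : TangentSpace (𝓡 4) x) :
    S.Ω.val x (S.Jp.J x v) w = S.Ω.val x v (S.Jm.J x w) := by
  rw [S.skew, ← S.adj, ← S.skew]

/-- The inverse of `Ω`. -/
def Λ (x : M) : (TangentSpace (𝓡 4) x →L[ℝ] ℝ) →L[ℝ] TangentSpace (𝓡 4) x :=
  (show E4 →L[ℝ] E4 →L[ℝ] ℝ from S.Ω.val x).inverse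

theorem Ω_Λ (x : M) (α : TangentSpace (𝓡 4) x →L[ℝ] ℝ) : S.Ω.val x (S.Λ x α) = α :=
  (apply_inverse_of_nondegenerate (show E4 →L[ℝ] E4 →L[ℝ] ℝ from S.Ω.val x)
    (S.nondegenerate x)).1 α

theorem Λ_Ω (x : M) (v : TangentSpace (𝓡 4) x) : S.Λ x (S.Ω.val x v) = v :=
  (apply_inverse_of_nondegenerate (show E4 →L[ℝ] E4 →L[ℝ] ℝ from S.Ω.val x)
    (S.nondegenerate x)).2 v

theorem Jm_Λ (x : M) (α : TangentSpace (𝓡 4) x →L[ℝ] ℝ) :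
    S.Jm.J x (S.Λ x α) = S.Λ x (α.comp (S.Jp.J x)) := by
  rw [← S.Λ_Ω x (S.Jm.J x (S.Λ x α))]
  congr 1
  ext w
  rw [S.adj, S.Ω_Λ, ContinuousLinearMap.comp_apply]

/-- The real Poisson structure. -/
def Q (x : M) : (TangentSpace (𝓡 4) x →L[ℝ] ℝ) →L[ℝ] TangentSpace (𝓡 4) x :=
  -((S.Jp.J x).comp (S.Λ x) + (S.Jm.J x).comp (S.Λ x))

theorem Q_apply (x : M) (α : TangentSpace (𝓡 4) x →L[ℝ] ℝ) :
    S.Q x α = -(S.Jp.J x (S.Λ x α) + S.Λ x (α.comp (S.Jp.J x))) := by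
  rw [← S.Jm_Λ]; rfl

theorem comp_comp (x : M) (α : TangentSpace (𝓡 4) x →L[ℝ] ℝ) :
    (α.comp (S.Jp.J x)).comp (S.Jp.J x) = -α := by
  ext w
  simp [S.Jp.sq]

theorem Q_comp (x : M) (α : TangentSpace (𝓡 4) x →L[ℝ] ℝ) :
    S.Q x (α.comp (S.Jp.J x)) = S.Λ x α - S.Jp.J x (S.Λ x (α.comp (S.Jp.J x))) := by
  rw [Q_apply, comp_comp, map_neg]
  abel

/-- With `v = Λ α`, the pairing is `-(Ω(v, J₊v) + Ω(v, J₋v))`, and the two terms cancel because `J₊`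
and `J₋` are adjoint and `Ω` is skew. -/
theorem apply_Q_self (x : M) (α : TangentSpace (𝓡 4) x →L[ℝ] ℝ) : α (S.Q x α) = 0 := by
  have h : ∀ w, α w = S.Ω.val x (S.Λ x α) w := fun w ↦ by rw [S.Ω_Λ]
  rw [h, Q_apply, ← Jm_Λ, map_neg, map_add, ← S.adj, S.skew, neg_add_cancel, neg_zero]

theorem apply_Q_comp_self (x : M) (α : TangentSpace (𝓡 4) x →L[ℝ] ℝ) :
    α (S.Q x (α.comp (S.Jp.J x))) = 0 := by
  have h : ∀ w, α w = S.Ω.val x (S.Λ x α) w := fun w ↦ by rw [S.Ω_Λ]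
  rw [h, Q_comp, ← Jm_Λ, map_sub, ← S.adj, S.Ω.alt, S.Ω.alt, sub_zero]

/-- By construction `QΩ = -(J₊ + J₋)`, while adjointness turns composition with `J₊` on covectors
into `J₋` on vectors. -/
theorem satisfiesQuadraticEq : SatisfiesQuadraticEq S.Ω S.Jp S.Q := by
  intro x v
  ext w
  have e : (S.Ω.val x v).comp (S.Jp.J x) = S.Ω.val x (S.Jm.J x v) := by
    ext w; rw [ContinuousLinearMap.comp_apply, S.adj]
  rw [e, S.Q_apply, S.Λ_Ω, ← S.Jm_Λ, S.Λ_Ω]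
  simp

theorem Jm_eq (x : M) (v : TangentSpace (𝓡 4) x) :
    S.Jm.J x v = -S.Jp.J x v - S.Q x (S.Ω.val x v) := by
  rw [S.Q_apply, ← S.Jm_Λ, S.Λ_Ω]
  abel

theorem isTaming : S.Ω.IsTaming S.Jp := by
  intro x v hv
  have h := S.tame x v hv
  have : S.Ω.invariantPart S.Jp x v (S.Jp.J x v) = S.Ω.val x v (S.Jp.J x v) := by
    rw [TwoForm.invariantPart, S.Jp.sq, map_neg, S.skew x (S.Jp.J x v)]
    ring
  rwa [this]

/-- The values of the holomorphic Poisson structure. -/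
theorem exists_bivector (x : M) :
    ∃ F : (TangentSpace (𝓡 4) x →L[ℝ] ℝ) →L[ℝ] (TangentSpace (𝓡 4) x →L[ℝ] ℝ) →L[ℝ] ℂ,
      ∀ α β, F α β = β (S.Q x α) - Complex.I * β (S.Q x (α.comp (S.Jp.J x))) := by
  exact exists_bivector_of_endomorphism (V := E4) (S.Q x) (S.Jp.J x)

theorem isHolomorphic_re_im {x : M} {J : CplxStructure M} {a : TangentSpace (𝓡 4) x →L[ℝ] ℂ}
    (ha : ∀ v, a (J.J x v) = Complex.I * a v) :
    (Complex.reCLM.comp a).comp (J.J x) = -Complex.imCLM.comp a ∧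
      (Complex.imCLM.comp a).comp (J.J x) = Complex.reCLM.comp a := by
  constructor <;> ext v <;> simp [ha]

/-- On covectors of type `(1,0)`, `σ` is a constant multiple of the Hamiltonian pairing `b(Λa)`, the
quantity differentiated in `twisted_dbar_of_integrable`. -/
theorem eval_eq {σ : CplxBivector M} (hσ : ∀ x α β, σ.val x α β =
      β (S.Q x α) - Complex.I * β (S.Q x (α.comp (S.Jp.J x)))) {x : M}
    {a b : TangentSpace (𝓡 4) x →L[ℝ] ℂ} (ha : ∀ v, a (S.Jp.J x v) = Complex.I * a v)
    (hb : ∀ v, b (S.Jp.J x v) = Complex.I * b v) :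
    σ.eval x a b = -4 * Complex.I * (b (S.Λ x (Complex.reCLM.comp a))
      + Complex.I * b (S.Λ x (Complex.imCLM.comp a))) := by
  obtain ⟨h1, h2⟩ := isHolomorphic_re_im ha
  have q1 : S.Q x (Complex.reCLM.comp a) =
      -S.Jp.J x (S.Λ x (Complex.reCLM.comp a)) + S.Λ x (Complex.imCLM.comp a) := by
    rw [Q_apply, h1, map_neg]; abel
  have q2 : S.Q x (Complex.imCLM.comp a) =
      -S.Jp.J x (S.Λ x (Complex.imCLM.comp a)) - S.Λ x (Complex.reCLM.comp a) := by
    rw [Q_apply, h2]; abel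
  have r : ∀ w,
      ((Complex.reCLM.comp b w : ℝ) : ℂ) + Complex.I * (Complex.imCLM.comp b w : ℝ) = b w :=
    fun w ↦ by apply Complex.ext <;> simp
  have s : ∀ α : TangentSpace (𝓡 4) x →L[ℝ] ℝ, σ.val x α (Complex.reCLM.comp b)
      + Complex.I * σ.val x α (Complex.imCLM.comp b) =
      b (S.Q x α) - Complex.I * b (S.Q x (α.comp (S.Jp.J x))) := fun α ↦ by
    rw [hσ, hσ, ← r, ← r]; ring
  have e : σ.eval x a b = (b (S.Q x (Complex.reCLM.comp a))
      - Complex.I * b (S.Q x ((Complex.reCLM.comp a).comp (S.Jp.J x))))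
      + Complex.I * (b (S.Q x (Complex.imCLM.comp a))
      - Complex.I * b (S.Q x ((Complex.imCLM.comp a).comp (S.Jp.J x)))) := by
    rw [← s, ← s, CplxBivector.eval]
    linear_combination (-σ.val x (Complex.imCLM.comp a) (Complex.imCLM.comp b)) * Complex.I_mul_I
  rw [e, h1, h2, map_neg, map_neg, q1, q2, map_add, map_sub, map_neg, map_neg, hb, hb]
  linear_combination (b (S.Λ x (Complex.imCLM.comp a))
    + Complex.I * b (S.Λ x (Complex.reCLM.comp a))) * Complex.I_mul_I
end TamedPair

end Poisson

/-! ### The holomorphic Poisson structure -/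

section HolomorphicPoisson

variable {M : Type*} [TopologicalSpace M] [ChartedSpace E4 M] [IsManifold (𝓡 4) ∞ M]

namespace HolChart

variable {J : CplxStructure M} (ψ : HolChart J)

theorem exists_symm {y : M} (hy : y ∈ ψ.φ.source) : ∃ z ∈ ψ.φ.target, ψ.φ.symm z = y :=
  ⟨ψ.φ y, ψ.φ.map_source hy, ψ.φ.left_inv hy⟩

theorem contMDiffAt_of_comp_symm {F : Type*} [NormedAddCommGroup F] [NormedSpace ℝ F] {f : M → F}
    {z : C2} (hz : z ∈ ψ.φ.target) (h : ContDiffAt ℝ ∞ (fun t ↦ f (ψ.φ.symm t)) z) :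
    ContMDiffAt (𝓡 4) 𝓘(ℝ, F) ∞ f (ψ.φ.symm z) := by
  have hx := ψ.φ.map_target hz
  have h' : ContMDiffAt 𝓘(ℝ, C2) 𝓘(ℝ, F) ∞ (fun t ↦ f (ψ.φ.symm t)) (ψ.φ (ψ.φ.symm z)) := by
    rw [ψ.φ.right_inv hz]; exact h.contMDiffAt
  refine (h'.comp (ψ.φ.symm z) ((ψ.smooth _ hx).contMDiffAt
    (ψ.φ.open_source.mem_nhds hx))).congr_of_eventuallyEq ?_
  filter_upwards [ψ.φ.open_source.mem_nhds hx] with y hy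
  simp [ψ.φ.left_inv hy]

theorem contDiffAt_comp_symm {F : Type*} [NormedAddCommGroup F] [NormedSpace ℝ F] {f : M → F}
    {z : C2} (hz : z ∈ ψ.φ.target) (h : ContMDiffAt (𝓡 4) 𝓘(ℝ, F) ∞ f (ψ.φ.symm z)) :
    ContDiffAt ℝ ∞ (fun t ↦ f (ψ.φ.symm t)) z := by
  rw [← contMDiffAt_iff_contDiffAt]
  exact h.comp z ((ψ.smooth_symm z hz).contMDiffAt (ψ.φ.open_target.mem_nhds hz))

theorem D_injective {y : M} (hy : y ∈ ψ.φ.source) : Function.Injective (ψ.D y) := by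
  obtain ⟨z, hz, rfl⟩ := ψ.exists_symm hy
  exact Function.LeftInverse.injective (ψ.E_D hz)

end HolChart

namespace TamedPair

variable (S : TamedPair M) (ψ : HolChart S.Jp)

/-- The field dual to a 1-form in a chart. -/
def ham (z : C2) (η : C2 →L[ℝ] ℝ) : C2 := (ψ.pull2 S.Ω.val z).inverse η

theorem E_ham {z : C2} (hz : z ∈ ψ.φ.target) (α : TangentSpace (𝓡 4) (ψ.φ.symm z) →L[ℝ] ℝ) :
    ψ.E z (S.ham ψ z (α.comp (ψ.E z))) = S.Λ _ α := by
  rw [← S.Λ_Ω _ (ψ.E z _)]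
  congr 1
  ext w
  have h := (apply_inverse_of_nondegenerate (ψ.pull2 S.Ω.val z)
    (ψ.pull2_nondegenerate S.Ω S.nondegenerate hz)).1 (α.comp (ψ.E z))
  have := congrArg (fun L : C2 →L[ℝ] ℝ ↦ L (ψ.D _ w)) h
  simpa [HolChart.pull2_apply, ψ.E_D hz, ham] using this

theorem pull2_ham {z : C2} (hz : z ∈ ψ.φ.target) (η : C2 →L[ℝ] ℝ) :
    ψ.pull2 S.Ω.val z (S.ham ψ z η) = η :=
  (apply_inverse_of_nondegenerate (ψ.pull2 S.Ω.val z)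
    (ψ.pull2_nondegenerate S.Ω S.nondegenerate hz)).1 η

theorem contDiffAt_ham {z : C2} (hz : z ∈ ψ.φ.target) {η : C2 → C2 →L[ℝ] ℝ}
    (hη : ContDiffAt ℝ ∞ η z) : ContDiffAt ℝ ∞ (fun t ↦ S.ham ψ t (η t)) z := by
  obtain ⟨e, he⟩ := exists_equiv_of_nondegenerate (ψ.pull2 S.Ω.val z)
    (ψ.pull2_nondegenerate S.Ω S.nondegenerate hz)
  have h1 : ContDiffAt ℝ ∞ ContinuousLinearMap.inverse (ψ.pull2 S.Ω.val z) := by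
    rw [← he]; exact contDiffAt_map_inverse e
  exact (h1.comp z (ψ.contDiffAt_twoForm S.Ω hz)).clm_apply hη

theorem comp_comp_E {z : C2} (hz : z ∈ ψ.φ.target)
    (α : TangentSpace (𝓡 4) (ψ.φ.symm z) →L[ℝ] ℝ) :
    (α.comp (S.Jp.J _)).comp (ψ.E z) = (α.comp (ψ.E z)).comp C2.mulI := by
  ext w
  simp [ψ.E_I hz]

theorem bivector_symm {z : C2} (hz : z ∈ ψ.φ.target)
    (α β : TangentSpace (𝓡 4) (ψ.φ.symm z) →L[ℝ] ℝ) :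
    ((β (S.Q _ α) : ℝ) : ℂ) - Complex.I * (β (S.Q _ (α.comp (S.Jp.J _))) : ℝ) =
      (β.comp (ψ.E z) (-(C2.mulI (S.ham ψ z (α.comp (ψ.E z)))
        + S.ham ψ z ((α.comp (ψ.E z)).comp C2.mulI))) : ℝ)
      - Complex.I * (β.comp (ψ.E z) (S.ham ψ z (α.comp (ψ.E z))
        - C2.mulI (S.ham ψ z ((α.comp (ψ.E z)).comp C2.mulI))) : ℝ) := by
  rw [Q_apply, Q_comp, ← comp_comp_E S ψ hz]
  simp only [ContinuousLinearMap.comp_apply, map_neg, map_add, map_sub, C2.mulI_apply, ψ.E_I hz,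
    S.E_ham ψ hz]

/-- The holomorphic Poisson structure. -/
theorem exists_cplxBivector : ∃ σ : CplxBivector M, ∀ x α β, σ.val x α β =
    β (S.Q x α) - Complex.I * β (S.Q x (α.comp (S.Jp.J x))) := by
  choose F hF using S.exists_bivector
  refine ⟨⟨F, fun α β x ↦ ?_, fun x α ↦ ?_⟩, hF⟩
  · obtain ⟨ψ, hψ⟩ := S.Jp.exists_chart x
    obtain ⟨z, hz, rfl⟩ := ψ.exists_symm hψ
    refine ψ.contMDiffAt_of_comp_symm hz ?_
    have a := ψ.contDiffAt_oneForm α hz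
    have b := ψ.contDiffAt_oneForm β hz
    have A := S.contDiffAt_ham ψ hz a
    have a' : ContDiffAt ℝ ∞ (fun t ↦ (ψ.pull1 α.val t).comp C2.mulI) z :=
      a.clm_comp contDiffAt_const
    have A' := S.contDiffAt_ham ψ hz a'
    have h1 := b.clm_apply ((C2.mulI.contDiff.contDiffAt.comp z A).add A').neg
    have h2 := b.clm_apply (A.sub (C2.mulI.contDiff.contDiffAt.comp z A'))
    have h3 := (Complex.ofRealCLM.contDiff.contDiffAt.comp z h1).sub
      (contDiffAt_const (c := Complex.I).mul (Complex.ofRealCLM.contDiff.contDiffAt.comp z h2))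
    refine h3.congr_of_eventuallyEq ?_
    filter_upwards [ψ.φ.open_target.mem_nhds hz] with t ht
    rw [hF, bivector_symm S ψ ht]
    rfl
  · rw [hF, apply_Q_self, apply_Q_comp_self]
    simp

variable {σ : CplxBivector M} (hσ : ∀ x α β, σ.val x α β =
    β (S.Q x α) - Complex.I * β (S.Q x (α.comp (S.Jp.J x))))
include hσ

theorem isTwoZero : σ.IsTwoZero S.Jp := by
  intro x α β
  rw [hσ, hσ, comp_comp, map_neg, map_neg]
  push_cast
  linear_combination (β (S.Q x (α.comp (S.Jp.J x)))) * Complex.I_mul_I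

theorem isRealPart : σ.IsRealPart S.Q := by
  intro x α β
  rw [hσ]
  simp

variable {U : Set M} {u v : M → ℂ} (hU : IsOpen U) (hu : IsHolomorphicOn S.Jp u U)
  (hv : IsHolomorphicOn S.Jp v U)
include hU hu hv

theorem eventuallyEq_eval {z : C2} (hz : z ∈ ψ.φ.target) (hzU : ψ.φ.symm z ∈ U) :
    (fun t ↦ σ.eval (ψ.φ.symm t) (cdiff u (ψ.φ.symm t)) (cdiff v (ψ.φ.symm t))) =ᶠ[nhds z] fun t ↦
      -4 * Complex.I * (fderiv ℝ (fun t ↦ v (ψ.φ.symm t)) t (S.ham ψ t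
        (Complex.reCLM.comp (fderiv ℝ (fun t ↦ u (ψ.φ.symm t)) t)))
      + Complex.I * fderiv ℝ (fun t ↦ v (ψ.φ.symm t)) t (S.ham ψ t
        (Complex.imCLM.comp (fderiv ℝ (fun t ↦ u (ψ.φ.symm t)) t)))) := by
  filter_upwards [ψ.φ.open_target.mem_nhds hz,
    (ψ.φ.continuousAt_symm hz).eventually (hU.mem_nhds hzU)] with t ht htU
  have d : ∀ {u : M → ℂ}, IsHolomorphicOn S.Jp u U →
      MDifferentiableAt (𝓡 4) 𝓘(ℝ, ℂ) u (ψ.φ.symm t) := fun hu ↦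
    ((hu.1 _ htU).contMDiffAt (hU.mem_nhds htU)).mdifferentiableAt (by simp)
  have e : ∀ {u : M → ℂ}, IsHolomorphicOn S.Jp u U →
      fderiv ℝ (fun t ↦ u (ψ.φ.symm t)) t = (cdiff u (ψ.φ.symm t)).comp (ψ.E t) := fun hu ↦ by
    ext1 w
    exact ψ.fderiv_comp_symm ht (d hu) w
  rw [S.eval_eq hσ (hu.2 _ htU) (hv.2 _ htU), e hu, e hv, ← S.E_ham ψ ht, ← S.E_ham ψ ht]
  rfl

theorem contDiffAt_eval {z : C2} (hz : z ∈ ψ.φ.target) (hzU : ψ.φ.symm z ∈ U) : ContDiffAt ℝ ∞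
    (fun t ↦ σ.eval (ψ.φ.symm t) (cdiff u (ψ.φ.symm t)) (cdiff v (ψ.φ.symm t))) z := by
  refine ContDiffAt.congr_of_eventuallyEq ?_ (S.eventuallyEq_eval ψ hσ hU hu hv hz hzU)
  have d : ∀ {u : M → ℂ}, IsHolomorphicOn S.Jp u U →
      ContDiffAt ℝ ∞ (fderiv ℝ (fun t ↦ u (ψ.φ.symm t))) z := fun hu ↦
    (ψ.contDiffAt_comp_symm hz ((hu.1 _ hzU).contMDiffAt (hU.mem_nhds hzU))).fderiv_right (by simp)
  have h : ∀ L : ℂ →L[ℝ] ℝ, ContDiffAt ℝ ∞ (fun t ↦ fderiv ℝ (fun t ↦ v (ψ.φ.symm t)) t (S.ham ψ t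
      (L.comp (fderiv ℝ (fun t ↦ u (ψ.φ.symm t)) t)))) z := fun L ↦
    (d hv).clm_apply (S.contDiffAt_ham ψ hz (contDiffAt_const.clm_comp (d hu)))
  exact contDiffAt_const.mul ((h _).add (contDiffAt_const.mul (h _)))

-- If `a` is of type `(1,0)` for `J₊`, then `Λ(Re a) + iΛ(Im a)` is of type `(1,0)` for `J₋`. This
-- is the bridge between the two complex structures.
omit hσ hU hu hv in
theorem Λ_re {x : M} {a : TangentSpace (𝓡 4) x →L[ℝ] ℂ}
    (ha : ∀ v, a (S.Jp.J x v) = Complex.I * a v) :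
    S.Λ x (Complex.reCLM.comp a) = S.Jm.J x (S.Λ x (Complex.imCLM.comp a)) := by
  rw [S.Jm_Λ, (isHolomorphic_re_im ha).2]

/-- The twisted Cauchy-Riemann equation in a chart. -/
theorem dbar_eval {θ : OneForm M} (hθ : IsLeeForm S.Jp S.Ω θ) {z : C2} (hz : z ∈ ψ.φ.target)
    (hzU : ψ.φ.symm z ∈ U) (w : C2) :
    fderiv ℝ (fun t ↦ σ.eval (ψ.φ.symm t) (cdiff u (ψ.φ.symm t)) (cdiff v (ψ.φ.symm t))) z w
      + Complex.I * fderiv ℝ (fun t ↦ σ.eval (ψ.φ.symm t) (cdiff u (ψ.φ.symm t))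
        (cdiff v (ψ.φ.symm t))) z (C2.mulI w)
      + σ.eval (ψ.φ.symm z) (cdiff u (ψ.φ.symm z)) (cdiff v (ψ.φ.symm z))
        * (ψ.pull1 θ.val z w + Complex.I * ψ.pull1 θ.val z (C2.mulI w)) = 0 := by
  -- A chart holomorphic for `J₋`: its expression in the `J₊`-chart `ψ` supplies the coordinates `q`
  -- that encode integrability of `J₋`.
  obtain ⟨χ, hχ⟩ := S.Jm.exists_chart (ψ.φ.symm z)
  have near : ∀ᶠ t in nhds z, t ∈ ψ.φ.target ∧ ψ.φ.symm t ∈ U ∧ ψ.φ.symm t ∈ χ.φ.source := by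
    filter_upwards [ψ.φ.open_target.mem_nhds hz,
      (ψ.φ.continuousAt_symm hz).eventually (hU.mem_nhds hzU),
      (ψ.φ.continuousAt_symm hz).eventually (χ.φ.open_source.mem_nhds hχ)] with t h1 h2 h3
    exact ⟨h1, h2, h3⟩
  have sm : ∀ {u : M → ℂ}, IsHolomorphicOn S.Jp u U →
      ContDiffAt ℝ ∞ (fun t ↦ u (ψ.φ.symm t)) z := fun hu ↦
    ψ.contDiffAt_comp_symm hz ((hu.1 _ hzU).contMDiffAt (hU.mem_nhds hzU))
  have d : ∀ {u : M → ℂ}, IsHolomorphicOn S.Jp u U → ∀ L : ℂ →L[ℝ] ℝ,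
      DifferentiableAt ℝ (fun t ↦ S.ham ψ t (L.comp (fderiv ℝ (fun t ↦ u (ψ.φ.symm t)) t))) z :=
    fun hu L ↦ (S.contDiffAt_ham ψ hz (contDiffAt_const.clm_comp
      ((sm hu).fderiv_right (m := ∞) (by simp)))).differentiableAt (by simp)
  have e : ∀ {u : M → ℂ}, IsHolomorphicOn S.Jp u U → ∀ t ∈ ψ.φ.target, ψ.φ.symm t ∈ U →
      fderiv ℝ (fun t ↦ u (ψ.φ.symm t)) t = (cdiff u (ψ.φ.symm t)).comp (ψ.E t) :=
    fun hu t ht htU ↦ by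
    ext1 w
    exact ψ.fderiv_comp_symm ht
      (((hu.1 _ htU).contMDiffAt (hU.mem_nhds htU)).mdifferentiableAt (by simp)) w
  have q : ∀ {u : M → ℂ}, IsHolomorphicOn S.Jp u U → ∀ᶠ t in nhds z,
      fderiv ℝ (fun t ↦ χ.φ (ψ.φ.symm t)) t
        (S.ham ψ t (Complex.reCLM.comp (fderiv ℝ (fun t ↦ u (ψ.φ.symm t)) t))) =
      Complex.I • fderiv ℝ (fun t ↦ χ.φ (ψ.φ.symm t)) t
        (S.ham ψ t (Complex.imCLM.comp (fderiv ℝ (fun t ↦ u (ψ.φ.symm t)) t))) := fun {u} hu ↦ by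
    filter_upwards [near] with t ht
    have a := S.E_ham ψ ht.1 (Complex.reCLM.comp (cdiff u (ψ.φ.symm t)))
    have b := S.E_ham ψ ht.1 (Complex.imCLM.comp (cdiff u (ψ.φ.symm t)))
    rw [HolChart.fderiv_transition ψ χ ht.1 ht.2.2, HolChart.fderiv_transition ψ χ ht.1 ht.2.2,
      e hu t ht.1 ht.2.1]
    refine (congrArg _ a).trans (Eq.trans ?_ (congrArg _ (congrArg _ b)).symm)
    rw [S.Λ_re (hu.2 _ ht.2.1)]
    exact χ.hol _ ht.2.2 _
  have hol : ∀ {u : M → ℂ}, IsHolomorphicOn S.Jp u U → ∀ w,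
      fderiv ℝ (fun t ↦ u (ψ.φ.symm t)) z (C2.mulI w) =
        Complex.I * fderiv ℝ (fun t ↦ u (ψ.φ.symm t)) z w := fun hu w ↦ by
    rw [e hu z hz hzU, ContinuousLinearMap.comp_apply, C2.mulI_apply, ψ.E_I hz, hu.2 _ hzU]
    rfl
  have tr := fun w ↦ HolChart.fderiv_transition ψ χ hz hχ w
  have hams : ∀ {u : M → ℂ} (L : ℂ →L[ℝ] ℝ), ∀ᶠ t in nhds z, ∀ w, ψ.pull2 S.Ω.val t
      (S.ham ψ t (L.comp (fderiv ℝ (fun t ↦ u (ψ.φ.symm t)) t))) w =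
      L (fderiv ℝ (fun t ↦ u (ψ.φ.symm t)) t w) := fun {u} L ↦ by
    filter_upwards [near] with t ht w
    rw [S.pull2_ham ψ ht.1]
    rfl
  have main := twisted_dbar_of_integrable (Ω := ψ.pull2 S.Ω.val) (θ := ψ.pull1 θ.val z)
    (u := fun t ↦ u (ψ.φ.symm t)) (v := fun t ↦ v (ψ.φ.symm t))
    (q := fun t ↦ χ.φ (ψ.φ.symm t)) (x := z) C2.mulI
    (K := (show E4 →L[ℝ] C2 from ψ.D (ψ.φ.symm z)).comp
      ((show E4 →L[ℝ] E4 from S.Jm.J (ψ.φ.symm z)).comp (show C2 →L[ℝ] E4 from ψ.E z)))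
    C2.I_smul_I_smul ((ψ.contDiffAt_twoForm S.Ω hz).differentiableAt (by simp))
    (Filter.Eventually.of_forall fun t v ↦ ψ.pull2_alt S.Ω t v) (hθ ψ z hz)
    ((sm hu).of_le (by norm_cast)) ((sm hv).of_le (by norm_cast))
    ((HolChart.contDiffAt_transition ψ χ hz hχ).of_le (by norm_cast))
    (d hu Complex.reCLM) (d hu Complex.imCLM) (d hv Complex.reCLM) (d hv Complex.imCLM)
    (hams _) (hams _) (hams _) (hams _) (q hu) (q hv)
    (fun w ↦ by
      rw [tr, tr]
      refine (congrArg (χ.D _) (ψ.E_D hz _)).trans ?_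
      exact χ.hol _ hχ _)
    (fun w w' h ↦ by
      rw [tr, tr] at h
      exact Function.LeftInverse.injective (ψ.D_E hz) (χ.D_injective hχ h))
    (fun v w ↦ by
      have := S.adj _ (ψ.E z v) (ψ.E z w)
      rw [← ψ.E_I hz] at this
      rw [ψ.pull2_apply, ψ.pull2_apply]
      exact (congrArg (fun a ↦ S.Ω.val (ψ.φ.symm z) a (ψ.E z w)) (ψ.E_D hz _)).trans this)
    (hol hu) (hol hv) w
  have ev := S.eventuallyEq_eval ψ hσ hU hu hv hz hzU
  have dS : DifferentiableAt ℝ (fun t ↦ fderiv ℝ (fun t ↦ v (ψ.φ.symm t)) t (S.ham ψ t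
        (Complex.reCLM.comp (fderiv ℝ (fun t ↦ u (ψ.φ.symm t)) t)))
      + Complex.I * fderiv ℝ (fun t ↦ v (ψ.φ.symm t)) t (S.ham ψ t
        (Complex.imCLM.comp (fderiv ℝ (fun t ↦ u (ψ.φ.symm t)) t)))) z := by
    have dv := ((sm hv).fderiv_right (m := ∞) (by simp)).differentiableAt (by simp)
    exact (dv.clm_apply (d hu _)).add ((dv.clm_apply (d hu _)).const_mul _)
  have ev0 := ev.self_of_nhds
  beta_reduce at ev0
  rw [ev.fderiv_eq, ev0, fderiv_const_mul dS]
  simp only [smul_apply, smul_eq_mul]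
  linear_combination (-4 * Complex.I) * main

theorem twisted_dbar_eval {θ : OneForm M} (hθ : IsLeeForm S.Jp S.Ω θ) {y : M} (hy : y ∈ U)
    (w : TangentSpace (𝓡 4) y) :
    (cdiff (fun z ↦ σ.eval z (cdiff u z) (cdiff v z)) y w
      + Complex.I * cdiff (fun z ↦ σ.eval z (cdiff u z) (cdiff v z)) y (S.Jp.J y w))
      + σ.eval y (cdiff u y) (cdiff v y)
        * ((θ.val y w : ℂ) + Complex.I * (θ.val y (S.Jp.J y w) : ℂ)) = 0 := by
  obtain ⟨ψ, hψ⟩ := S.Jp.exists_chart y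
  obtain ⟨z, hz, rfl⟩ := ψ.exists_symm hψ
  have h := S.dbar_eval ψ hσ hU hu hv hθ hz hy (ψ.D _ w)
  have hd := (S.contDiffAt_eval ψ hσ hU hu hv hz hy).differentiableAt (by simp)
  have c := fun w ↦ ψ.mfderiv_eq (f := fun z ↦ σ.eval z (cdiff u z) (cdiff v z)) hz hd w
  rw [C2.mulI_apply, ← ψ.D_J hz, ← c, ← c, ψ.pull1_apply, ψ.pull1_apply, ψ.E_D hz, ψ.E_D hz] at h
  exact h

omit hU hu hv in
theorem isHolomorphicSection {θ : OneForm M} (hθ : IsLeeForm S.Jp S.Ω θ) :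
    σ.IsHolomorphicSection S.Jp θ :=
  ⟨S.isTwoZero hσ, fun _ _ _ hU hu hv _ hy w ↦ S.twisted_dbar_eval hσ hU hu hv hθ hy w⟩

end TamedPair

end HolomorphicPoisson

/-! ### The exterior derivative of the Lee form is of type (1,1) -/

section Invariance

variable {M : Type*} [TopologicalSpace M] [ChartedSpace E4 M] [IsManifold (𝓡 4) ∞ M]

namespace HolChart

variable {J : CplxStructure M} (ψ : HolChart J)

theorem cdiff_coord {y : M} (hy : y ∈ ψ.φ.source) (j : Fin 2) (v : TangentSpace (𝓡 4) y) :
    cdiff (fun x ↦ ψ.φ x j) y v = ψ.D y v j := by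
  have h1 : MDifferentiableAt 𝓘(ℝ, C2) 𝓘(ℝ, ℂ)
      (ContinuousLinearMap.proj (R := ℝ) (φ := fun _ : Fin 2 ↦ ℂ) j) (ψ.φ y) :=
    (ContinuousLinearMap.proj (R := ℝ)
      (φ := fun _ : Fin 2 ↦ ℂ) j).differentiableAt.mdifferentiableAt
  have h := mfderiv_comp y h1 (ψ.mdiff hy)
  rw [mfderiv_eq_fderiv, ContinuousLinearMap.fderiv] at h
  exact congrArg (fun L : TangentSpace (𝓡 4) y →L[ℝ] ℂ ↦ L v) h

theorem isHolomorphicOn_coord (j : Fin 2) :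
    IsHolomorphicOn J (fun x ↦ ψ.φ x j) ψ.φ.source := by
  refine ⟨?_, fun y hy v ↦ ?_⟩
  · exact ((ContinuousLinearMap.proj (R := ℝ) (φ := fun _ : Fin 2 ↦ ℂ) j).contDiff.contMDiff
      (n := ∞)).comp_contMDiffOn ψ.smooth
  · rw [ψ.cdiff_coord hy, ψ.cdiff_coord hy]
    exact congrFun (ψ.hol y hy v) j

end HolChart

namespace TamedPair

variable (S : TamedPair M) (ψ : HolChart S.Jp) (σ : CplxBivector M)

/-- The coefficient of `σ` in a chart. -/
def coeff (t : C2) : ℂ :=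
  σ.eval (ψ.φ.symm t) (cdiff (fun x ↦ ψ.φ x 0) (ψ.φ.symm t))
    (cdiff (fun x ↦ ψ.φ x 1) (ψ.φ.symm t))

variable {σ}

/-- The hypothesis `h` says that `Λa` is of type `(0,1)` for `J₊`, whereas `Λ_re` says that it is of
type `(1,0)` for `J₋`. So `J₋ = -J₊` on its real and imaginary parts, and adjointness moves this to
the covector `a`. -/
theorem add_eq_zero_of_hamiltonian {x : M} {a : TangentSpace (𝓡 4) x →L[ℝ] ℂ}
    (ha : ∀ v, a (S.Jp.J x v) = Complex.I * a v)
    (h : S.Λ x (Complex.reCLM.comp a) = -S.Jp.J x (S.Λ x (Complex.imCLM.comp a)))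
    (w : TangentSpace (𝓡 4) x) : a (S.Jm.J x w + S.Jp.J x w) = 0 := by
  have h1 : S.Jm.J x (S.Λ x (Complex.imCLM.comp a)) =
      -S.Jp.J x (S.Λ x (Complex.imCLM.comp a)) := by rw [← S.Λ_re ha, h]
  have h2 : S.Jm.J x (S.Λ x (Complex.reCLM.comp a)) =
      -S.Jp.J x (S.Λ x (Complex.reCLM.comp a)) := by
    rw [S.Λ_re ha, S.Jm.sq, h1, map_neg, S.Jp.sq]
    simp
  have key : ∀ α : TangentSpace (𝓡 4) x →L[ℝ] ℝ, S.Jm.J x (S.Λ x α) = -S.Jp.J x (S.Λ x α) →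
      α (S.Jm.J x w + S.Jp.J x w) = 0 := fun α hα ↦ by
    have e : ∀ w, α w = S.Ω.val x (S.Λ x α) w := fun w ↦ by rw [S.Ω_Λ]
    rw [e, map_add, ← S.adj, ← S.adj', hα]
    simp
  have r := key _ h2
  have i := key _ h1
  exact Complex.ext r i

/-- If the coefficient vanishes, skewness makes both `dz₀` and `dz₁` annihilate `Λ dz₀` and `Λ dz₁`;
these fields are then of type `(0,1)` for `J₊` and `add_eq_zero_of_hamiltonian` applies. Conversely,
`J₋ = -J₊` makes `Λ dz₀` of type `(0,1)`, so `dz₁` kills it. -/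
theorem coeff_eq_zero_iff (hσ : ∀ x α β, σ.val x α β =
    β (S.Q x α) - Complex.I * β (S.Q x (α.comp (S.Jp.J x)))) {z : C2} (hz : z ∈ ψ.φ.target) :
    S.coeff ψ σ z = 0 ↔ S.Jm.J (ψ.φ.symm z) = -S.Jp.J (ψ.φ.symm z) := by
  have hy := ψ.φ.map_target hz
  have hol := fun j ↦ (ψ.isHolomorphicOn_coord j).2 _ hy
  rw [coeff, S.eval_eq hσ (hol 0) (hol 1)]
  set x := ψ.φ.symm z
  set a : Fin 2 → TangentSpace (𝓡 4) x →L[ℝ] ℂ := fun j ↦ cdiff (fun x ↦ ψ.φ x j) x with ha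
  change -4 * Complex.I * (a 1 (S.Λ x (Complex.reCLM.comp (a 0)))
    + Complex.I * a 1 (S.Λ x (Complex.imCLM.comp (a 0)))) = 0 ↔ _
  constructor
  · intro h
    have h' := (mul_eq_zero.mp h).resolve_left (by simp)
    have P : ∀ i j, a j (S.Λ x (Complex.reCLM.comp (a i)))
        + Complex.I * a j (S.Λ x (Complex.imCLM.comp (a i))) =
        (S.Ω.val x (S.Λ x (Complex.reCLM.comp (a j))) (S.Λ x (Complex.reCLM.comp (a i)))
        - S.Ω.val x (S.Λ x (Complex.imCLM.comp (a j))) (S.Λ x (Complex.imCLM.comp (a i))))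
        + Complex.I *
        (S.Ω.val x (S.Λ x (Complex.imCLM.comp (a j))) (S.Λ x (Complex.reCLM.comp (a i)))
        + S.Ω.val x (S.Λ x (Complex.reCLM.comp (a j))) (S.Λ x (Complex.imCLM.comp (a i)))) := by
      intro i j
      rw [S.Ω_Λ, S.Ω_Λ]
      apply Complex.ext <;> simp [sub_eq_add_neg]
    have van : ∀ i j, a j (S.Λ x (Complex.reCLM.comp (a i)))
        + Complex.I * a j (S.Λ x (Complex.imCLM.comp (a i))) = 0 := by
      intro i j
      have self : ∀ i, a i (S.Λ x (Complex.reCLM.comp (a i)))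
          + Complex.I * a i (S.Λ x (Complex.imCLM.comp (a i))) = 0 := fun i ↦ by
        rw [P, S.Ω.alt, S.Ω.alt, S.skew x (S.Λ x (Complex.imCLM.comp (a i)))]
        push_cast; ring
      have h10 : a 0 (S.Λ x (Complex.reCLM.comp (a 1)))
          + Complex.I * a 0 (S.Λ x (Complex.imCLM.comp (a 1))) = 0 := by
        rw [← neg_eq_zero, ← h', P, P, S.skew x (S.Λ x (Complex.reCLM.comp (a 0))),
          S.skew x (S.Λ x (Complex.imCLM.comp (a 0))), S.skew x (S.Λ x (Complex.imCLM.comp (a 0))),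
          S.skew x (S.Λ x (Complex.reCLM.comp (a 0)))]
        push_cast; ring
      fin_cases i <;> fin_cases j
      · exact self 0
      · exact h'
      · exact h10
      · exact self 1
    have ham : ∀ i, S.Λ x (Complex.reCLM.comp (a i)) =
        -S.Jp.J x (S.Λ x (Complex.imCLM.comp (a i))) := by
      intro i
      apply ψ.D_injective hy
      ext j
      have := van i j
      rw [ha] at this
      simp only [x, ψ.cdiff_coord hy] at this
      have e : ψ.D x (S.Jp.J x _) = Complex.I • ψ.D x (S.Λ x (Complex.imCLM.comp (a i))) :=
        ψ.hol x hy _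
      rw [map_neg, e]
      simp only [Pi.neg_apply, Pi.smul_apply, smul_eq_mul]
      exact eq_neg_of_add_eq_zero_left this
    ext1 w
    have : S.Jm.J x w + S.Jp.J x w = 0 := by
      apply ψ.D_injective hy
      ext j
      rw [map_zero, ← ψ.cdiff_coord hy]
      exact S.add_eq_zero_of_hamiltonian (hol j) (ham j) w
    exact eq_neg_of_add_eq_zero_left this
  · intro h
    rw [S.Λ_re (hol 0), h, neg_apply, map_neg]
    have := hol 1 (S.Λ x (Complex.imCLM.comp (a 0)))
    change a 1 _ = _ * a 1 _ at this
    rw [this]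
    ring

variable (hσ : ∀ x α β, σ.val x α β =
    β (S.Q x α) - Complex.I * β (S.Q x (α.comp (S.Jp.J x))))
include hσ

theorem contDiffAt_coeff {z : C2} (hz : z ∈ ψ.φ.target) : ContDiffAt ℝ ∞ (S.coeff ψ σ) z :=
  S.contDiffAt_eval ψ hσ ψ.φ.open_source (ψ.isHolomorphicOn_coord 0) (ψ.isHolomorphicOn_coord 1) hz
    (ψ.φ.map_target hz)

variable {θ : OneForm M} (hθ : IsLeeForm S.Jp S.Ω θ)
include hθ

theorem dbar_coeff {z : C2} (hz : z ∈ ψ.φ.target) (w : C2) :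
    fderiv ℝ (S.coeff ψ σ) z w + Complex.I * fderiv ℝ (S.coeff ψ σ) z (C2.mulI w)
      + S.coeff ψ σ z * (ψ.pull1 θ.val z w + Complex.I * ψ.pull1 θ.val z (C2.mulI w)) = 0 :=
  S.dbar_eval ψ hσ ψ.φ.open_source (ψ.isHolomorphicOn_coord 0) (ψ.isHolomorphicOn_coord 1) hθ hz
    (ψ.φ.map_target hz) w

/-- On the complex line `t ↦ y + t(z - y)` the twisted equation becomes `f_x + i f_y = bf`, so
vanishing near `t = 0` spreads to `t = 1`. -/
theorem coeff_unique_continuation {c y z : C2} {R : ℝ} (hR : Metric.ball c R ⊆ ψ.φ.target)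
    (hy : y ∈ Metric.ball c (R / 8)) (hz : z ∈ Metric.ball c (R / 8))
    (h : ∀ᶠ t in nhds y, S.coeff ψ σ t = 0) : S.coeff ψ σ z = 0 := by
  rw [mem_ball_iff_norm] at hy hz
  -- The radius `R / 8` suffices: for `‖t‖ < 2` the distance to `c` stays below `R/8 + 2 · (R/4) <
  -- R`.
  have maps : ∀ t ∈ Metric.ball (0 : ℂ) 2, y + t • (z - y) ∈ ψ.φ.target := by
    intro t ht
    apply hR
    rw [mem_ball_iff_norm]
    rw [mem_ball_zero_iff] at ht
    have h1 : ‖z - y‖ ≤ ‖z - c‖ + ‖y - c‖ := by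
      rw [show z - y = (z - c) - (y - c) by abel]; exact norm_sub_le _ _
    have h2 : ‖y + t • (z - y) - c‖ ≤ ‖y - c‖ + ‖t‖ * ‖z - y‖ := by
      rw [show y + t • (z - y) - c = (y - c) + t • (z - y) by abel, ← norm_smul]
      exact norm_add_le _ _
    nlinarith [norm_nonneg t, norm_nonneg (z - y), norm_nonneg (y - c), norm_nonneg (z - c)]
  have hl : ∀ t, HasFDerivAt (fun t : ℂ ↦ y + t • (z - y))
      ((ContinuousLinearMap.toSpanSingleton ℂ (z - y)).restrictScalars ℝ) t := fun t ↦ by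
    exact (((ContinuousLinearMap.toSpanSingleton ℂ (z - y)).restrictScalars
      ℝ).hasFDerivAt).const_add y
  have sl : ContDiff ℝ ∞ (fun t : ℂ ↦ y + t • (z - y)) := contDiff_const.add
    ((ContinuousLinearMap.toSpanSingleton ℂ (z - y)).restrictScalars ℝ).contDiff
  have sc : ContDiffOn ℝ ∞ (S.coeff ψ σ) ψ.φ.target := fun t ht ↦
    (S.contDiffAt_coeff ψ hσ ht).contDiffWithinAt
  have sθ := (ψ.contDiffOn_pull1 θ.smooth).comp sl.contDiffOn maps
  have sb : ∀ w, ContDiffOn ℝ ∞ (fun t : ℂ ↦ ((ψ.pull1 θ.val (y + t • (z - y)) w : ℝ) : ℂ))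
      (Metric.ball 0 2) := fun w ↦
    Complex.ofRealCLM.contDiff.comp_contDiffOn (sθ.clm_apply contDiffOn_const)
  obtain ⟨r, r0, hr⟩ : ∃ r > 0, ∀ t ∈ Metric.ball (0 : ℂ) r, S.coeff ψ σ (y + t • (z - y)) = 0 := by
    have : Filter.Tendsto (fun t : ℂ ↦ y + t • (z - y)) (nhds 0) (nhds y) := by
      have := (hl 0).continuousAt
      simpa [ContinuousAt] using this
    exact Metric.eventually_nhds_iff_ball.mp (this.eventually h)
  have := dbar_unique_continuation (f := fun t ↦ S.coeff ψ σ (y + t • (z - y)))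
    (b := fun t ↦ -((ψ.pull1 θ.val (y + t • (z - y)) (z - y) : ℝ)
      + Complex.I * (ψ.pull1 θ.val (y + t • (z - y)) (C2.mulI (z - y)) : ℝ))) one_lt_two r0
    ((sc.comp sl.contDiffOn maps).of_le (by norm_cast))
    (((sb _).add (contDiffOn_const.mul (sb _))).neg.of_le (by norm_cast)) (fun t ht ↦ ?_) hr
  · simpa using this
  · have d := ((S.contDiffAt_coeff ψ hσ (maps t ht)).differentiableAt (by simp)).hasFDerivAt.comp t
      (hl t)
    have e := S.dbar_coeff ψ hσ hθ (maps t ht) (z - y)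
    rw [show fderiv ℝ (fun t ↦ S.coeff ψ σ (y + t • (z - y))) t = _ from d.fderiv]
    simp only [ContinuousLinearMap.comp_apply, ContinuousLinearMap.coe_restrictScalars',
      ContinuousLinearMap.toSpanSingleton_apply, one_smul]
    rw [C2.mulI_apply] at e ⊢
    linear_combination e

/-- The interior of the locus `J₋ = -J₊` is also closed, by unique continuation, so on a connected
manifold it is empty or everything. -/
theorem dense_ne_neg [ConnectedSpace M] (hne : ∃ x : M, S.Jm.J x ≠ -S.Jp.J x) :
    Dense {x : M | S.Jm.J x ≠ -S.Jp.J x} := by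
  rw [show {x : M | S.Jm.J x ≠ -S.Jp.J x} = {x : M | S.Jm.J x = -S.Jp.J x}ᶜ from rfl,
    ← interior_eq_empty_iff_dense_compl]
  set Z := interior {x : M | S.Jm.J x = -S.Jp.J x} with hZ
  have cl : IsClosed Z := by
    refine isClosed_of_closure_subset fun x hx ↦ ?_
    obtain ⟨ψ, hψ⟩ := S.Jp.exists_chart x
    obtain ⟨R, R0, hR⟩ := Metric.isOpen_iff.mp ψ.φ.open_target (ψ.φ x) (ψ.φ.map_source hψ)
    have nb : ψ.φ.source ∩ ψ.φ ⁻¹' Metric.ball (ψ.φ x) (R / 8) ∈ nhds x :=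
      Filter.inter_mem (ψ.φ.open_source.mem_nhds hψ)
        ((ψ.φ.continuousAt hψ).preimage_mem_nhds (Metric.ball_mem_nhds _ (by positivity)))
    obtain ⟨y, hy, hyZ⟩ := mem_closure_iff_nhds.mp hx _ nb
    have near : ∀ᶠ t in nhds (ψ.φ y), S.coeff ψ σ t = 0 := by
      have c := ψ.φ.continuousAt_symm (ψ.φ.map_source hy.1)
      rw [ContinuousAt, ψ.φ.left_inv hy.1] at c
      filter_upwards [c.eventually (isOpen_interior.mem_nhds hyZ),
        ψ.φ.open_target.mem_nhds (ψ.φ.map_source hy.1)] with t h1 h2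
      exact (S.coeff_eq_zero_iff ψ hσ h2).mpr
        (interior_subset h1 : ψ.φ.symm t ∈ {x : M | S.Jm.J x = -S.Jp.J x})
    rw [hZ, mem_interior_iff_mem_nhds]
    filter_upwards [nb] with y' hy'
    have h0 := S.coeff_unique_continuation ψ hσ hθ hR hy.2 hy'.2 near
    have := (S.coeff_eq_zero_iff ψ hσ (ψ.φ.map_source hy'.1)).mp h0
    rw [ψ.φ.left_inv hy'.1] at this
    exact this
  rcases isClopen_iff.mp ⟨cl, isOpen_interior⟩ with h | h
  · exact h
  · obtain ⟨x, hx⟩ := hne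
    exact absurd (interior_subset (h ▸ Set.mem_univ x : x ∈ Z)) hx

-- Failure of invariance at one point would persist on an open set by continuity, and that set
-- contains a point where the coefficient of `σ` is nonzero, against `extd1_invariant`.
set_option maxSynthPendingDepth 5 in
theorem extd1_lee_invariant [ConnectedSpace M] (hne : ∃ x : M, S.Jm.J x ≠ -S.Jp.J x) {z : C2}
    (hz : z ∈ ψ.φ.target) (v w : C2) :
    extd1 (ψ.pull1 θ.val) z (Complex.I • v) (Complex.I • w) = extd1 (ψ.pull1 θ.val) z v w := by
  by_contra hc
  have T := (ψ.contDiffAt_oneForm θ hz).fderiv_right (m := ∞) (by simp)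
  have cont : ∀ v w, ContinuousAt (fun t ↦ extd1 (ψ.pull1 θ.val) t v w) z := fun v w ↦ by
    have h : ∀ v w, ContinuousAt (fun t ↦ fderiv ℝ (ψ.pull1 θ.val) t v w) z := fun v w ↦
      ((T.clm_apply contDiffAt_const).clm_apply contDiffAt_const).continuousAt
    exact (h v w).sub (h w v)
  have ev := ((cont (Complex.I • v) (Complex.I • w)).sub (cont v w)).eventually_ne
    (sub_ne_zero.mpr hc)
  have nb := Filter.inter_mem ev (ψ.φ.open_target.mem_nhds hz)
  have nb' : ψ.φ.symm '' _ ∈ nhds (ψ.φ.symm z) :=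
    ψ.φ.symm.image_mem_nhds hz nb
  obtain ⟨x, hx, ⟨t, ht, rfl⟩⟩ := (S.dense_ne_neg hσ hθ hne).inter_nhds_nonempty nb'
  refine ht.1 (sub_eq_zero.mpr ?_)
  refine extd1_invariant C2.mulI ((S.contDiffAt_coeff ψ hσ ht.2).of_le (by norm_cast))
    ((ψ.contDiffAt_oneForm θ ht.2).differentiableAt (by simp))
    (fun h ↦ hx ((S.coeff_eq_zero_iff ψ hσ ht.2).mp h)) ?_ v w
  filter_upwards [ψ.φ.open_target.mem_nhds ht.2] with s hs w
  exact S.dbar_coeff ψ hσ hθ hs w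

/-- `dθ ∧ dθ ≤ 0`, with equality only where `dθ = 0`. -/
theorem wedge22_lee_nonpos [ConnectedSpace M] (hne : ∃ x : M, S.Jm.J x ≠ -S.Jp.J x) {z : C2}
    (hz : z ∈ ψ.φ.target) :
    wedge22 (extd1 (ψ.pull1 θ.val) z) (extd1 (ψ.pull1 θ.val) z)
        (C2.basis 0) (C2.basis 1) (C2.basis 2) (C2.basis 3) ≤ 0 ∧
      (wedge22 (extd1 (ψ.pull1 θ.val) z) (extd1 (ψ.pull1 θ.val) z)
        (C2.basis 0) (C2.basis 1) (C2.basis 2) (C2.basis 3) = 0 →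
        extd1 (ψ.pull1 θ.val) z = 0) := by
  refine wedge22_self_nonpos (Ω := ψ.pull2 S.Ω.val z) (fun v ↦ by rw [extd1_apply, sub_self])
    (ψ.pull2_alt S.Ω z) (S.extd1_lee_invariant ψ hσ hθ hne hz) (fun v hv ↦ ?_) ?_
  · rw [ψ.pull2_apply, ψ.E_I hz]
    refine S.tame _ _ fun h ↦ hv ?_
    rw [← ψ.D_E hz v, h, map_zero]
  · refine wedge22_extd1_eq_zero ((ψ.contDiffAt_twoForm S.Ω hz).of_le (by norm_cast))
      ((ψ.contDiffAt_oneForm θ hz).differentiableAt (by simp))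
      (Filter.Eventually.of_forall fun t v ↦ ψ.pull2_alt S.Ω t v) ?_ _ _ _ _
    filter_upwards [ψ.φ.open_target.mem_nhds hz] with t ht
    exact hθ ψ t ht

end TamedPair

end Invariance

/-! ### Stokes' theorem on a compact complex surface -/

section Integration

open MeasureTheory

/-- The identity `dη ∧ dθ = d(η ∧ dθ)`, written as a divergence so that it can be integrated term by
term. -/
theorem wedge22_extd1_extd1 {V : Type*} [NormedAddCommGroup V] [NormedSpace ℝ V]
    {η θ : V → V →L[ℝ] ℝ} {x : V} (hη : DifferentiableAt ℝ η x) (hθ : ContDiffAt ℝ 2 θ x)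
    (a b c d : V) :
    wedge22 (extd1 η x) (extd1 θ x) a b c d =
      fderiv ℝ (fun y ↦ wedge12 (η y) (extd1 θ y) b c d) x a
      - fderiv ℝ (fun y ↦ wedge12 (η y) (extd1 θ y) a c d) x b
      + fderiv ℝ (fun y ↦ wedge12 (η y) (extd1 θ y) a b d) x c
      - fderiv ℝ (fun y ↦ wedge12 (η y) (extd1 θ y) a b c) x d := by
  have T2 := hθ.hasFDerivAt_fderiv
  have h0 := fun v ↦ hη.hasFDerivAt.apply_vector v
  have h1 : ∀ v w, HasFDerivAt (fun y ↦ extd1 θ y v w) _ x := fun v w ↦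
    ((T2.apply_vector v).apply_vector w).sub ((T2.apply_vector w).apply_vector v)
  have h2 : ∀ a b c, HasFDerivAt (fun y ↦ wedge12 (η y) (extd1 θ y) a b c) _ x := fun a b c ↦
    (((h0 a).mul (h1 b c)).add ((h0 b).mul (h1 c a))).add ((h0 c).mul (h1 a b))
  rw [(h2 _ _ _).fderiv, (h2 _ _ _).fderiv, (h2 _ _ _).fderiv, (h2 _ _ _).fderiv]
  simp only [wedge22, extd1_apply, add_apply, sub_apply, smul_apply, smul_eq_mul,
    ContinuousLinearMap.flip_apply, fderiv_fderiv_symm hθ b a, fderiv_fderiv_symm hθ c a,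
    fderiv_fderiv_symm hθ d a, fderiv_fderiv_symm hθ c b, fderiv_fderiv_symm hθ d b,
    fderiv_fderiv_symm hθ d c]
  ring

theorem ContinuousOn.integrableOn_of_eq_zero_off_compact {E : Type*} [TopologicalSpace E]
    [T2Space E] [MeasurableSpace E] [BorelSpace E] {μ : Measure E} [IsFiniteMeasureOnCompacts μ]
    {T K : Set E} (hT : IsOpen T) (hK : IsCompact K) (hKT : K ⊆ T) {f : E → ℝ}
    (hf : ContinuousOn f T) (h0 : ∀ x ∈ T \ K, f x = 0) : IntegrableOn f T μ :=
  ((hf.mono hKT).integrableOn_compact hK).of_forall_sdiff_eq_zero hT.measurableSet h0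

variable {E : Type*} [NormedAddCommGroup E] [NormedSpace ℝ E]

theorem fderiv_eq_zero_off_compact {F : Type*} [NormedAddCommGroup F] [NormedSpace ℝ F]
    {T K : Set E} (hT : IsOpen T) (hK : IsCompact K) {f : E → F} (h0 : ∀ x ∈ T \ K, f x = 0) {x : E}
    (hx : x ∈ T \ K) : fderiv ℝ f x = 0 := by
  have e : f =ᶠ[nhds x] fun _ ↦ 0 := by
    filter_upwards [(hT.sdiff hK.isClosed).mem_nhds hx] with y hy using h0 y hy
  rw [e.fderiv_eq, fderiv_const_apply]

variable [MeasurableSpace E] [BorelSpace E] {μ : Measure E} [FiniteDimensional ℝ E]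
  [μ.IsAddHaarMeasure]

theorem HasCompactSupport.integral_fderiv_eq_zero {f : E → ℝ} (hf : ContDiff ℝ 1 f)
    (hc : HasCompactSupport f) (v : E) : ∫ x, fderiv ℝ f x v ∂μ = 0 := by
  have h1 : Integrable (fun x ↦ fderiv ℝ f x v) μ :=
    Continuous.integrable_of_hasCompactSupport
      ((hf.continuous_fderiv (by simp)).clm_apply continuous_const) (hc.fderiv_apply (𝕜 := ℝ) v)
  have := integral_mul_fderiv_eq_neg_fderiv_mul_of_integrable (μ := μ) (f := fun _ : E ↦ (1 : ℝ))
    (g := f) (v := v) (by simp) (by simpa using h1)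
    (by simpa using hf.continuous.integrable_of_hasCompactSupport hc) (by simp)
    (fun x _ ↦ hf.differentiable (by simp) x)
  simpa using this

/-- Extension by zero outside `T` is differentiable on the whole space with compact support. -/
theorem setIntegral_fderiv_eq_zero {T K : Set E} (hT : IsOpen T) (hK : IsCompact K) (hKT : K ⊆ T)
    {f : E → ℝ} (hf : ContDiffOn ℝ 1 f T) (h0 : ∀ x ∈ T \ K, f x = 0) (v : E) :
    ∫ x in T, fderiv ℝ f x v ∂μ = 0 := by
  have z : ∀ x ∉ K, T.indicator f x = 0 := fun x hx ↦ by
    by_cases hxT : x ∈ T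
    · rw [Set.indicator_of_mem hxT, h0 x ⟨hxT, hx⟩]
    · rw [Set.indicator_of_notMem hxT]
  have e : ∀ x ∈ T, T.indicator f =ᶠ[nhds x] f := fun x hx ↦ by
    filter_upwards [hT.mem_nhds hx] with y hy using Set.indicator_of_mem hy f
  have smooth : ContDiff ℝ 1 (T.indicator f) := by
    rw [contDiff_iff_contDiffAt]
    intro x
    by_cases hx : x ∈ T
    · exact (hf.contDiffAt (hT.mem_nhds hx)).congr_of_eventuallyEq (e x hx)
    · refine (contDiffAt_const (c := (0 : ℝ))).congr_of_eventuallyEq ?_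
      filter_upwards [hK.isClosed.isOpen_compl.mem_nhds fun h ↦ hx (hKT h)] with y hy using z y hy
  have h := HasCompactSupport.integral_fderiv_eq_zero (μ := μ) smooth (.intro hK z) v
  rw [← setIntegral_eq_integral_of_forall_compl_eq_zero (s := T) fun x hx ↦ ?_] at h
  · rw [← h]
    exact setIntegral_congr_fun hT.measurableSet fun x hx ↦ by
      simp only [(e x hx).fderiv_eq]
  · rw [fderiv_eq_zero_off_compact isOpen_univ hK (fun x hx ↦ z x hx.2)
      ⟨Set.mem_univ x, fun h ↦ hx (hKT h)⟩, zero_apply]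

theorem setIntegral_wedge22_extd1_eq_zero {T K : Set E} (hT : IsOpen T) (hK : IsCompact K)
    (hKT : K ⊆ T) {η θ : E → E →L[ℝ] ℝ} (hη : ContDiffOn ℝ ∞ η T) (hθ : ContDiffOn ℝ ∞ θ T)
    (h0 : ∀ x ∈ T \ K, η x = 0) (a b c d : E) :
    ∫ x in T, wedge22 (extd1 η x) (extd1 θ x) a b c d ∂μ = 0 := by
  have hθ' := hθ.fderiv_of_isOpen (m := ∞) hT (by simp)
  have s1 : ∀ v w, ContDiffOn ℝ ∞ (fun y ↦ extd1 θ y v w) T := fun v w ↦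
    ((hθ'.clm_apply contDiffOn_const).clm_apply contDiffOn_const).sub
      ((hθ'.clm_apply contDiffOn_const).clm_apply contDiffOn_const)
  have s0 : ∀ v, ContDiffOn ℝ ∞ (fun y ↦ η y v) T := fun v ↦ hη.clm_apply contDiffOn_const
  have s : ∀ a b c, ContDiffOn ℝ ∞ (fun y ↦ wedge12 (η y) (extd1 θ y) a b c) T := fun a b c ↦
    (((s0 a).mul (s1 b c)).add ((s0 b).mul (s1 c a))).add ((s0 c).mul (s1 a b))
  have z : ∀ a b c, ∀ x ∈ T \ K, wedge12 (η x) (extd1 θ x) a b c = 0 := fun a b c x hx ↦ by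
    simp [wedge12, h0 x hx]
  have I : ∀ a b c v, ∫ x in T, fderiv ℝ (fun y ↦ wedge12 (η y) (extd1 θ y) a b c) x v ∂μ = 0 :=
    fun a b c v ↦ setIntegral_fderiv_eq_zero hT hK hKT ((s a b c).of_le (by norm_cast)) (z a b c) v
  have J : ∀ a b c v, IntegrableOn
      (fun x ↦ fderiv ℝ (fun y ↦ wedge12 (η y) (extd1 θ y) a b c) x v) T μ := fun a b c v ↦ by
    refine ContinuousOn.integrableOn_of_eq_zero_off_compact hT hK hKT ?_ fun x hx ↦ ?_
    · exact (((s a b c).fderiv_of_isOpen (m := ∞) hT (by simp)).clm_apply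
        contDiffOn_const).continuousOn
    · rw [fderiv_eq_zero_off_compact hT hK (z a b c) hx, zero_apply]
  rw [setIntegral_congr_fun hT.measurableSet fun x hx ↦ wedge22_extd1_extd1
    ((hη.contDiffAt (hT.mem_nhds hx)).differentiableAt (by simp))
    ((hθ.contDiffAt (hT.mem_nhds hx)).of_le (by norm_cast)) a b c d]
  have lin : ∀ {A B C D : E → ℝ}, IntegrableOn A T μ → IntegrableOn B T μ → IntegrableOn C T μ →
      IntegrableOn D T μ → ∫ x in T, A x ∂μ = 0 → ∫ x in T, B x ∂μ = 0 → ∫ x in T, C x ∂μ = 0 →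
      ∫ x in T, D x ∂μ = 0 → ∫ x in T, A x - B x + C x - D x ∂μ = 0 := by
    intro A B C D hA hB hC hD a b c d
    have k1 : IntegrableOn (fun x ↦ A x - B x) T μ := hA.sub hB
    have k2 : IntegrableOn (fun x ↦ A x - B x + C x) T μ := k1.add hC
    rw [integral_sub k2 hD, integral_add k1 hC, integral_sub hA hB, a, b, c, d]
    simp
  exact lin (J _ _ _ _) (J _ _ _ _) (J _ _ _ _) (J _ _ _ _) (I _ _ _ _) (I _ _ _ _) (I _ _ _ _)
    (I _ _ _ _)

end Integration

/-- The real determinant of a complex linear map is the squared modulus of its complex determinant.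
Hence holomorphic transition maps preserve orientation and the change of variables formula needs no
sign. -/
theorem det_nonneg_of_commutes {L : C2 →L[ℝ] C2}
    (hL : ∀ v, L (Complex.I • v) = Complex.I • L v) : 0 ≤ L.det := by
  let L' : C2 →ₗ[ℂ] C2 :=
    { toFun := L
      map_add' := map_add L
      map_smul' := fun c v ↦ by
        have e : ∀ v : C2, c • v = c.re • v + c.im • Complex.I • v := fun v ↦ by
          conv_lhs => rw [← Complex.re_add_im c, add_smul, mul_smul]
          rfl
        rw [RingHom.id_apply, e, map_add, map_smul, map_smul, hL, e] }
  have : (L : C2 →ₗ[ℝ] C2) = L'.restrictScalars ℝ := rfl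
  rw [ContinuousLinearMap.det, this, LinearMap.det_restrictScalars, Algebra.norm_complex_apply]
  exact Complex.normSq_nonneg _

/-! ### Integrals of 4-forms over holomorphic charts and the global Stokes argument -/

section Stokes

open MeasureTheory

variable {M : Type*} [TopologicalSpace M] [ChartedSpace E4 M] [IsManifold (𝓡 4) ∞ M]

theorem OneForm.exists_smul (J : CplxStructure M) (θ : OneForm M) {ρ : M → ℝ}
    (hρ : ContMDiff (𝓡 4) 𝓘(ℝ, ℝ) ∞ ρ) : ∃ η : OneForm M, ∀ x, η.val x = ρ x • θ.val x := by
  refine ⟨⟨fun x ↦ ρ x • θ.val x, fun x ↦ ?_⟩, fun x ↦ rfl⟩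
  obtain ⟨ψ, hψ⟩ := J.exists_chart x
  obtain ⟨z, hz, rfl⟩ := ψ.exists_symm hψ
  refine ψ.contMDiffAt_of_pull1 hψ ?_
  rw [ψ.φ.right_inv hz]
  exact (ψ.contDiffAt_comp_symm hz hρ.contMDiffAt).smul (ψ.contDiffAt_oneForm θ hz)

namespace HolChart

variable {J : CplxStructure M} (ψ χ : HolChart J)

/-- The coefficient of `dα ∧ dβ` in a chart. -/
def density (α β : OneForm M) (z : C2) : ℝ :=
  wedge22 (extd1 (ψ.pull1 α.val) z) (extd1 (ψ.pull1 β.val) z)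
    (C2.basis 0) (C2.basis 1) (C2.basis 2) (C2.basis 3)

variable (α β : OneForm M)

theorem continuousOn_density : ContinuousOn (ψ.density α β) ψ.φ.target := by
  have h : ∀ (α : OneForm M) v w, ContinuousOn (fun z ↦ extd1 (ψ.pull1 α.val) z v w) ψ.φ.target :=
    fun α v w ↦ by
    have h' := ((ψ.contDiffOn_pull1 α.smooth).fderiv_of_isOpen (m := ∞) ψ.φ.open_target
      (by simp)).continuousOn
    exact ((h'.clm_apply continuousOn_const).clm_apply continuousOn_const).sub
      ((h'.clm_apply continuousOn_const).clm_apply continuousOn_const)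
  unfold density wedge22
  exact ((((((h _ _ _).mul (h _ _ _)).sub ((h _ _ _).mul (h _ _ _))).add
    ((h _ _ _).mul (h _ _ _))).add ((h _ _ _).mul (h _ _ _))).sub ((h _ _ _).mul (h _ _ _))).add
    ((h _ _ _).mul (h _ _ _))

theorem extd1_transition {z : C2} (hz : z ∈ ψ.φ.target) (hχ : ψ.φ.symm z ∈ χ.φ.source) (v w : C2) :
    extd1 (ψ.pull1 α.val) z v w = extd1 (χ.pull1 α.val) (χ.φ (ψ.φ.symm z))
      (fderiv ℝ (fun t ↦ χ.φ (ψ.φ.symm t)) z v) (fderiv ℝ (fun t ↦ χ.φ (ψ.φ.symm t)) z w) := by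
  refine extd1_pullback (η := χ.pull1 α.val) (τ := fun t ↦ χ.φ (ψ.φ.symm t))
    ((χ.contDiffAt_oneForm α (χ.φ.map_source hχ)).differentiableAt (by simp))
    ((ψ.contDiffAt_oneForm α hz).differentiableAt (by simp))
    ((contDiffAt_transition ψ χ hz hχ).of_le (by norm_cast)) ?_ v w
  filter_upwards [eventually_mem_source ψ χ hz hχ] with t ht w
  exact pull1_transition ψ χ α.val ht.1 ht.2 w

theorem abs_det_transition {z : C2} (hz : z ∈ ψ.φ.target) (hχ : ψ.φ.symm z ∈ χ.φ.source) :
    |(fderiv ℝ (fun t ↦ χ.φ (ψ.φ.symm t)) z).det| =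
      (fderiv ℝ (fun t ↦ χ.φ (ψ.φ.symm t)) z).det := by
  refine abs_of_nonneg (det_nonneg_of_commutes fun v ↦ ?_)
  rw [fderiv_transition ψ χ hz hχ, fderiv_transition ψ χ hz hχ, ψ.E_I hz]
  exact χ.hol _ hχ _

theorem density_transition {z : C2} (hz : z ∈ ψ.φ.target) (hχ : ψ.φ.symm z ∈ χ.φ.source) :
    ψ.density α β z = |(fderiv ℝ (fun t ↦ χ.φ (ψ.φ.symm t)) z).det| *
      χ.density α β (χ.φ (ψ.φ.symm z)) := by
  rw [abs_det_transition ψ χ hz hχ, density, density, ContinuousLinearMap.det,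
    ← wedge22_map C2.basis (fun v ↦ by rw [extd1_apply, sub_self])
      (fun v ↦ by rw [extd1_apply, sub_self])]
  simp only [wedge22, extd1_transition ψ χ _ hz hχ, ContinuousLinearMap.coe_coe]

theorem extd1_eq_zero {z : C2} (hz : z ∈ ψ.φ.target)
    (h : ∀ᶠ y in nhds (ψ.φ.symm z), α.val y = 0) : extd1 (ψ.pull1 α.val) z = 0 := by
  have e : ψ.pull1 α.val =ᶠ[nhds z] fun _ ↦ 0 := by
    filter_upwards [(ψ.φ.continuousAt_symm hz).eventually h] with t ht
    rw [pull1, ht, ContinuousLinearMap.zero_comp]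
  ext v w
  rw [extd1_apply, e.fderiv_eq, fderiv_const_apply]
  simp

theorem density_eq_zero {z : C2} (hz : z ∈ ψ.φ.target)
    (h : ∀ᶠ y in nhds (ψ.φ.symm z), α.val y = 0) : ψ.density α β z = 0 := by
  rw [density, ψ.extd1_eq_zero α hz h]
  simp [wedge22]

theorem density_sum {ι : Type*} [Fintype ι] (η : ι → OneForm M)
    (h : ∀ x, α.val x = ∑ i, (η i).val x) {z : C2} (hz : z ∈ ψ.φ.target) :
    ψ.density α β z = ∑ i, ψ.density (η i) β z := by
  have e : ψ.pull1 α.val = fun t ↦ ∑ i, ψ.pull1 (η i).val t := by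
    ext t w
    rw [pull1_apply, h, sum_apply, sum_apply]
    rfl
  have d : fderiv ℝ (ψ.pull1 α.val) z = ∑ i, fderiv ℝ (ψ.pull1 (η i).val) z := by
    rw [e]
    exact fderiv_fun_sum fun i _ ↦ (ψ.contDiffAt_oneForm (η i) hz).differentiableAt (by simp)
  have e' : ∀ v w, extd1 (ψ.pull1 α.val) z v w = ∑ i, extd1 (ψ.pull1 (η i).val) z v w := by
    intro v w
    simp only [extd1_apply, d, sum_apply, Finset.sum_sub_distrib]
  simp only [density, wedge22, e', Finset.sum_add_distrib, Finset.sum_sub_distrib, Finset.sum_mul]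

/-- Integrals of 4-forms do not depend on the chart. -/
theorem setIntegral_transition (a : M → ℝ) :
    ∫ z in ψ.φ.target ∩ ψ.φ.symm ⁻¹' χ.φ.source, a (ψ.φ.symm z) * ψ.density α β z =
      ∫ z in χ.φ.target ∩ χ.φ.symm ⁻¹' ψ.φ.source, a (χ.φ.symm z) * χ.density α β z := by
  have im : (fun t ↦ χ.φ (ψ.φ.symm t)) '' (ψ.φ.target ∩ ψ.φ.symm ⁻¹' χ.φ.source) =
      χ.φ.target ∩ χ.φ.symm ⁻¹' ψ.φ.source := by
    ext z
    constructor
    · rintro ⟨t, ⟨ht, hχ⟩, rfl⟩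
      refine ⟨χ.φ.map_source hχ, ?_⟩
      simp only [Set.mem_preimage, χ.φ.left_inv hχ]
      exact ψ.φ.map_target ht
    · rintro ⟨hz, hψ⟩
      refine ⟨ψ.φ (χ.φ.symm z), ⟨ψ.φ.map_source hψ, ?_⟩, ?_⟩
      · simp only [Set.mem_preimage, ψ.φ.left_inv hψ]
        exact χ.φ.map_target hz
      · simp only [ψ.φ.left_inv hψ, χ.φ.right_inv hz]
  have meas : MeasurableSet (ψ.φ.target ∩ ψ.φ.symm ⁻¹' χ.φ.source) :=
    (ψ.φ.symm.isOpen_inter_preimage χ.φ.open_source).measurableSet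
  rw [← im, integral_image_eq_integral_abs_det_fderiv_smul volume meas
    (fun z hz ↦ ((contDiffAt_transition ψ χ hz.1 hz.2).differentiableAt
      (by simp)).hasFDerivAt.hasFDerivWithinAt)]
  · refine setIntegral_congr_fun meas fun z hz ↦ ?_
    simp only [smul_eq_mul, density_transition ψ χ α β hz.1 hz.2, χ.φ.left_inv hz.2]
    ring
  · intro z hz t ht h
    have := χ.φ.injOn hz.2 ht.2 h
    exact ψ.φ.symm.injOn hz.1 ht.1 this

theorem setIntegral_density_eq_zero {K : Set M} (hK : IsCompact K) (hKs : K ⊆ ψ.φ.source)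
    (h : ∀ x ∉ K, α.val x = 0) : ∫ z in ψ.φ.target, ψ.density α β z = 0 := by
  refine setIntegral_wedge22_extd1_eq_zero (K := ψ.φ '' K) ψ.φ.open_target
    (hK.image_of_continuousOn (ψ.φ.continuousOn.mono hKs)) ?_ (ψ.contDiffOn_pull1 α.smooth)
    (ψ.contDiffOn_pull1 β.smooth) (fun z hz ↦ ?_) _ _ _ _
  · rintro _ ⟨y, hy, rfl⟩
    exact ψ.φ.map_source (hKs hy)
  · rw [pull1, h, ContinuousLinearMap.zero_comp]
    exact fun hk ↦ hz.2 ⟨_, hk, ψ.φ.right_inv hz.1⟩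

theorem integrableOn_mul_density {K : Set M} (hK : IsCompact K) (hKs : K ⊆ ψ.φ.source) {a : M → ℝ}
    (ha : Continuous a) (h : ∀ z ∈ ψ.φ.target, ψ.φ.symm z ∉ K →
      a (ψ.φ.symm z) * ψ.density α β z = 0) :
    IntegrableOn (fun z ↦ a (ψ.φ.symm z) * ψ.density α β z) ψ.φ.target := by
  refine ContinuousOn.integrableOn_of_eq_zero_off_compact (K := ψ.φ '' K) ψ.φ.open_target
    (hK.image_of_continuousOn (ψ.φ.continuousOn.mono hKs)) ?_
    ((ha.comp_continuousOn ψ.φ.continuousOn_symm).mul (ψ.continuousOn_density α β)) (fun z hz ↦ ?_)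
  · rintro _ ⟨y, hy, rfl⟩
    exact ψ.φ.map_source (hKs hy)
  · exact h z hz.1 fun hk ↦ hz.2 ⟨_, hk, ψ.φ.right_inv hz.1⟩

end HolChart

variable [T2Space M] [CompactSpace M]

/-- If `dθ ∧ dθ ≤ 0` on a compact complex surface, then `dθ ∧ dθ = 0`. -/
theorem density_self_eq_zero (J : CplxStructure M) (θ : OneForm M)
    (h : ∀ (ψ : HolChart J), ∀ z ∈ ψ.φ.target, ψ.density θ θ z ≤ 0) (x : M) :
    ∃ ψ : HolChart J, x ∈ ψ.φ.source ∧ ψ.density θ θ (ψ.φ x) = 0 := by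
  choose χ hχ using J.exists_chart
  obtain ⟨t, -, ht⟩ := (isCompact_univ (X := M)).elim_nhds_subcover (fun x ↦ (χ x).φ.source)
    fun x _ ↦ (χ x).φ.open_source.mem_nhds (hχ x)
  let ψ : t → HolChart J := fun i ↦ χ i
  obtain ⟨ρ, hρ⟩ := SmoothPartitionOfUnity.exists_isSubordinate (𝓡 4) (isClosed_univ (X := M))
    (fun i : t ↦ (ψ i).φ.source) (fun i ↦ (ψ i).φ.open_source) (by
      intro y hy
      obtain ⟨i, hi, hy'⟩ := Set.mem_iUnion₂.mp (ht hy)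
      exact Set.mem_iUnion.mpr ⟨⟨i, hi⟩, hy'⟩)
  have sum : ∀ y, ∑ i, ρ i y = 1 := fun y ↦ by
    rw [← finsum_eq_sum_of_fintype]; exact ρ.sum_eq_one (Set.mem_univ y)
  have K : ∀ i, IsCompact (tsupport (ρ i)) := fun i ↦ (isClosed_tsupport _).isCompact
  have cont : ∀ j, Continuous (ρ j) := fun j ↦ (ρ j).contMDiff.continuous
  have off : ∀ i, ∀ y ∉ tsupport (ρ i), ρ i y = 0 := fun i y hy ↦
    image_eq_zero_of_notMem_tsupport hy
  have near : ∀ i, ∀ y ∉ tsupport (ρ i), ∀ᶠ y' in nhds y, ρ i y' = 0 := fun i y hy ↦ by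
    filter_upwards [(isClosed_tsupport (ρ i)).isOpen_compl.mem_nhds hy] with y' hy'
    exact off i y' hy'
  -- The pieces `η k = ρ k • θ` sum to `θ`, and each is supported inside a single chart.
  choose η hη using fun i ↦ θ.exists_smul J (ρ i).contMDiff
  have hsum : ∀ y, θ.val y = ∑ i, (η i).val y := fun y ↦ by
    simp only [hη, ← Finset.sum_smul, sum, one_smul]
  have ηz : ∀ (φ : HolChart J) k, ∀ z ∈ φ.φ.target, φ.φ.symm z ∉ tsupport (ρ k) →
      φ.density (η k) θ z = 0 := fun φ k z hz hk ↦ by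
    refine φ.density_eq_zero _ _ hz ?_
    filter_upwards [near k _ hk] with y hy
    rw [hη, hy, zero_smul]
  have int : ∀ j, ∫ z in (ψ j).φ.target, ρ j ((ψ j).φ.symm z) * (ψ j).density θ θ z =
      ∑ k, ∫ z in (ψ j).φ.target, ρ j ((ψ j).φ.symm z) * (ψ j).density (η k) θ z := fun j ↦ by
    rw [← integral_finsetSum]
    · refine setIntegral_congr_fun (ψ j).φ.open_target.measurableSet fun z hz ↦ ?_
      simp only [(ψ j).density_sum θ θ η hsum hz, Finset.mul_sum]
    · intro k _
      exact (ψ j).integrableOn_mul_density _ _ (K j) (hρ j) (cont j) fun z _ hk ↦ by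
        rw [off j _ hk, zero_mul]
  -- The integrand is supported in the overlap of the two charts, since `ρ j` vanishes off one and
  -- `η k` off the other; it can therefore be moved from chart `j` to chart `k`.
  have change : ∀ j k, ∫ z in (ψ j).φ.target, ρ j ((ψ j).φ.symm z) * (ψ j).density (η k) θ z =
      ∫ z in (ψ k).φ.target, ρ j ((ψ k).φ.symm z) * (ψ k).density (η k) θ z := fun j k ↦ by
    rw [setIntegral_eq_of_subset_of_forall_sdiff_eq_zero (ψ j).φ.open_target.measurableSet
      (Set.inter_subset_left (t := (ψ j).φ.symm ⁻¹' (ψ k).φ.source)) fun z hz ↦ ?_,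
      HolChart.setIntegral_transition (ψ j) (ψ k) (η k) θ (ρ j),
      ← setIntegral_eq_of_subset_of_forall_sdiff_eq_zero (ψ k).φ.open_target.measurableSet
      (Set.inter_subset_left (t := (ψ k).φ.symm ⁻¹' (ψ j).φ.source)) fun z hz ↦ ?_]
    · rw [off j _ fun hk ↦ hz.2 ⟨hz.1, hρ j hk⟩, zero_mul]
    · rw [ηz _ k z hz.1 fun hk ↦ hz.2 ⟨hz.1, hρ k hk⟩, mul_zero]
  -- After the move, summing over `j` first removes the cut-offs `ρ j`, and each remaining integral
  -- of `dη_k ∧ dθ` vanishes by Stokes in chart `k`.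
  have total : ∑ j, ∫ z in (ψ j).φ.target, ρ j ((ψ j).φ.symm z) * (ψ j).density θ θ z = 0 := by
    rw [Finset.sum_congr rfl fun j _ ↦ (int j).trans (Finset.sum_congr rfl fun k _ ↦ change j k),
      Finset.sum_comm]
    refine Finset.sum_eq_zero fun k _ ↦ ?_
    rw [← integral_finsetSum]
    · simp only [← Finset.sum_mul, sum, one_mul]
      exact (ψ k).setIntegral_density_eq_zero _ _ (K k) (hρ k) fun y hy ↦ by
        rw [hη, off k y hy, zero_smul]
    · intro j _
      exact (ψ k).integrableOn_mul_density _ _ (K k) (hρ k) (cont j) fun z hz hk ↦ by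
        rw [ηz _ k z hz hk, mul_zero]
  have sign : ∀ j, ∀ z ∈ (ψ j).φ.target, ρ j ((ψ j).φ.symm z) * (ψ j).density θ θ z ≤ 0 :=
    fun j z hz ↦ mul_nonpos_of_nonneg_of_nonpos (ρ.nonneg j _) (h _ z hz)
  -- Nonpositive integrals with zero sum vanish one by one; a continuous integrand of constant sign
  -- is then zero everywhere, and at `x` some `ρ j` can be divided out.
  have each := (Finset.sum_eq_zero_iff_of_nonpos fun j _ ↦
    setIntegral_nonpos (ψ j).φ.open_target.measurableSet (sign j)).mp total
  obtain ⟨j, hj⟩ : ∃ j, ρ j x ≠ 0 := by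
    by_contra! h0
    have := sum x
    simp [h0] at this
  have hx : x ∈ (ψ j).φ.source := hρ j (subset_tsupport _ hj)
  refine ⟨ψ j, hx, ?_⟩
  have ioi := (ψ j).integrableOn_mul_density θ θ (K j) (hρ j) (cont j) fun z _ hk ↦ by
    rw [off j _ hk, zero_mul]
  have e : ∫ z in (ψ j).φ.target, -(ρ j ((ψ j).φ.symm z) * (ψ j).density θ θ z) = 0 := by
    rw [integral_neg, each j (Finset.mem_univ j), neg_zero]
  rw [setIntegral_eq_zero_iff_of_nonneg_ae (ae_restrict_of_forall_mem
    (ψ j).φ.open_target.measurableSet fun z hz ↦ neg_nonneg.mpr (sign j z hz)) ioi.neg] at e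
  have co : ContinuousOn (fun z ↦ -(ρ j ((ψ j).φ.symm z) * (ψ j).density θ θ z))
      (ψ j).φ.target :=
    (((cont j).comp_continuousOn (ψ j).φ.continuousOn_symm).mul
      ((ψ j).continuousOn_density θ θ)).neg
  have := Measure.eqOn_open_of_ae_eq e (ψ j).φ.open_target co continuousOn_const
    ((ψ j).φ.map_source hx)
  simp only [Pi.zero_apply, neg_eq_zero, (ψ j).φ.left_inv hx] at this
  exact (mul_eq_zero.mp this).resolve_left hj

end Stokes

/-! ### Closedness of the Lee form -/

section ClosedLeeForm

variable {M : Type*} [TopologicalSpace M] [ChartedSpace E4 M] [IsManifold (𝓡 4) ∞ M]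
  [T2Space M] [CompactSpace M] [ConnectedSpace M]

/-- The Lee form of a tamed pair is closed. -/
theorem TamedPair.isClosed_lee (S : TamedPair M) {σ : CplxBivector M} (hσ : ∀ x α β, σ.val x α β =
    β (S.Q x α) - Complex.I * β (S.Q x (α.comp (S.Jp.J x)))) {θ : OneForm M}
    (hθ : IsLeeForm S.Jp S.Ω θ) (hne : ∃ x : M, S.Jm.J x ≠ -S.Jp.J x) : θ.IsClosed := by
  intro X Y hX hY x
  obtain ⟨ψ, hψ, h0⟩ := density_self_eq_zero S.Jp θ
    (fun ψ z hz ↦ (S.wedge22_lee_nonpos ψ hσ hθ hne hz).1) x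
  obtain ⟨z, hz, rfl⟩ := ψ.exists_symm hψ
  rw [ψ.φ.right_inv hz] at h0
  rw [ψ.d_oneForm θ hX hY hz, (S.wedge22_lee_nonpos ψ hσ hθ hne hz).2 h0]
  simp

end ClosedLeeForm

end

/-! ### Assembly of the data on the complex surface -/

theorem mainTheorem3 (M : Type*) [TopologicalSpace M] [T2Space M] [CompactSpace M]
    [ConnectedSpace M] [ChartedSpace E4 M] [IsManifold (𝓡 4) ∞ M] (B : BiHermitian M)
    (hne : ∀ x : M, B.Jp.J x ≠ B.Jm.J x) (hne' : ∃ x : M, B.Jp.J x ≠ -B.Jm.J x) :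
    ∃ (θ : OneForm M) (σ : CplxBivector M) (Ω : TwoForm M)
      (Q : ∀ x : M, (TangentSpace (𝓡 4) x →L[ℝ] ℝ) →L[ℝ] TangentSpace (𝓡 4) x),
      -- the data `θ`, `σ`, `Q = Re σ`, `Ω` on the complex surface `(M, J₊)`
      θ.IsClosed ∧ σ.IsHolomorphicSection B.Jp θ ∧ σ.IsRealPart Q ∧
      Ω.IsTwistedClosed θ ∧ Ω.IsTaming B.Jp ∧ SatisfiesQuadraticEq Ω B.Jp Q ∧
      -- `J₋ = -J₊ - Q Ω`
      (∀ (x : M) (v : TangentSpace (𝓡 4) x), B.Jm.J x v = -B.Jp.J x v - Q x (Ω.val x v)) ∧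
      -- `c = [g]` with `g = -½ Ω (J₊ - J₋)`
      ∃ g : RMetric M, g.conformalClass = B.c ∧
        ∀ (x : M) (v w : TangentSpace (𝓡 4) x),
          g.inner x v w = -(1 / 2) * Ω.val x (B.Jp.J x v - B.Jm.J x v) w := by
  obtain ⟨g, Ω, hg, adj, tame, gΩ⟩ := B.exists_twoForm hne
  let S : TamedPair M := ⟨B.Jp, B.Jm, Ω, adj, tame⟩
  obtain ⟨θ, hθ⟩ := exists_isLeeForm B.Jp S.nondegenerate
  obtain ⟨σ, hσ⟩ := S.exists_cplxBivector
  have hS : ∃ x : M, S.Jm.J x ≠ -S.Jp.J x := by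
    obtain ⟨x, hx⟩ := hne'
    exact ⟨x, fun h ↦ hx (by rw [show B.Jm.J x = -B.Jp.J x from h, neg_neg])⟩
  exact ⟨θ, σ, Ω, S.Q, S.isClosed_lee hσ hθ hS, S.isHolomorphicSection hσ hθ, S.isRealPart hσ,
    hθ.isTwistedClosed, S.isTaming, S.satisfiesQuadraticEq, S.Jm_eq, g, hg, gΩ⟩
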